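/- **Setting.** Let $X=\mathcal{O}_{\mathbb{P}^1}(-1,-1,0)$, with contraction $X\to Y=\operatorname{Spec}\mathbb{C}[x,y,z,w,u]/(xy-zw)$. A perverse coherent system is a pair $I=(\mathcal{O}_X\xrightarrow{s}F)$ with $F\in\mathrm{Per}(X/Y)$ compactly supported. Via $V_0=\mathrm{Hom}(\mathcal{O}_X,F)$, $V_1=\mathrm{Hom}(\mathcal{O}_X(1),F)$, $v=s\in V_0$, it is the same as a finite-dimensional representation of the quiver with arrows $a_1,a_2:0\to1$, $b_1,b_2:1\to0$, loops $c$ at $0$ and $d$ at $1$, relations $a_2b_ia_1=a_1b_ia_2$, $b_2a_ib_1=b_1a_ib_2$, $da_i=a_ic$, $cb_i=b_id$, together with a vector $v\in V_0$. Put $n=\chi(F)=\dim V_0$ and $d=d(F)=\dim V_0-\dim V_1$. For $\Theta=(\theta_0,\theta_1)\in\mathbb{R}^2$ and $\Theta(V)=\theta_0\dim V_0+\theta_1\dim V_1$, the system is $\Theta$-stable if $\Theta(V')<0$ for every nonzero subrepresentation $V'\subseteq V$, and $\Theta(V')<\Theta(V)$ for every proper subrepresentation $V'\subsetneq V$ that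 contains $v$; it is $\Theta$-semistable if the same holds with $\le$. **Invariants.** Let $T_0=\{t\in(\mathbb{C}^*)^4: t_0t_1t_2t_3=1\}$ act so that $a_1,a_2,b_1,b_2,c,d$ have weights $t_1,t_2,1,t_0,t_3,t_3$. Let $\lambda_i$ be the equivariant parameter of $t_i$, so that $\lambda_0+\lambda_1+\lambda_2+\lambda_3=0$, let $m$ be the equivariant parameter of an additional $\mathbb{C}^*$ acting trivially, with $e^m$ the trivial line bundle of weight $m$, and let $\Lambda=\mathbb{Q}(\lambda_0,\lambda_1,\lambda_2,m)$. For a $T_0$-fixed $\Theta'$-stable system $I$, with its canonical equivariant structure and a choice of sign $\pm1$, put $$w(I)=\pm\, e_{T_0}\big(-\chi_X(F)+\chi_X(F,F)^{1/2}\big)\cdot e_{T_0\times\mathbb{C}^*}\big(\chi_X(F)^\vee\otimes e^m\big)\in\Lambda ,$$ where $V^{1/2}$ denotes a class in $K^{T_0}(\mathrm{pt})$ with $V^{1/2}+\overline{V^{1/2}}=V$, and $\overline{(\cdot)}$ inverts the characters. For $\Theta'$ outside the walls below, let $P^{\Theta'}_n(X,d)^{T_0}$ be the set of isomorphism classes of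 $T_0$-fixed $\Theta'$-stable systems with invariants $(n,d)$, and let $P^{\Theta'}_{n,d}(e^m)=\sum_{I\in P^{\Theta'}_n(X,d)^{T_0}}w(I)$. Since these sets are empty unless $n\ge0$ and $d\le n$, the series $\sum_{n,d}P^{\Theta'}_{n,d}(e^m)q^nt^d$ lies in $\Lambda[[qt,t^{-1}]]$. **Walls.** These are $$L^-_\mp(k)=\{\theta_0\lessgtr\theta_1,\ k\theta_0+(k-1)\theta_1=0\}\ (k\ge1),\qquad L^+_\mp(k)=\{\theta_0\lessgtr\theta_1,\ k\theta_0+(k+1)\theta_1=0\}\ (k\ge0),$$ where the lower sign $-$ goes with $\theta_0<\theta_1$ and the lower sign $+$ with $\theta_0>\theta_1$, and $L_\mp(\infty)=\{\theta_0\lessgtr\theta_1,\ \theta_0+\theta_1=0\}$. For $\Theta=(\theta_0,\theta_1)$ on a wall $L^\pm_\pm(k)$, let $\Theta_\pm=(\theta_0\mp0^+,\theta_1)$ lie in the two adjacent chambers; for $k=0$, where the wall lies on the line $\theta_1=0$, let $\Theta_\pm=(\theta_0,\theta_1\mp0^+)$ instead. Let $S_{k-1}$ be $\mathcal{O}_{\mathbb{P}^1}(k-1)$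 on $L^-_-(k)$, $\mathcal{O}_{\mathbb{P}^1}(-k-1)[1]$ on $L^+_-(k)$, $\Upsilon_0(\mathcal{O}_{\mathbb{P}^1}(-k-1)[1])$ on $L^-_+(k)$ and $\Upsilon_0(\mathcal{O}_{\mathbb{P}^1}(k-1))$ on $L^+_+(k)$, where $\Upsilon_0$ is the flop equivalence. It has invariants $(n,d)=(k,1)$ on $L^-_\pm(k)$ and $(k,-1)$ on $L^+_\pm(k)$. **Conjecture.** For every $\Theta$ on a wall $L^-_\pm(k)$ ($k\ge1$) or $L^+_\pm(k)$ ($k\ge0$) and every $T_0$-fixed $\Theta$-stable $I_0$, let $\pi_\pm^{-1}(P^{I_0}_{k-1,r})$ be the set of $T_0$-fixed $\Theta_\pm$-stable $I$ that are S-equivalent, with respect to $\Theta$-semistability, to $I_0\oplus S_{k-1}^{\oplus r}[-1]$. Then there are choices of signs such that $$\frac{\sum_{r\ge0}u^r\sum_{I\in\pi_+^{-1}(P^{I_0}_{k-1,r})}w(I)}{\sum_{r\ge0}u^r\sum_{I\in\pi_-^{-1}(P^{I_0}_{k-1,r})}w(I)}=(1-u)^{k\frac{m}{\lambda_3}},$$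 where $u=t$ on $L^-_\pm(k)$ and $u=t^{-1}$ on $L^+_\pm(k)$. The identity is read as numerator $=$ denominator $\cdot\,(1-u)^{km/\lambda_3}$ in $\Lambda[[u]]$. **Proposition 3.8 (wall-crossing formula).** Assume the Conjecture. Then: * If $\Theta\in L^-_-(k)$ or $\Theta\in L^-_+(k)$, $k\ge1$, there are choices of signs such that $$\frac{\sum_{n,d}P^{\Theta_+}_{n,d}(e^m)q^nt^d}{\sum_{n,d}P^{\Theta_-}_{n,d}(e^m)q^nt^d}=(1-q^kt)^{k\frac{m}{\lambda_3}}.$$ * If $\Theta\in L^+_-(k)$ or $\Theta\in L^+_+(k)$, $k\ge0$, there are choices of signs such that $$\frac{\sum_{n,d}P^{\Theta_+}_{n,d}(e^m)q^nt^d}{\sum_{n,d}P^{\Theta_-}_{n,d}(e^m)q^nt^d}=(1-q^kt^{-1})^{k\frac{m}{\lambda_3}}.$$ Here the sums over fixed points are finite, the denominators are invertible in $\Lambda[[qt,t^{-1}]]$, and $(1-u)^\alpha=\sum_r(-1)^r\binom{\alpha}{r}u^r$. -/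

import Mathlib

noncomputable section

namespace WallCrossing

open Matrix

/-! ### Representations of the quiver with relations

The quiver `Q` of `X = 𝒪_{ℙ¹}(-1,-1,0)` has vertices `0, 1`, arrows `a₁, a₂ : 0 → 1`,
`b₁, b₂ : 1 → 0` and loops `c` at `0`, `d` at `1`.  The index `0 : Fin 2` stands for the
subscript `1` and the index `1 : Fin 2` for the subscript `2`.  Compactly supported objects `F` of
`Per(X/Y)` are the finite dimensional representations of `(Q, I)`, through
`V₀ = Hom(𝒪_X, F)` and `V₁ = Hom(𝒪_X(1), F)`. -/

/-- The closed subscheme of representations of `(Q, I)` inside the space of representations of `Q`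
with dimension vector `(d₀, d₁)` (its complex points). -/
structure QRep (d₀ d₁ : ℕ) where
  a : Fin 2 → Matrix (Fin d₁) (Fin d₀) ℂ
  b : Fin 2 → Matrix (Fin d₀) (Fin d₁) ℂ
  c : Matrix (Fin d₀) (Fin d₀) ℂ
  d : Matrix (Fin d₁) (Fin d₁) ℂ
  rel_aba : ∀ i, a 1 * b i * a 0 = a 0 * b i * a 1
  rel_bab : ∀ i, b 1 * a i * b 0 = b 0 * a i * b 1
  rel_da : ∀ i, d * a i = a i * c
  rel_cb : ∀ i, c * b i = b i * d

/-- Representations of the framed quiver `(Q̃, I)` with `V_∞ = ℂ` and dimension vector `(d₀, d₁)` at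
the other vertices; the arrow `∞ → 0` is the vector `v`.  These are the perverse coherent systems
`(F, s : 𝒪_X → F)` with `χ(F) = d₀` and `d(F) = d₀ - d₁`. -/
structure FramedRep (d₀ d₁ : ℕ) extends QRep d₀ d₁ where
  v : Fin d₀ → ℂ

variable {d₀ d₁ e₀ e₁ s₀ s₁ : ℕ}

/-- A subrepresentation of an unframed representation. -/
structure SubRep (V : QRep d₀ d₁) where
  W₀ : Submodule ℂ (Fin d₀ → ℂ)
  W₁ : Submodule ℂ (Fin d₁ → ℂ)
  a_mem : ∀ i, ∀ x ∈ W₀, V.a i *ᵥ x ∈ W₁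
  b_mem : ∀ i, ∀ x ∈ W₁, V.b i *ᵥ x ∈ W₀
  c_mem : ∀ x ∈ W₀, V.c *ᵥ x ∈ W₀
  d_mem : ∀ x ∈ W₁, V.d *ᵥ x ∈ W₁

/-- The subrepresentation is zero. -/
def SubRep.IsZero {V : QRep d₀ d₁} (W : SubRep V) : Prop := W.W₀ = ⊥ ∧ W.W₁ = ⊥

/-- The subrepresentation is everything. -/
def SubRep.IsAll {V : QRep d₀ d₁} (W : SubRep V) : Prop := W.W₀ = ⊤ ∧ W.W₁ = ⊤

/-- `Θ(V₀', V₁') = θ₀ dim V₀' + θ₁ dim V₁'` for a subrepresentation. -/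
def SubRep.slope {V : QRep d₀ d₁} (W : SubRep V) (Θ : ℝ × ℝ) : ℝ :=
  Θ.1 * (Module.finrank ℂ W.W₀ : ℝ) + Θ.2 * (Module.finrank ℂ W.W₁ : ℝ)

/-- `Θ`-stability of a framed representation with `V_∞ = ℂ`.  A subrepresentation
`(V₀', V₁', V_∞' = ℂ)` is a subrepresentation of the unframed quiver that contains the framing
vector. -/
def FramedRep.IsStable (V : FramedRep d₀ d₁) (Θ : ℝ × ℝ) : Prop :=
  (∀ W : SubRep V.toQRep, ¬ W.IsZero → W.slope Θ < 0) ∧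
  (∀ W : SubRep V.toQRep, V.v ∈ W.W₀ → ¬ W.IsAll →
    W.slope Θ < Θ.1 * (d₀ : ℝ) + Θ.2 * (d₁ : ℝ))

/-- Isomorphism of framed representations (identity on `V_∞ = ℂ`): being in the same orbit of
`GL(V₀) × GL(V₁)`. -/
def FramedRep.Iso (V U : FramedRep d₀ d₁) : Prop :=
  ∃ (g₀ : GL (Fin d₀) ℂ) (g₁ : GL (Fin d₁) ℂ),
    (∀ i, g₁.1 * V.a i = U.a i * g₀.1) ∧ (∀ i, g₀.1 * V.b i = U.b i * g₁.1) ∧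
    g₀.1 * V.c = U.c * g₀.1 ∧ g₁.1 * V.d = U.d * g₁.1 ∧ g₀.1 *ᵥ V.v = U.v

theorem inv_intertwine {m n : ℕ} (g : GL (Fin m) ℂ) (h : GL (Fin n) ℂ)
    {A B : Matrix (Fin m) (Fin n) ℂ} (e : g.1 * A = B * h.1) :
    (g⁻¹).1 * B = A * (h⁻¹).1 := by
  have h1 : (g⁻¹).1 * g.1 = 1 := by simp
  have h2 : h.1 * (h⁻¹).1 = 1 := by simp
  calc (g⁻¹).1 * B = (g⁻¹).1 * (B * h.1) * (h⁻¹).1 := by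
        rw [Matrix.mul_assoc, Matrix.mul_assoc, h2, Matrix.mul_one]
    _ = A * (h⁻¹).1 := by rw [← e, ← Matrix.mul_assoc, h1, Matrix.one_mul]

theorem comp_intertwine {m n : ℕ} (g g' : GL (Fin m) ℂ) (h h' : GL (Fin n) ℂ)
    {A B C : Matrix (Fin m) (Fin n) ℂ} (e : g.1 * A = B * h.1) (e' : g'.1 * B = C * h'.1) :
    (g' * g).1 * A = C * (h' * h).1 := by
  rw [Units.val_mul, Units.val_mul, Matrix.mul_assoc, e, ← Matrix.mul_assoc, e',
    Matrix.mul_assoc]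

theorem FramedRep.Iso.equivalence : Equivalence (FramedRep.Iso (d₀ := d₀) (d₁ := d₁)) where
  refl V := ⟨1, 1, by simp⟩
  symm := by
    rintro V U ⟨g₀, g₁, ha, hb, hc, hd, hv⟩
    refine ⟨g₀⁻¹, g₁⁻¹, fun i => inv_intertwine _ _ (ha i), fun i => inv_intertwine _ _ (hb i),
      inv_intertwine _ _ hc, inv_intertwine _ _ hd, ?_⟩
    have h1 : (g₀⁻¹).1 * g₀.1 = 1 := by simp
    rw [← hv, Matrix.mulVec_mulVec, h1, Matrix.one_mulVec]
  trans := by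
    rintro V U T ⟨g₀, g₁, ha, hb, hc, hd, hv⟩ ⟨g₀', g₁', ha', hb', hc', hd', hv'⟩
    refine ⟨g₀' * g₀, g₁' * g₁, fun i => comp_intertwine _ _ _ _ (ha i) (ha' i),
      fun i => comp_intertwine _ _ _ _ (hb i) (hb' i), comp_intertwine _ _ _ _ hc hc',
      comp_intertwine _ _ _ _ hd hd', ?_⟩
    rw [Units.val_mul, ← Matrix.mulVec_mulVec, hv, hv']

/-- The `GL(V₀) × GL(V₁)`-orbits. -/
def FramedRep.setoid (d₀ d₁ : ℕ) : Setoid (FramedRep d₀ d₁) :=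
  ⟨FramedRep.Iso, FramedRep.Iso.equivalence⟩

/-- Isomorphism classes of framed representations, of all dimension vectors. -/
def IsoClass : Type := Σ p : ℕ × ℕ, Quotient (FramedRep.setoid p.1 p.2)

/-- `dim V₀`. -/
def IsoClass.dim₀ (I : IsoClass) : ℕ := I.1.1

/-- `dim V₁`. -/
def IsoClass.dim₁ (I : IsoClass) : ℕ := I.1.2

/-- A representative of the isomorphism class. -/
def IsoClass.rep (I : IsoClass) : FramedRep I.dim₀ I.dim₁ := Quotient.out I.2

/-! ### The torus -/

/-- The torus `T₀ = {(t₀, t₁, t₂, t₃) : t₀ t₁ t₂ t₃ = 1}`. -/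
def T₀ : Set (Fin 4 → ℂˣ) := {t | ∏ i, t i = 1}

/-- The action of the torus on framed representations.  On `X`, `t₁, t₂, t₃` are the weights of the
fibre coordinates of `N = 𝒪(-Z_∞) ⊗ t₁⁻¹ ⊕ 𝒪(-Z_∞) ⊗ t₂⁻¹ ⊕ 𝒪 ⊗ t₃⁻¹` and `1, t₀` those of the
sections of `𝒪_{ℙ¹}(Z_∞)`; hence the arrows `a₁, a₂, b₁, b₂, c, d` have weights
`t₁, t₂, 1, t₀, t₃, t₃`. -/
def FramedRep.act (t : Fin 4 → ℂˣ) (V : FramedRep d₀ d₁) : FramedRep d₀ d₁ where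
  a i := (![t 1, t 2] i : ℂ) • V.a i
  b i := (![1, t 0] i : ℂ) • V.b i
  c := (t 3 : ℂ) • V.c
  d := (t 3 : ℂ) • V.d
  v := V.v
  rel_aba i := by
    simp only [Matrix.smul_mul, Matrix.mul_smul, smul_smul, V.rel_aba]
    congr 1
    ring
  rel_bab i := by
    simp only [Matrix.smul_mul, Matrix.mul_smul, smul_smul, V.rel_bab]
    congr 1
    ring
  rel_da i := by
    simp only [Matrix.smul_mul, Matrix.mul_smul, smul_smul, V.rel_da]
    congr 1
    ring
  rel_cb i := by
    simp only [Matrix.smul_mul, Matrix.mul_smul, smul_smul, V.rel_cb]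
    congr 1
    ring

/-- The isomorphism class of `V` is a `T₀`-fixed point. -/
def FramedRep.IsTorusFixed (V : FramedRep d₀ d₁) : Prop := ∀ t ∈ T₀, (V.act t).Iso V

/-- `⋃_{n,d} P^Θ_n(X, d)^{T₀}` for `Θ` outside the walls: the isomorphism classes of `Θ`-stable
perverse coherent systems that are fixed by `T₀`. -/
def fixedPoints (Θ : ℝ × ℝ) : Set IsoClass := {I | I.rep.IsStable Θ ∧ I.rep.IsTorusFixed}

/-- `n = χ(F)`. -/
def IsoClass.n (I : IsoClass) : ℤ := I.dim₀

/-- `d = d(F) = dim V₀ - dim V₁`, i.e. `[F] = d [ℙ¹]`. -/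
def IsoClass.deg (I : IsoClass) : ℤ := (I.dim₀ : ℤ) - (I.dim₁ : ℤ)

/-! ### Equivariant K-theory of a point and Euler classes -/

/-- The character lattice of `T₀`: `t₀, t₁, t₂` are a basis and `t₃ = (t₀ t₁ t₂)⁻¹`. -/
abbrev Chr : Type := Fin 3 → ℤ

/-- The characters `t₀, t₁, t₂, t₃` of `T₀`. -/
def tchr : Fin 4 → Chr := ![![1, 0, 0], ![0, 1, 0], ![0, 0, 1], ![-1, -1, -1]]

/-- `K^{T₀}(pt) = ℤ[t₀^±, t₁^±, t₂^±, t₃^±] / (t₀ t₁ t₂ t₃ - 1)`, the group ring of the character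
lattice. -/
abbrev KT : Type := AddMonoidAlgebra ℤ Chr

/-- The class of the one-dimensional representation with character `w`. -/
def KT.chr (w : Chr) : KT := AddMonoidAlgebra.single w 1

/-- The involution `t^w ↦ t^{-w}` (dual representation). -/
def KT.dual : KT →+* KT := AddMonoidAlgebra.mapDomainRingHom ℤ (negAddMonoidHom (α := Chr))

/-- `R` is a square root of `V`: `R + R̄ = V`. -/
def KT.IsSqrt (R V : KT) : Prop := R + KT.dual R = V

/-- The field `Λ = ℚ(λ₀, λ₁, λ₂, m)`, i.e. rational functions in `λ₀, λ₁, λ₂, λ₃, m` modulo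
`λ₀ + λ₁ + λ₂ + λ₃ = 0`. -/
abbrev Lam : Type := FractionRing (MvPolynomial (Fin 4) ℚ)

/-- The variables of `Λ`: `λ₀, λ₁, λ₂` have indices `0, 1, 2`, and `m` has index `3`. -/
def Lam.var (i : Fin 4) : Lam := algebraMap (MvPolynomial (Fin 4) ℚ) Lam (MvPolynomial.X i)

/-- The equivariant parameter of a trivial line bundle of `ℂ^*`-weight `m`. -/
def Lam.m : Lam := Lam.var 3

/-- `λ₃ = -(λ₀ + λ₁ + λ₂)`. -/
def Lam.l₃ : Lam := -(Lam.var 0 + Lam.var 1 + Lam.var 2)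

/-- The equivariant Euler (first Chern) class of the character `w`. -/
def lamOf (w : Chr) : Lam := w 0 * Lam.var 0 + w 1 * Lam.var 1 + w 2 * Lam.var 2

/-- `e_{T₀}(V) = ∏_w (λ·w)^{n_w}` for `V = ∑_w n_w t^w`. -/
def eulerT (V : KT) : Lam := V.coeff.prod fun w n => lamOf w ^ n

/-- `e_{T₀ × ℂ^*}(V ⊗ e^m) = ∏_w (m + λ·w)^{n_w}` for `V = ∑_w n_w t^w`. -/
def eulerTm (V : KT) : Lam := V.coeff.prod fun w n => (Lam.m + lamOf w) ^ n

/-- A `T₀`-equivariant structure on a framed representation `V`, for which the framing is invariant: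
bases of `V₀`, `V₁` of weight vectors, i.e. a representation `rep` isomorphic to `V` and characters
`w₀`, `w₁` of the basis vectors such that the matrix of each arrow is homogeneous of the weight of
the arrow and the framing vector has weight `0`.  It exists for `T₀`-fixed stable `V`, and is unique
up to isomorphism since `V` has no automorphism. -/
structure EquivariantStructure (V : FramedRep d₀ d₁) where
  rep : FramedRep d₀ d₁
  iso : V.Iso rep
  w₀ : Fin d₀ → Chr
  w₁ : Fin d₁ → Chr
  a_wt : ∀ i p q, rep.a i p q ≠ 0 → w₁ p = w₀ q + ![tchr 1, tchr 2] i
  b_wt : ∀ i p q, rep.b i p q ≠ 0 → w₀ p = w₁ q + ![0, tchr 0] i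
  c_wt : ∀ p q, rep.c p q ≠ 0 → w₀ p = w₀ q + tchr 3
  d_wt : ∀ p q, rep.d p q ≠ 0 → w₁ p = w₁ q + tchr 3
  v_wt : ∀ p, rep.v p ≠ 0 → w₀ p = 0

namespace EquivariantStructure

variable {V : FramedRep d₀ d₁} (E : EquivariantStructure V)

/-- The class of `V₀`.  Since `V₀ = RHom(𝒪_X, F)`, this is `χ_X(F)`. -/
def K₀ : KT := ∑ i, KT.chr (E.w₀ i)

/-- The class of `V₁ = RHom(𝒪_X(Z_∞), F)`. -/
def K₁ : KT := ∑ i, KT.chr (E.w₁ i)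

/-- The equivariant Euler pairing of `F` with itself on the 3-fold `Z = 𝒪_{ℙ¹}(-1,-1)`, after push
forward along `X → Z`: the Euler characteristic of the complex of `T₀`-representations
`⨁_v Hom(V_v, V_v) → ⨁_{arrows i→j} Hom(V_i, V_j) → ⨁_{relations i→j} Hom(V_i, V_j) →
⨁_v Hom(V_v, V_v)` that comes from the bimodule resolution of the Jacobi algebra of the conifold
quiver (arrows `a₁, a₂, b₁, b₂`).  The summand of an arrow, of a relation, and the last term are
twisted by the inverse weight of that arrow, of that relation (`t₁ t₂ · {1, t₀}` for
`a₂ b_i a₁ = a₁ b_i a₂` and `t₀ · {t₁, t₂}` for `b₂ a_i b₁ = b₁ a_i b₂`), and of the potential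
(`t₀ t₁ t₂`). -/
def chiZ : KT :=
  (KT.dual E.K₀ * E.K₀ + KT.dual E.K₁ * E.K₁)
  - (KT.dual E.K₀ * E.K₁ * (KT.chr (-tchr 1) + KT.chr (-tchr 2))
      + KT.dual E.K₁ * E.K₀ * (1 + KT.chr (-tchr 0)))
  + (KT.dual E.K₀ * E.K₁ * (KT.chr (-tchr 1 - tchr 2) * (1 + KT.chr (-tchr 0)))
      + KT.dual E.K₁ * E.K₀ * (KT.chr (-tchr 0) * (KT.chr (-tchr 1) + KT.chr (-tchr 2))))
  - (KT.dual E.K₀ * E.K₀ + KT.dual E.K₁ * E.K₁) * KT.chr (-tchr 0 - tchr 1 - tchr 2)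

/-- The equivariant Euler pairing `χ_X(F, F)` on `X = Z × ℂ`: the algebra of `(Q, I)` is the
Jacobi algebra of the conifold quiver tensored with `ℂ[c]`, and `c` has weight `t₃`. -/
def chiX : KT := E.chiZ * (1 - KT.chr (-tchr 3))

/-- The square root `χ_X(I, I)₀^{1/2} = -χ_X(F) + χ_X(F, F)^{1/2}`, with `χ_X(F, F)^{1/2} = χ_Z`.
Another square root changes the Euler class at most by a sign. -/
def sqrtChi : KT := -E.K₀ + E.chiZ

theorem chiZ_isSqrt : KT.IsSqrt E.chiZ E.chiX := by
  have hd : ∀ w : Chr, KT.dual (KT.chr w) = KT.chr (-w) := by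
    intro w
    simp [KT.dual, KT.chr]
  have hm : ∀ v w : Chr, KT.chr (v + w) = KT.chr v * KT.chr w := by
    intro v w
    simp [KT.chr, AddMonoidAlgebra.single_mul_single]
  have hdd : ∀ x : KT, KT.dual (KT.dual x) = x := by
    intro x
    have : KT.dual.comp KT.dual = RingHom.id KT := by
      ext <;> simp [KT.dual]
    exact congrArg (fun f : KT →+* KT => f x) this
  have h3 : tchr 3 = -tchr 0 + -tchr 1 + -tchr 2 := by
    funext i
    fin_cases i <;> simp [tchr]
  have hone : ∀ w : Chr, KT.chr w * KT.chr (-w) = 1 := by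
    intro w
    rw [← hm, add_neg_cancel]
    rfl
  have h0 := hone (tchr 0)
  have h1 := hone (tchr 1)
  have h2 := hone (tchr 2)
  unfold KT.IsSqrt chiX chiZ
  rw [h3]
  simp only [sub_eq_add_neg, map_add, map_neg, map_mul, map_one, hm, hd, hdd, neg_add, neg_neg]
  generalize KT.chr (tchr 0) = x0 at *
  generalize KT.chr (tchr 1) = x1 at *
  generalize KT.chr (tchr 2) = x2 at *
  generalize KT.chr (-tchr 0) = y0 at *
  generalize KT.chr (-tchr 1) = y1 at *
  generalize KT.chr (-tchr 2) = y2 at *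
  generalize KT.dual E.K₀ = p at *
  generalize KT.dual E.K₁ = q at *
  generalize E.K₀ = u at *
  generalize E.K₁ = v at *
  clear hd hm hdd h3 hone
  grind

/-- `e_{T₀}(χ_X(I,I)₀^{1/2}) · e_{T₀ × ℂ^*}(χ_X(F)^∨ ⊗ e^m)`. -/
def contribution : Lam := eulerT E.sqrtChi * eulerTm (KT.dual E.K₀)

end EquivariantStructure

open Classical in
/-- The contribution of a `T₀`-fixed stable framed representation, up to sign, computed with its
equivariant structure. -/
def FramedRep.contribution (V : FramedRep d₀ d₁) : Lam :=
  if h : Nonempty (EquivariantStructure V) then h.some.contribution else 0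

/-- A choice of sign for each torus fixed point. -/
abbrev Signs : Type := IsoClass → ℤˣ

/-- The signed contribution of a torus fixed point. -/
def weight (σ : Signs) (I : IsoClass) : Lam := ((σ I : ℤ) : Lam) * I.rep.contribution

/-- The set `P^Θ_n(X, d)^{T₀}`. -/
def fixedPointsOf (Θ : ℝ × ℝ) (n d : ℤ) : Set IsoClass :=
  {I | I ∈ fixedPoints Θ ∧ I.n = n ∧ I.deg = d}

/-- The tautological invariant `P^Θ_{n,d}(e^m)`, for a choice of signs. -/
def tautInv (Θ : ℝ × ℝ) (σ : Signs) (n d : ℤ) : Lam :=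
  ∑ᶠ I ∈ fixedPointsOf Θ n d, weight σ I

/-- The exponent of `q^n t^d`, for `0 ≤ n` and `d ≤ n`, in the ring `Λ⟦qt, t⁻¹⟧` of power series in
`qt` (variable `0`) and `t⁻¹` (variable `1`): `q^n t^d = (qt)^n (t⁻¹)^{n-d}`. -/
def qtExp (n : ℕ) (d : ℤ) : Fin 2 →₀ ℕ :=
  Finsupp.single 0 n + Finsupp.single 1 ((n : ℤ) - d).toNat

/-- `∑_{n,d} P^Θ_{n,d}(e^m) q^n t^d` in `Λ⟦qt, t⁻¹⟧`; the coefficient of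
`(qt)^i (t⁻¹)^j = q^i t^{i-j}` is `P^Θ_{i,i-j}(e^m)`.  (There are no `F` with `n < 0` or `d > n`,
because `n = dim V₀` and `n - d = dim V₁`.) -/
def genSeries (Θ : ℝ × ℝ) (σ : Signs) : MvPowerSeries (Fin 2) Lam :=
  fun e => tautInv Θ σ (e 0) ((e 0 : ℤ) - (e 1 : ℤ))

/-- The binomial series `(1 - u)^α = ∑_r (-1)^r (α choose r) u^r`. -/
def oneSubPow (α : Lam) : PowerSeries Lam :=
  PowerSeries.mk fun r => (-1) ^ r * (∏ i ∈ Finset.range r, (α - (i : Lam))) / (r.factorial : Lam)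

/-- The series `(1 - q^n t^d)^α` in `Λ⟦qt, t⁻¹⟧`, for `0 ≤ n`, `d ≤ n`, `(n, d) ≠ (0, 0)`. -/
def oneSubQTPow (n : ℕ) (d : ℤ) (α : Lam) : MvPowerSeries (Fin 2) Lam :=
  PowerSeries.subst (MvPowerSeries.monomial (qtExp n d) (1 : Lam)) (oneSubPow α)

/-! ### Walls -/

/-- `L^-_-(k)`, for `k ≥ 1`. -/
def LmMinus (k : ℕ) : Set (ℝ × ℝ) := {Θ | Θ.1 < Θ.2 ∧ (k : ℝ) * Θ.1 + ((k : ℝ) - 1) * Θ.2 = 0}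

/-- `L^-_+(k)`, for `k ≥ 1`. -/
def LpMinus (k : ℕ) : Set (ℝ × ℝ) := {Θ | Θ.2 < Θ.1 ∧ (k : ℝ) * Θ.1 + ((k : ℝ) - 1) * Θ.2 = 0}

/-- `L^+_-(k)`, for `k ≥ 0`. -/
def LmPlus (k : ℕ) : Set (ℝ × ℝ) := {Θ | Θ.1 < Θ.2 ∧ (k : ℝ) * Θ.1 + ((k : ℝ) + 1) * Θ.2 = 0}

/-- `L^+_+(k)`, for `k ≥ 0`. -/
def LpPlus (k : ℕ) : Set (ℝ × ℝ) := {Θ | Θ.2 < Θ.1 ∧ (k : ℝ) * Θ.1 + ((k : ℝ) + 1) * Θ.2 = 0}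

/-- `L_-(∞) ∪ L_+(∞)`. -/
def Linf : Set (ℝ × ℝ) := {Θ | Θ.1 ≠ Θ.2 ∧ Θ.1 + Θ.2 = 0}

/-- The union of all walls. -/
def walls : Set (ℝ × ℝ) :=
  {Θ | (∃ k : ℕ, 1 ≤ k ∧ (Θ ∈ LmMinus k ∨ Θ ∈ LpMinus k)) ∨
    (∃ k : ℕ, Θ ∈ LmPlus k ∨ Θ ∈ LpPlus k) ∨ Θ ∈ Linf}

/-- `Θ'` lies in the chamber adjacent to `Θ` in the direction `u`: `Θ' = Θ + ε u` with `ε > 0` so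
small that there is no wall between them. -/
def IsAdjacent (Θ u Θ' : ℝ × ℝ) : Prop :=
  ∃ ε : ℝ, 0 < ε ∧ Θ' = Θ + ε • u ∧ ∀ s : ℝ, 0 < s → s ≤ ε → Θ + s • u ∉ walls

/-- The pair `Θ_± = (θ₀ ∓ 0⁺, θ₁)` of parameters in the chambers adjacent to a wall `L^±_±(k)` with
`k ≥ 1` at `Θ`.  The walls `L^+_±(0)` lie on the line `θ₁ = 0`, and there `Θ_± = (θ₀, θ₁ ∓ 0⁺)`. -/
def AreAdjacentAcross (k : ℕ) (Θ Θp Θm : ℝ × ℝ) : Prop :=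
  if k = 0 then IsAdjacent Θ (0, -1) Θp ∧ IsAdjacent Θ (0, 1) Θm
  else IsAdjacent Θ (-1, 0) Θp ∧ IsAdjacent Θ (1, 0) Θm

/-! ### The stable objects `S_{k-1}` on the walls -/

/-- The matrices `e_q ↦ e_q` (for `i = 0`) and `e_q ↦ e_{q+1}` (for `i = 1`). -/
def upMat (m n : ℕ) (i : Fin 2) : Matrix (Fin m) (Fin n) ℂ :=
  fun p q => if p.val = q.val + i.val then 1 else 0

/-- The matrices `e_q ↦ e_q` (for `i = 0`) and `e_q ↦ e_{q-1}` (for `i = 1`), where `e_q = 0` for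
`q` out of range. -/
def downMat (m n : ℕ) (i : Fin 2) : Matrix (Fin m) (Fin n) ℂ :=
  fun p q => if p.val + i.val = q.val then 1 else 0

/-- The representation with `a = 0`, `c = 0`, `d = 0` and the given `b`. -/
def QRep.ofB (b : Fin 2 → Matrix (Fin d₀) (Fin d₁) ℂ) : QRep d₀ d₁ where
  a _ := 0
  b := b
  c := 0
  d := 0
  rel_aba := by simp
  rel_bab := by simp
  rel_da := by simp
  rel_cb := by simp

/-- The representation with `b = 0`, `c = 0`, `d = 0` and the given `a`. -/
def QRep.ofA (a : Fin 2 → Matrix (Fin d₁) (Fin d₀) ℂ) : QRep d₀ d₁ where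
  a := a
  b _ := 0
  c := 0
  d := 0
  rel_aba := by simp
  rel_bab := by simp
  rel_da := by simp
  rel_cb := by simp

/-- `S_{k-1} = 𝒪_{ℙ¹}(k-1)` on `L^-_-(k)`: `V₁ = H⁰(𝒪(k-2)) → V₀ = H⁰(𝒪(k-1))`, multiplication by
the two sections of `𝒪(1)`. -/
def SmMinus (k : ℕ) : QRep k (k - 1) := QRep.ofB (upMat k (k - 1))

/-- `S_{k-1} = 𝒪_{ℙ¹}(-k-1)[1]` on `L^+_-(k)`: `V₁ = H¹(𝒪(-k-2)) → V₀ = H¹(𝒪(-k-1))`. -/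
def SmPlus (k : ℕ) : QRep k (k + 1) := QRep.ofB (downMat k (k + 1))

/-- `S_{k-1} = Υ₀(𝒪_{ℙ¹}(-k-1)[1])` on `L^-_+(k)`: on the flop, with `𝒪 ⊕ 𝒪(-1)` as tilting bundle,
`V₀ = H¹(𝒪(-k-1)) → V₁ = H¹(𝒪(-k))`. -/
def SpMinus (k : ℕ) : QRep k (k - 1) := QRep.ofA (downMat (k - 1) k)

/-- `S_{k-1} = Υ₀(𝒪_{ℙ¹}(k-1))` on `L^+_+(k)`: on the flop, `V₀ = H⁰(𝒪(k-1)) → V₁ = H⁰(𝒪(k))`. -/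
def SpPlus (k : ℕ) : QRep k (k + 1) := QRep.ofA (upMat (k + 1) k)

/-! ### The maps `π_±` and the wall-crossing conjecture -/

/-- `p₀ : W'₀ → R₀`, `p₁ : W'₁ → R₁` is a surjective morphism of representations of `(Q, I)` with
kernel `W ⊆ W'`; so it identifies the subquotient `W'/W` with `R`. -/
structure IsSubquotientMap {V : QRep d₀ d₁} (W W' : SubRep V) (R : QRep e₀ e₁)
    (p₀ : W'.W₀ →ₗ[ℂ] (Fin e₀ → ℂ)) (p₁ : W'.W₁ →ₗ[ℂ] (Fin e₁ → ℂ)) : Prop where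
  le₀ : W.W₀ ≤ W'.W₀
  le₁ : W.W₁ ≤ W'.W₁
  surj₀ : Function.Surjective p₀
  surj₁ : Function.Surjective p₁
  ker₀ : ∀ x, p₀ x = 0 ↔ (x : Fin d₀ → ℂ) ∈ W.W₀
  ker₁ : ∀ x, p₁ x = 0 ↔ (x : Fin d₁ → ℂ) ∈ W.W₁
  comm_a : ∀ i (x : W'.W₀), p₁ ⟨V.a i *ᵥ x.1, W'.a_mem i x.1 x.2⟩ = R.a i *ᵥ p₀ x
  comm_b : ∀ i (x : W'.W₁), p₀ ⟨V.b i *ᵥ x.1, W'.b_mem i x.1 x.2⟩ = R.b i *ᵥ p₁ x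
  comm_c : ∀ x : W'.W₀, p₀ ⟨V.c *ᵥ x.1, W'.c_mem x.1 x.2⟩ = R.c *ᵥ p₀ x
  comm_d : ∀ x : W'.W₁, p₁ ⟨V.d *ᵥ x.1, W'.d_mem x.1 x.2⟩ = R.d *ᵥ p₁ x

/-- `V` has a filtration by subrepresentations whose subquotients are the framed representation
`I₀`, once, and the unframed representation `S`, `r` times.  When `I₀` is `Θ`-stable and `S` is
`Θ`-stable with `Θ(S) = 0`, this is a Jordan-Hölder filtration, and it says that `V` is
`Θ`-semistable and S-equivalent to the polystable object `I₀ ⊕ S^{⊕r}[-1]`. -/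
def FramedRep.IsSEquivalent (V : FramedRep d₀ d₁) (I₀ : FramedRep e₀ e₁) (S : QRep s₀ s₁)
    (r : ℕ) : Prop :=
  ∃ (W : ℕ → SubRep V.toQRep) (j₀ : ℕ), j₀ ≤ r ∧ (W 0).IsZero ∧ (W (r + 1)).IsAll ∧
    (∃ (hv : V.v ∈ (W (j₀ + 1)).W₀) (p₀ : (W (j₀ + 1)).W₀ →ₗ[ℂ] (Fin e₀ → ℂ))
      (p₁ : (W (j₀ + 1)).W₁ →ₗ[ℂ] (Fin e₁ → ℂ)),
      IsSubquotientMap (W j₀) (W (j₀ + 1)) I₀.toQRep p₀ p₁ ∧ p₀ ⟨V.v, hv⟩ = I₀.v) ∧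
    (∀ j, j ≤ r → j ≠ j₀ →
      ∃ (p₀ : (W (j + 1)).W₀ →ₗ[ℂ] (Fin s₀ → ℂ)) (p₁ : (W (j + 1)).W₁ →ₗ[ℂ] (Fin s₁ → ℂ)),
        IsSubquotientMap (W j) (W (j + 1)) S p₀ p₁)

/-- The fibre `π_±^{-1}(P^{I₀}_{k-1,r})`, `P^{I₀}_{k-1,r} = I₀ ⊕ S_{k-1}^{⊕r}[-1]`, inside the
`T₀`-fixed `Θ'`-stable systems, where `Θ' = Θ_±`. -/
def fibre (Θ' : ℝ × ℝ) (I₀ : FramedRep e₀ e₁) (S : QRep s₀ s₁) (r : ℕ) : Set IsoClass :=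
  {I | I ∈ fixedPoints Θ' ∧ I.rep.IsSEquivalent I₀ S r}

/-- `∑_r u^r ∑_{I ∈ π_±^{-1}(P^{I₀}_{k-1,r})} e_{T₀}(χ_X(I,I)₀^{1/2}) e(χ_X(F)^∨ ⊗ e^m)`. -/
def fibreSeries (Θ' : ℝ × ℝ) (σ : Signs) (I₀ : FramedRep e₀ e₁) (S : QRep s₀ s₁) :
    PowerSeries Lam :=
  PowerSeries.mk fun r => ∑ᶠ I ∈ fibre Θ' I₀ S r, weight σ I

/-- For each `T₀`-fixed `Θ`-stable `I₀`, with suitable signs, the quotient of the two series is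
`(1 - u)^{k m / λ₃}`. -/
def ConjectureAt (Θ Θp Θm : ℝ × ℝ) (k : ℕ) (S : QRep s₀ s₁) : Prop :=
  ∀ (e₀ e₁ : ℕ) (I₀ : FramedRep e₀ e₁), I₀.IsStable Θ → I₀.IsTorusFixed →
    ∃ σp σm : Signs,
      fibreSeries Θp σp I₀ S = fibreSeries Θm σm I₀ S * oneSubPow ((k : Lam) * (Lam.m / Lam.l₃))

/-- The wall-crossing conjecture for the fibres of `π_±` on all walls `L^-_±(k)`, `k ≥ 1`, and
`L^+_±(k)`, `k ≥ 0`.  The power series variable is `t` on `L^-_±(k)`, where `S_{k-1}` has degree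
`1`, and `t⁻¹` on `L^+_±(k)`, where `S_{k-1}` has degree `-1`. -/
def WallCrossingConjecture : Prop :=
  (∀ k : ℕ, 1 ≤ k → ∀ Θ Θp Θm : ℝ × ℝ, AreAdjacentAcross k Θ Θp Θm →
    (Θ ∈ LmMinus k → ConjectureAt Θ Θp Θm k (SmMinus k)) ∧
    (Θ ∈ LpMinus k → ConjectureAt Θ Θp Θm k (SpMinus k))) ∧
  (∀ k : ℕ, ∀ Θ Θp Θm : ℝ × ℝ, AreAdjacentAcross k Θ Θp Θm →
    (Θ ∈ LmPlus k → ConjectureAt Θ Θp Θm k (SmPlus k)) ∧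
    (Θ ∈ LpPlus k → ConjectureAt Θ Θp Θm k (SpPlus k)))

/-- With suitable signs, the quotient of the generating series of tautological invariants for `Θ_+`
and `Θ_-` is `(1 - q^k t^d)^{k m / λ₃}` in `Λ⟦qt, t⁻¹⟧`; all sums over fixed points are finite and
the denominator is invertible. -/
def QuotientFormula (Θp Θm : ℝ × ℝ) (k : ℕ) (d : ℤ) : Prop :=
  (∀ n' d' : ℤ, (fixedPointsOf Θp n' d').Finite ∧ (fixedPointsOf Θm n' d').Finite) ∧
  ∃ σp σm : Signs, IsUnit (genSeries Θm σm) ∧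
    genSeries Θp σp = genSeries Θm σm * oneSubQTPow k d ((k : Lam) * (Lam.m / Lam.l₃))

end WallCrossing

end

/-! The Conjecture compares the two sides of a wall over one `Θ`-stable system `I₀` at a time, and
the proposition is obtained by summing over all `I₀`. A fixed point for `Θ_±` is `Θ`-semistable, and
its Jordan–Hölder filtration has exactly one framed factor `I₀`, while all other factors are copies
of `S = S_{k-1}`. Hence the fixed points for `Θ_±` are the disjoint union of the fibres of `π_±`
over the pairs `(I₀, r)`, and the dimension vector of a point of such a fibre is that of `I₀` plus
`r` times that of `S`. The generating series is therefore the sum over `I₀` of the monomial of `I₀`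
times the fibre series evaluated at the monomial of `S`, and the Conjecture gives the same factor
`(1 - u)^{km/λ₃}` for every `I₀`. A system lies over only one `I₀`, so signs can be chosen
separately over each `I₀`. This is `quotientFormula_of_conjectureAt`; the denominator is a unit
because its constant term, from the zero system, is `±1`.

The factors. In a stable representation of slope zero all closed paths act as scalars by Schur's
lemma. If `θ₀ + θ₁ ≠ 0`, the paths between the two vertices vanish, and then so does one of the two
pairs of arrows; what remains is a Kronecker module with scalar endomorphisms. Its Euler form is at
most `1`, so the dimensions differ by one. A fixed system has nilpotent loops, so the scalars of the
loops vanish as well, and comparison with the explicit module identifies the factor with `S`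
(`exists_equiv_upMat`, `exists_equiv_downMat`). The same dimension argument shows that strict
semistability at `Θ ≠ 0` occurs only on walls, so stability on one side of a wall implies
semistability on it (`IsFramedStable.isFramedSemistable`). The framed factor is unique up to
isomorphism (`IsSubquo.unique`), and therefore again fixed by the torus.

Finiteness of the fixed point sets off the walls. When `θ₀, θ₁ < 0`, stable systems are cyclic; the
torus weights and the Calabi–Yau relation `t₀t₁t₂t₃ = 1` make the nonzero monomials in the arrows a
basis, so a system is determined by the finite set of its nonzero monomials
(`finiteClasses_of_isGenerated`). Other chambers with `θ₀ + θ₁ < 0` are brought to this one by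
reflections. For `θ₀ + θ₁ > 0` with one negative parameter, a single tilt depending on the chamber
produces a cyclic representation from which the original can be recovered. If both parameters are
nonnegative only the zero system is stable. To accommodate the reflections and tilts, a framing is a
chain of vectors `n₀, …, n_k` with `x₀ n_j = x₁ n_{j+1}` rather than one vector. -/

noncomputable section

set_option linter.unusedSectionVars false

namespace WallCrossing

open Matrix Module

/-! ### Representations of the conifold quiver -/

section

/-- Representations of the conifold quiver with loops on vector spaces `P`, `Q`:
arrows `x i : P → Q`, `y i : Q → P` and loops `z`, `w`. -/
structure ConifoldRep (P Q : Type) [AddCommGroup P] [Module ℂ P] [AddCommGroup Q]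
    [Module ℂ Q] where
  x : Fin 2 → P →ₗ[ℂ] Q
  y : Fin 2 → Q →ₗ[ℂ] P
  z : P →ₗ[ℂ] P
  w : Q →ₗ[ℂ] Q
  xyx : ∀ i p, x 1 (y i (x 0 p)) = x 0 (y i (x 1 p))
  yxy : ∀ i q, y 1 (x i (y 0 q)) = y 0 (x i (y 1 q))
  wx : ∀ i p, w (x i p) = x i (z p)
  zy : ∀ i q, z (y i q) = y i (w q)

namespace ConifoldRep

variable {P Q P' Q' : Type} [AddCommGroup P] [Module ℂ P] [AddCommGroup Q] [Module ℂ Q]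
  [AddCommGroup P'] [Module ℂ P'] [AddCommGroup Q'] [Module ℂ Q']

/-- Exchange of the two vertices. -/
@[simps] def swap (c : ConifoldRep P Q) : ConifoldRep Q P where
  x := c.y
  y := c.x
  z := c.w
  w := c.z
  xyx := c.yxy
  yxy := c.xyx
  wx := c.zy
  zy := c.wx

theorem xyx_comm (c : ConifoldRep P Q) (i l j : Fin 2) (p : P) :
    c.x i (c.y l (c.x j p)) = c.x j (c.y l (c.x i p)) := by
  fin_cases i <;> fin_cases j <;> simp [c.xyx]

theorem yxy_comm (c : ConifoldRep P Q) (i l j : Fin 2) (q : Q) :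
    c.y i (c.x l (c.y j q)) = c.y j (c.x l (c.y i q)) := by
  fin_cases i <;> fin_cases j <;> simp [c.yxy]

/-- A pair of linear maps commuting with the arrows. -/
structure IsHom (c : ConifoldRep P Q) (c' : ConifoldRep P' Q') (f : P →ₗ[ℂ] P')
    (g : Q →ₗ[ℂ] Q') : Prop where
  x : ∀ i p, g (c.x i p) = c'.x i (f p)
  y : ∀ i q, f (c.y i q) = c'.y i (g q)
  z : ∀ p, f (c.z p) = c'.z (f p)
  w : ∀ q, g (c.w q) = c'.w (g q)

theorem IsHom.swap {c : ConifoldRep P Q} {c' : ConifoldRep P' Q'} {f : P →ₗ[ℂ] P'}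
    {g : Q →ₗ[ℂ] Q'} (h : IsHom c c' f g) : IsHom c.swap c'.swap g f :=
  ⟨h.y, h.x, h.w, h.z⟩

/-- Subrepresentations. -/
structure Sub (c : ConifoldRep P Q) where
  fst : Submodule ℂ P
  snd : Submodule ℂ Q
  x_mem : ∀ i, ∀ p ∈ fst, c.x i p ∈ snd
  y_mem : ∀ i, ∀ q ∈ snd, c.y i q ∈ fst
  z_mem : ∀ p ∈ fst, c.z p ∈ fst
  w_mem : ∀ q ∈ snd, c.w q ∈ snd

namespace Sub

variable {c : ConifoldRep P Q}

@[ext] theorem ext {A B : Sub c} (h : A.fst = B.fst) (h' : A.snd = B.snd) : A = B := by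
  cases A; cases B; simp_all

@[simps] def swap (W : Sub c) : Sub c.swap := ⟨W.snd, W.fst, W.y_mem, W.x_mem, W.w_mem, W.z_mem⟩

@[simps] def unswap (W : Sub c.swap) : Sub c :=
  ⟨W.snd, W.fst, W.y_mem, W.x_mem, W.w_mem, W.z_mem⟩

instance : LE (Sub c) := ⟨fun A B => A.fst ≤ B.fst ∧ A.snd ≤ B.snd⟩

instance : Bot (Sub c) where
  bot := ⟨⊥, ⊥, by simp, by simp, by simp, by simp⟩

instance : Top (Sub c) where
  top := ⟨⊤, ⊤, by simp, by simp, by simp, by simp⟩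

instance : Min (Sub c) where
  min A B := ⟨A.fst ⊓ B.fst, A.snd ⊓ B.snd,
    fun i p h => ⟨A.x_mem i p h.1, B.x_mem i p h.2⟩, fun i p h => ⟨A.y_mem i p h.1, B.y_mem i p h.2⟩,
    fun p h => ⟨A.z_mem p h.1, B.z_mem p h.2⟩, fun p h => ⟨A.w_mem p h.1, B.w_mem p h.2⟩⟩

instance : Max (Sub c) where
  max A B := ⟨A.fst ⊔ B.fst, A.snd ⊔ B.snd,
    fun i p h => by
      obtain ⟨a, ha, b, hb, rfl⟩ := Submodule.mem_sup.1 h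
      rw [map_add]
      exact Submodule.add_mem_sup (A.x_mem i a ha) (B.x_mem i b hb),
    fun i p h => by
      obtain ⟨a, ha, b, hb, rfl⟩ := Submodule.mem_sup.1 h
      rw [map_add]
      exact Submodule.add_mem_sup (A.y_mem i a ha) (B.y_mem i b hb),
    fun p h => by
      obtain ⟨a, ha, b, hb, rfl⟩ := Submodule.mem_sup.1 h
      rw [map_add]
      exact Submodule.add_mem_sup (A.z_mem a ha) (B.z_mem b hb),
    fun p h => by
      obtain ⟨a, ha, b, hb, rfl⟩ := Submodule.mem_sup.1 h
      rw [map_add]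
      exact Submodule.add_mem_sup (A.w_mem a ha) (B.w_mem b hb)⟩

@[simp] theorem bot_fst : (⊥ : Sub c).fst = ⊥ := rfl
@[simp] theorem bot_snd : (⊥ : Sub c).snd = ⊥ := rfl
@[simp] theorem top_fst : (⊤ : Sub c).fst = ⊤ := rfl
@[simp] theorem top_snd : (⊤ : Sub c).snd = ⊤ := rfl
@[simp] theorem inf_fst (A B : Sub c) : (A ⊓ B).fst = A.fst ⊓ B.fst := rfl
@[simp] theorem inf_snd (A B : Sub c) : (A ⊓ B).snd = A.snd ⊓ B.snd := rfl
@[simp] theorem sup_fst (A B : Sub c) : (A ⊔ B).fst = A.fst ⊔ B.fst := rfl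
@[simp] theorem sup_snd (A B : Sub c) : (A ⊔ B).snd = A.snd ⊔ B.snd := rfl

/-- `θ₀ dim + θ₁ dim`. -/
def slope (W : Sub c) (Θ : ℝ × ℝ) : ℝ :=
  Θ.1 * (finrank ℂ W.fst : ℝ) + Θ.2 * (finrank ℂ W.snd : ℝ)

theorem slope_swap (W : Sub c) (Θ : ℝ × ℝ) : W.swap.slope Θ.swap = W.slope Θ := by
  exact add_comm _ _

@[simp] theorem slope_bot (Θ : ℝ × ℝ) : (⊥ : Sub c).slope Θ = 0 := by
  simp [slope]

theorem slope_sup_add_inf [FiniteDimensional ℂ P] [FiniteDimensional ℂ Q] (A B : Sub c)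
    (Θ : ℝ × ℝ) : (A ⊔ B).slope Θ + (A ⊓ B).slope Θ = A.slope Θ + B.slope Θ := by
  have h1 := Submodule.finrank_sup_add_finrank_inf_eq A.fst B.fst
  have h2 := Submodule.finrank_sup_add_finrank_inf_eq A.snd B.snd
  have h1' : (finrank ℂ ↥(A.fst ⊔ B.fst) : ℝ) + finrank ℂ ↥(A.fst ⊓ B.fst) =
    finrank ℂ A.fst + finrank ℂ B.fst := by exact_mod_cast h1
  have h2' : (finrank ℂ ↥(A.snd ⊔ B.snd) : ℝ) + finrank ℂ ↥(A.snd ⊓ B.snd) =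
    finrank ℂ A.snd + finrank ℂ B.snd := by exact_mod_cast h2
  simp only [slope, sup_fst, sup_snd, inf_fst, inf_snd]
  linear_combination Θ.1 * h1' + Θ.2 * h2'

end Sub

/-- `θ₀ dim P + θ₁ dim Q`. -/
def totalSlope (_ : ConifoldRep P Q) (Θ : ℝ × ℝ) : ℝ :=
  Θ.1 * (finrank ℂ P : ℝ) + Θ.2 * (finrank ℂ Q : ℝ)

@[simp] theorem Sub.slope_top (c : ConifoldRep P Q) (Θ : ℝ × ℝ) :
    (⊤ : Sub c).slope Θ = c.totalSlope Θ := by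
  simp [Sub.slope, totalSlope]

/-- The kernel of a morphism. -/
@[simps] def IsHom.ker {c : ConifoldRep P Q} {c' : ConifoldRep P' Q'} {f : P →ₗ[ℂ] P'}
    {g : Q →ₗ[ℂ] Q'} (h : IsHom c c' f g) : Sub c where
  fst := LinearMap.ker f
  snd := LinearMap.ker g
  x_mem i p hp := by simp_all [h.x]
  y_mem i p hp := by simp_all [h.y]
  z_mem p hp := by simp_all [h.z]
  w_mem p hp := by simp_all [h.w]

/-- The image of a subrepresentation. -/
@[simps] def IsHom.map {c : ConifoldRep P Q} {c' : ConifoldRep P' Q'} {f : P →ₗ[ℂ] P'}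
    {g : Q →ₗ[ℂ] Q'} (h : IsHom c c' f g) (W : Sub c) : Sub c' where
  fst := W.fst.map f
  snd := W.snd.map g
  x_mem := by
    rintro i _ ⟨p, hp, rfl⟩
    exact ⟨_, W.x_mem i p hp, h.x i p⟩
  y_mem := by
    rintro i _ ⟨p, hp, rfl⟩
    exact ⟨_, W.y_mem i p hp, h.y i p⟩
  z_mem := by
    rintro _ ⟨p, hp, rfl⟩
    exact ⟨_, W.z_mem p hp, h.z p⟩
  w_mem := by
    rintro _ ⟨p, hp, rfl⟩
    exact ⟨_, W.w_mem p hp, h.w p⟩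

theorem finrank_map_add_inf_ker {V V' : Type} [AddCommGroup V] [Module ℂ V] [AddCommGroup V']
    [Module ℂ V'] [FiniteDimensional ℂ V] (f : V →ₗ[ℂ] V') (W : Submodule ℂ V) :
    finrank ℂ (W.map f) + finrank ℂ ↥(W ⊓ LinearMap.ker f) = finrank ℂ W := by
  have h := LinearMap.finrank_range_add_finrank_ker (f.domRestrict W)
  rw [LinearMap.range_domRestrict, LinearMap.ker_domRestrict] at h
  rw [← h]
  congr 1
  rw [← Submodule.map_comap_subtype]
  exact (Submodule.equivMapOfInjective _ W.subtype_injective _).symm.finrank_eq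

theorem Sub.slope_map_add_slope_inf_ker [FiniteDimensional ℂ P] [FiniteDimensional ℂ Q]
    {c : ConifoldRep P Q} {c' : ConifoldRep P' Q'} {f : P →ₗ[ℂ] P'}
    {g : Q →ₗ[ℂ] Q'} (h : IsHom c c' f g) (W : Sub c) (Θ : ℝ × ℝ) :
    (h.map W).slope Θ + (W ⊓ h.ker).slope Θ = W.slope Θ := by
  have h1 := finrank_map_add_inf_ker f W.fst
  have h2 := finrank_map_add_inf_ker g W.snd
  have h1' : (finrank ℂ (W.fst.map f) : ℝ) + finrank ℂ ↥(W.fst ⊓ LinearMap.ker f) =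
    finrank ℂ W.fst := by exact_mod_cast h1
  have h2' : (finrank ℂ (W.snd.map g) : ℝ) + finrank ℂ ↥(W.snd ⊓ LinearMap.ker g) =
    finrank ℂ W.snd := by exact_mod_cast h2
  change Θ.1 * (finrank ℂ (W.fst.map f) : ℝ) + Θ.2 * (finrank ℂ (W.snd.map g) : ℝ) +
    (Θ.1 * (finrank ℂ ↥(W.fst ⊓ LinearMap.ker f) : ℝ) +
      Θ.2 * (finrank ℂ ↥(W.snd ⊓ LinearMap.ker g) : ℝ)) =
    Θ.1 * (finrank ℂ W.fst : ℝ) + Θ.2 * (finrank ℂ W.snd : ℝ)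
  linear_combination Θ.1 * h1' + Θ.2 * h2'

theorem slope_range_add_slope_ker [FiniteDimensional ℂ P] [FiniteDimensional ℂ Q]
    {c : ConifoldRep P Q} {c' : ConifoldRep P' Q'} {f : P →ₗ[ℂ] P'}
    {g : Q →ₗ[ℂ] Q'} (h : IsHom c c' f g) (Θ : ℝ × ℝ) :
    (h.map ⊤).slope Θ + h.ker.slope Θ = c.totalSlope Θ := by
  rw [← Sub.slope_top, ← Sub.slope_map_add_slope_inf_ker h ⊤ Θ]
  congr 2
  ext <;> simp

/-- Stability of an unframed representation of slope zero. -/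
structure IsStable (c : ConifoldRep P Q) (Θ : ℝ × ℝ) : Prop where
  nonzero : 0 < finrank ℂ P + finrank ℂ Q
  total : c.totalSlope Θ = 0
  neg : ∀ W : Sub c, W ≠ ⊥ → W ≠ ⊤ → W.slope Θ < 0

theorem IsStable.swap {c : ConifoldRep P Q} {Θ : ℝ × ℝ} (h : c.IsStable Θ) :
    c.swap.IsStable Θ.swap where
  nonzero := by rw [add_comm]; exact h.nonzero
  total := by rw [← h.total]; exact add_comm _ _
  neg W h1 h2 := by
    have := h.neg W.unswap (fun e => h1 ?_) (fun e => h2 ?_)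
    · rw [← W.unswap.slope_swap] at this
      exact this
    · ext1
      · exact congrArg Sub.snd e
      · exact congrArg Sub.fst e
    · ext1
      · exact congrArg Sub.snd e
      · exact congrArg Sub.fst e

/-! ### Schur's lemma and the vanishing of closed paths. -/

section Schur

variable [FiniteDimensional ℂ P] [FiniteDimensional ℂ Q]
  {c : ConifoldRep P Q} {Θ : ℝ × ℝ}

theorem IsStable.slope_nonpos (h : c.IsStable Θ) (W : Sub c) : W.slope Θ ≤ 0 := by
  by_cases h1 : W = ⊥
  · simp [h1]
  by_cases h2 : W = ⊤
  · simp [h2, h.total]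
  exact (h.neg W h1 h2).le

theorem IsStable.eq_bot_or_eq_top (h : c.IsStable Θ) {W : Sub c} (hW : 0 ≤ W.slope Θ) :
    W = ⊥ ∨ W = ⊤ := by
  by_contra! hc
  exact (h.neg W hc.1 hc.2).not_ge hW

/-- The slopes of kernel and image add up to zero and the image has slope at most zero, so the
kernel has slope at least zero. -/
theorem IsStable.ker_eq_top (h : c.IsStable Θ) {f : P →ₗ[ℂ] P} {g : Q →ₗ[ℂ] Q}
    (hf : IsHom c c f g) (hk : hf.ker ≠ ⊥) : hf.ker = ⊤ := by
  by_contra hk'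
  have h1 := h.neg _ hk hk'
  have h2 := slope_range_add_slope_ker hf Θ
  have h3 := h.slope_nonpos (hf.map ⊤)
  rw [h.total] at h2
  linarith

theorem IsHom.sub_smul {f : P →ₗ[ℂ] P} {g : Q →ₗ[ℂ] Q} (hf : IsHom c c f g) (μ : ℂ) :
    IsHom c c (f - μ • LinearMap.id) (g - μ • LinearMap.id) := by
  constructor <;> intros <;> simp [hf.x, hf.y, hf.z, hf.w]

/-- Schur's lemma: an eigenvalue `μ` exists on whichever vertex space is nonzero, and the kernel of
the endomorphism minus `μ` is then a nonzero subrepresentation, hence everything. -/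
theorem IsStable.exists_scalar (h : c.IsStable Θ) {f : P →ₗ[ℂ] P} {g : Q →ₗ[ℂ] Q}
    (hf : IsHom c c f g) : ∃ μ : ℂ, f = μ • LinearMap.id ∧ g = μ • LinearMap.id := by
  suffices ∃ μ : ℂ, (hf.sub_smul μ).ker ≠ ⊥ by
    obtain ⟨μ, hμ⟩ := this
    have := h.ker_eq_top _ hμ
    refine ⟨μ, ?_, ?_⟩
    · exact sub_eq_zero.1 (LinearMap.ker_eq_top.1 (congrArg Sub.fst this))
    · exact sub_eq_zero.1 (LinearMap.ker_eq_top.1 (congrArg Sub.snd this))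
  rcases Nat.eq_zero_or_pos (finrank ℂ P) with hP | hP
  · have hQ : 0 < finrank ℂ Q := by have := h.nonzero; omega
    have := finrank_pos_iff.1 hQ
    obtain ⟨μ, hμ⟩ := Module.End.exists_eigenvalue g
    obtain ⟨v, hv⟩ := hμ.exists_hasEigenvector
    refine ⟨μ, fun e => hv.2 ?_⟩
    have : v ∈ (hf.sub_smul μ).ker.snd := by simp [hv.apply_eq_smul]
    rw [e] at this
    simpa using this
  · have := finrank_pos_iff.1 hP
    obtain ⟨μ, hμ⟩ := Module.End.exists_eigenvalue f
    obtain ⟨v, hv⟩ := hμ.exists_hasEigenvector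
    refine ⟨μ, fun e => hv.2 ?_⟩
    have : v ∈ (hf.sub_smul μ).ker.fst := by simp [hv.apply_eq_smul]
    rw [e] at this
    simpa using this

/-- The relations say precisely that the paths `y l x i` and `x i y l` together are central. -/
theorem isHom_yx (c : ConifoldRep P Q) (i l : Fin 2) :
    IsHom c c (c.y l ∘ₗ c.x i) (c.x i ∘ₗ c.y l) where
  x j p := c.xyx_comm i l j p
  y j q := c.yxy_comm l i j q
  z p := by simp [c.zy, c.wx]
  w q := by simp [c.zy, c.wx]

theorem isHom_zw (c : ConifoldRep P Q) : IsHom c c c.z c.w where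
  x := c.wx
  y := c.zy
  z _ := rfl
  w _ := rfl

/-- The pair acts by one scalar. Were it nonzero, `x i` would be an isomorphism, the two dimensions
would agree, and slope zero would force `θ₀ + θ₁ = 0`. -/
theorem IsStable.yx_eq_zero (h : c.IsStable Θ) (hΘ : Θ.1 + Θ.2 ≠ 0) (i l : Fin 2) :
    c.y l ∘ₗ c.x i = 0 ∧ c.x i ∘ₗ c.y l = 0 := by
  obtain ⟨μ, h1, h2⟩ := h.exists_scalar (c.isHom_yx i l)
  by_cases hμ : μ = 0
  · simp [h1, h2, hμ]
  exfalso
  have e1 : ∀ p, c.y l (c.x i p) = μ • p := fun p => congrArg (fun F => F p) h1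
  have e2 : ∀ q, c.x i (c.y l q) = μ • q := fun q => congrArg (fun F => F q) h2
  have hinj : Function.Injective (c.x i) := by
    intro p p' e
    have := e1 p
    rw [e, e1 p'] at this
    exact (smul_right_injective _ hμ this).symm
  have hsurj : Function.Surjective (c.x i) := fun q =>
    ⟨μ⁻¹ • c.y l q, by rw [map_smul, e2, smul_smul, inv_mul_cancel₀ hμ, one_smul]⟩
  have hd := (LinearEquiv.ofBijective (c.x i) ⟨hinj, hsurj⟩).finrank_eq
  have ht := h.total
  have hn := h.nonzero
  rw [totalSlope, hd, ← add_mul] at ht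
  rcases mul_eq_zero.1 ht with h' | h'
  · exact hΘ h'
  · have : finrank ℂ Q = 0 := by exact_mod_cast h'
    omega

/-- Keeping all of the second vertex space and shrinking the first to the images of the `y i` cannot
lower the slope when `θ₀ ≤ 0`. By stability this subrepresentation is zero or everything, and since
all `x i y l` vanish, `x i = 0` in both cases. -/
theorem IsStable.x_eq_zero (h : c.IsStable Θ) (hΘ : Θ.1 + Θ.2 ≠ 0) (h0 : Θ.1 ≤ 0)
    (i : Fin 2) : c.x i = 0 := by
  let W : Sub c :=
    { fst := LinearMap.range (c.y 0) ⊔ LinearMap.range (c.y 1)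
      snd := ⊤
      x_mem := by simp
      y_mem := by
        intro i q _
        fin_cases i
        · exact Submodule.mem_sup_left ⟨q, rfl⟩
        · exact Submodule.mem_sup_right ⟨q, rfl⟩
      z_mem := by
        intro p hp
        obtain ⟨_, ⟨a, rfl⟩, _, ⟨b, rfl⟩, rfl⟩ := Submodule.mem_sup.1 hp
        rw [map_add, c.zy, c.zy]
        exact Submodule.add_mem_sup ⟨_, rfl⟩ ⟨_, rfl⟩
      w_mem := by simp }
  have hW : 0 ≤ W.slope Θ := by
    have h1 : (finrank ℂ W.fst : ℝ) ≤ finrank ℂ P := by exact_mod_cast Submodule.finrank_le _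
    have h2 : (finrank ℂ W.snd : ℝ) = finrank ℂ Q := by exact_mod_cast finrank_top ℂ Q
    rw [← h.total, totalSlope, Sub.slope, h2]
    nlinarith
  rcases h.eq_bot_or_eq_top hW with e | e
  · have : (⊤ : Submodule ℂ Q) = ⊥ := congrArg Sub.snd e
    ext p
    have : c.x i p ∈ (⊤ : Submodule ℂ Q) := trivial
    simp_all
  · have : LinearMap.range (c.y 0) ⊔ LinearMap.range (c.y 1) = ⊤ := congrArg Sub.fst e
    ext p
    have hp : p ∈ LinearMap.range (c.y 0) ⊔ LinearMap.range (c.y 1) := this ▸ trivial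
    obtain ⟨_, ⟨a, rfl⟩, _, ⟨b, rfl⟩, rfl⟩ := Submodule.mem_sup.1 hp
    have e1 := congrArg (fun F => F a) (h.yx_eq_zero hΘ i 0).2
    have e2 := congrArg (fun F => F b) (h.yx_eq_zero hΘ i 1).2
    simp_all

end Schur

/-- `(f, g) ↦ (f ∘ s i - y i ∘ g)`: its kernel consists of the morphisms of representations of the
Kronecker quiver. -/
def kroneckerMap (s : Fin 2 → Q' →ₗ[ℂ] P') (y : Fin 2 → Q →ₗ[ℂ] P) :
    ((P' →ₗ[ℂ] P) × (Q' →ₗ[ℂ] Q)) →ₗ[ℂ] (Fin 2 → Q' →ₗ[ℂ] P) :=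
  LinearMap.pi fun i =>
    (LinearMap.lcomp ℂ P (s i)) ∘ₗ LinearMap.fst ℂ _ _ -
      (LinearMap.llcomp ℂ Q' Q P (y i)) ∘ₗ LinearMap.snd ℂ _ _

theorem mem_ker_kroneckerMap {s : Fin 2 → Q' →ₗ[ℂ] P'} {y : Fin 2 → Q →ₗ[ℂ] P}
    {F : (P' →ₗ[ℂ] P) × (Q' →ₗ[ℂ] Q)} :
    F ∈ LinearMap.ker (kroneckerMap s y) ↔ ∀ i q, F.1 (s i q) = y i (F.2 q) := by
  simp only [LinearMap.mem_ker, kroneckerMap, funext_iff, LinearMap.ext_iff]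
  simp [sub_eq_zero]

/-- The Euler form of the Kronecker quiver bounds the dimension of the space of morphisms from
below. -/
theorem le_finrank_ker_kroneckerMap [FiniteDimensional ℂ P] [FiniteDimensional ℂ Q]
    [FiniteDimensional ℂ P'] [FiniteDimensional ℂ Q']
    (s : Fin 2 → Q' →ₗ[ℂ] P') (y : Fin 2 → Q →ₗ[ℂ] P) :
    finrank ℂ P' * finrank ℂ P + finrank ℂ Q' * finrank ℂ Q ≤
      2 * (finrank ℂ Q' * finrank ℂ P) + finrank ℂ (LinearMap.ker (kroneckerMap s y)) := by
  have h := LinearMap.finrank_range_add_finrank_ker (kroneckerMap s y)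
  have h2 := Submodule.finrank_le (LinearMap.range (kroneckerMap s y))
  rw [finrank_prod, finrank_linearMap, finrank_linearMap] at h
  rw [finrank_pi_fintype] at h2
  simp [finrank_linearMap] at h2
  omega

/-- As the `x i` vanish and the loops are scalars, every endomorphism of the Kronecker module is an
endomorphism of the representation, hence a scalar. So the Euler form is at most `1`. -/
theorem IsStable.finrank_sub_sq_le [FiniteDimensional ℂ P] [FiniteDimensional ℂ Q]
    {c : ConifoldRep P Q} {Θ : ℝ × ℝ} (h : c.IsStable Θ) (hΘ : Θ.1 + Θ.2 ≠ 0) (h0 : Θ.1 ≤ 0) :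
    finrank ℂ P * finrank ℂ P + finrank ℂ Q * finrank ℂ Q ≤
      2 * (finrank ℂ Q * finrank ℂ P) + 1 := by
  refine (le_finrank_ker_kroneckerMap c.y c.y).trans ?_
  gcongr
  obtain ⟨ν, hz, hw⟩ := h.exists_scalar c.isHom_zw
  have hle : LinearMap.ker (kroneckerMap c.y c.y) ≤
      Submodule.span ℂ {((LinearMap.id : P →ₗ[ℂ] P), (LinearMap.id : Q →ₗ[ℂ] Q))} := by
    intro F hF
    rw [mem_ker_kroneckerMap] at hF
    have hom : IsHom c c F.1 F.2 :=
      ⟨by simp [h.x_eq_zero hΘ h0], hF, by simp [hz], by simp [hw]⟩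
    obtain ⟨μ, h1, h2⟩ := h.exists_scalar hom
    exact Submodule.mem_span_singleton.2 ⟨μ, by ext <;> simp [h1, h2]⟩
  exact (Submodule.finrank_mono hle).trans ((finrank_span_le_card _).trans (by simp))

end ConifoldRep

end

/-! ### Stable representations of slope zero -/

section

theorem upMat_zero_mulVec {m : ℕ} (v : Fin m → ℂ) :
    upMat (m + 1) m 0 *ᵥ v = (Fin.snoc v 0 : Fin (m + 1) → ℂ) := by
  ext p
  refine Fin.lastCases ?_ (fun j => ?_) p
  · simp only [Fin.snoc_last, mulVec, dotProduct, upMat]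
    refine Finset.sum_eq_zero fun q _ => ?_
    have := q.2
    rw [if_neg (by simp; omega), zero_mul]
  · simp only [Fin.snoc_castSucc, mulVec, dotProduct, upMat]
    rw [Finset.sum_eq_single j] <;> simp +contextual [Fin.ext_iff, eq_comm]

theorem upMat_one_mulVec {m : ℕ} (v : Fin m → ℂ) :
    upMat (m + 1) m 1 *ᵥ v = (Fin.cons 0 v : Fin (m + 1) → ℂ) := by
  ext p
  refine Fin.cases ?_ (fun j => ?_) p
  · simp [mulVec, dotProduct, upMat]
  · simp only [Fin.cons_succ, mulVec, dotProduct, upMat]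
    rw [Finset.sum_eq_single j] <;> simp +contextual [Fin.ext_iff, eq_comm]

theorem downMat_zero_mulVec {m : ℕ} (v : Fin (m + 1) → ℂ) :
    downMat m (m + 1) 0 *ᵥ v = fun j => v j.castSucc := by
  ext j
  simp only [mulVec, dotProduct, downMat]
  rw [Finset.sum_eq_single j.castSucc] <;> simp +contextual [Fin.ext_iff, eq_comm]

theorem downMat_one_mulVec {m : ℕ} (v : Fin (m + 1) → ℂ) :
    downMat m (m + 1) 1 *ᵥ v = fun j => v j.succ := by
  ext j
  simp only [mulVec, dotProduct, downMat]
  rw [Finset.sum_eq_single j.succ] <;> simp +contextual [Fin.ext_iff, eq_comm]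

/-- The two matrices are multiplication by `1` and by `X` on polynomials of degree below `m`. If the
dimension did not grow, `U` would equal `1 · W` and `X` would map `W` to itself; repeated
multiplication by `X` would give nonzero elements of `W` of arbitrarily high order. -/
theorem finrank_lt_of_upMat_mem {m : ℕ} {W : Submodule ℂ (Fin m → ℂ)}
    {U : Submodule ℂ (Fin (m + 1) → ℂ)} (h : ∀ i, ∀ v ∈ W, upMat (m + 1) m i *ᵥ v ∈ U)
    (hW : W ≠ ⊥) : finrank ℂ W < finrank ℂ U := by
  by_contra! hle
  have hinj : Function.Injective (upMat (m + 1) m 0).mulVecLin := by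
    intro v v' e
    simp only [mulVecLin_apply, upMat_zero_mulVec] at e
    ext j
    simpa using congrFun e j.castSucc
  have hmap : W.map (upMat (m + 1) m 0).mulVecLin = U := by
    refine Submodule.eq_of_le_of_finrank_le ?_ ?_
    · rintro _ ⟨v, hv, rfl⟩
      exact h 0 v hv
    · rwa [← (Submodule.equivMapOfInjective _ hinj W).finrank_eq]
  have key : ∀ n : ℕ, ∃ v ∈ W, v ≠ 0 ∧ ∀ i : Fin m, i.val < n → v i = 0 := by
    intro n
    induction n with
    | zero =>
      obtain ⟨v, hv, hv0⟩ := Submodule.exists_mem_ne_zero_of_ne_bot hW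
      exact ⟨v, hv, hv0, by simp⟩
    | succ n ih =>
      obtain ⟨v, hv, hv0, hvn⟩ := ih
      have h1 := h 1 v hv
      rw [← hmap] at h1
      obtain ⟨u, hu, e⟩ := h1
      simp only [mulVecLin_apply, upMat_zero_mulVec, upMat_one_mulVec] at e
      refine ⟨u, hu, ?_, fun i hi => ?_⟩
      · rintro rfl
        apply hv0
        ext j
        have := congrFun e j.succ
        rw [Fin.cons_succ] at this
        rw [← this]
        refine Fin.lastCases (n := m) ?_ (fun j => ?_) j.succ <;> simp
      · have := congrFun e i.castSucc
        rw [Fin.snoc_castSucc] at this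
        rw [this]
        rcases Nat.eq_zero_or_pos i.val with h0 | h0
        · have : i.castSucc = 0 := Fin.ext h0
          rw [this, Fin.cons_zero]
        · have : i.castSucc = Fin.succ (⟨i.val - 1, by omega⟩ : Fin m) :=
            Fin.ext (by simp; omega)
          rw [this, Fin.cons_succ]
          exact hvn _ (by simp; omega)
  obtain ⟨v, -, hv0, hv⟩ := key m
  exact hv0 (funext fun i => hv i i.2)

/-- Dropping the last coordinate has a one-dimensional kernel, so the dimension falls by exactly
one: `U` is the image of `W`, and `W` contains the last basis vector. The other matrix then carries
each basis vector to the preceding one, and lifting back to `W` costs only a multiple of the last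
basis vector. -/
theorem eq_top_of_downMat_mem {m : ℕ} {W : Submodule ℂ (Fin (m + 1) → ℂ)}
    {U : Submodule ℂ (Fin m → ℂ)} (h : ∀ i, ∀ v ∈ W, downMat m (m + 1) i *ᵥ v ∈ U)
    (hlt : finrank ℂ U < finrank ℂ W) : W = ⊤ := by
  set T := (downMat m (m + 1) 0).mulVecLin with hT
  have hTker : LinearMap.ker T ≤ Submodule.span ℂ {Pi.single (Fin.last m) (1 : ℂ)} := by
    intro v hv
    rw [LinearMap.mem_ker, hT, mulVecLin_apply, downMat_zero_mulVec] at hv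
    refine Submodule.mem_span_singleton.2 ⟨v (Fin.last m), ?_⟩
    ext p
    refine Fin.lastCases ?_ (fun j => ?_) p
    · simp
    · have := congrFun hv j
      simp_all
  have hle : W.map T ≤ U := by
    rintro _ ⟨v, hv, rfl⟩
    exact h 0 v hv
  have h1 := ConifoldRep.finrank_map_add_inf_ker T W
  have h2 := Submodule.finrank_mono hle
  have h3 : finrank ℂ ↥(W ⊓ LinearMap.ker T) ≤
      finrank ℂ (Submodule.span ℂ {Pi.single (Fin.last m) (1 : ℂ)} : Submodule ℂ (Fin (m+1) → ℂ)) :=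
    Submodule.finrank_mono (inf_le_right.trans hTker)
  have h4 : finrank ℂ (Submodule.span ℂ {Pi.single (Fin.last m) (1 : ℂ)} :
      Submodule ℂ (Fin (m+1) → ℂ)) ≤ 1 := (finrank_span_le_card _).trans (by simp)
  have hmap : W.map T = U := Submodule.eq_of_le_of_finrank_le hle (by omega)
  have hlast : Pi.single (Fin.last m) (1 : ℂ) ∈ W := by
    have := Submodule.eq_of_le_of_finrank_le (inf_le_right.trans hTker : W ⊓ LinearMap.ker T ≤ _)
      (by omega)
    have h5 : Pi.single (Fin.last m) (1 : ℂ) ∈ W ⊓ LinearMap.ker T := by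
      rw [this]
      exact Submodule.mem_span_singleton_self _
    exact h5.1
  have key : ∀ n : ℕ, ∀ j : Fin (m + 1), j.val + n = m → Pi.single j (1 : ℂ) ∈ W := by
    intro n
    induction n with
    | zero =>
      intro j hj
      have : j = Fin.last m := Fin.ext (by simpa using hj)
      rwa [this]
    | succ n ih =>
      intro j hj
      let j' : Fin m := ⟨j.val, by omega⟩
      have h1 := h 1 _ (ih j'.succ (by simp [j']; omega))
      rw [← hmap] at h1
      obtain ⟨u, hu, e⟩ := h1
      simp only [hT, mulVecLin_apply, downMat_zero_mulVec, downMat_one_mulVec] at e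
      have : Pi.single j (1 : ℂ) = u - u (Fin.last m) • Pi.single (Fin.last m) (1 : ℂ) := by
        ext p
        refine Fin.lastCases ?_ (fun i => ?_) p
        · have : Fin.last m ≠ j := fun e => by
            have := congrArg Fin.val e
            simp at this
            omega
          simp [this]
        · have := congrFun e i
          simp only [Pi.sub_apply, this, Pi.smul_apply]
          have e1 : j = j'.castSucc := rfl
          rw [e1]
          have := i.2.ne
          simp [Pi.single_apply, Fin.ext_iff, this]
      rw [this]
      exact W.sub_mem hu (W.smul_mem _ hlast)
  rw [eq_top_iff]
  intro v _
  rw [← Finset.univ_sum_single v]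
  refine W.sum_mem fun j _ => ?_
  have := W.smul_mem (v j) (key (m - j.val) j (by omega))
  rwa [← Pi.single_smul, smul_eq_mul, mul_one] at this

namespace ConifoldRep

variable {P Q P' Q' : Type} [AddCommGroup P] [Module ℂ P] [AddCommGroup Q] [Module ℂ Q]
  [AddCommGroup P'] [Module ℂ P'] [AddCommGroup Q'] [Module ℂ Q']
  [FiniteDimensional ℂ P] [FiniteDimensional ℂ Q]
  [FiniteDimensional ℂ P'] [FiniteDimensional ℂ Q'] {c : ConifoldRep P Q} {Θ : ℝ × ℝ}

/-- The representation with only the arrows `y i` nonzero. -/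
@[simps] def ofY (s : Fin 2 → Q →ₗ[ℂ] P) : ConifoldRep P Q where
  x _ := 0
  y := s
  z := 0
  w := 0
  xyx := by simp
  yxy := by simp
  wx := by simp
  zy := by simp

/-- The Euler form `hd` is positive, so there is a nonzero morphism from the model. Semistability of
the model `hs` makes the slope of its image nonnegative, so by stability of `c` it is onto, and
equality of dimensions makes it an isomorphism. -/
theorem IsStable.exists_equiv_ofY (h : c.IsStable Θ) (hx : ∀ i, c.x i = 0) (hz : c.z = 0)
    (hw : c.w = 0) (s : Fin 2 → Q' →ₗ[ℂ] P') (hP : finrank ℂ P' = finrank ℂ P)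
    (hQ : finrank ℂ Q' = finrank ℂ Q) (hs : ∀ W : Sub (ofY s), W.slope Θ ≤ 0)
    (hd : 2 * (finrank ℂ Q * finrank ℂ P) <
      finrank ℂ P * finrank ℂ P + finrank ℂ Q * finrank ℂ Q) :
    ∃ (f : P ≃ₗ[ℂ] P') (g : Q ≃ₗ[ℂ] Q'), IsHom c (ofY s) f.toLinearMap g.toLinearMap := by
  have h1 := le_finrank_ker_kroneckerMap s c.y
  rw [hP, hQ] at h1
  have h2 : LinearMap.ker (kroneckerMap s c.y) ≠ ⊥ := by
    intro e
    rw [e, finrank_bot] at h1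
    omega
  obtain ⟨⟨f, g⟩, hfg, hne⟩ := Submodule.exists_mem_ne_zero_of_ne_bot h2
  rw [mem_ker_kroneckerMap] at hfg
  have hom : IsHom (ofY s) c f g := ⟨by simp [hx], hfg, by simp [hz], by simp [hw]⟩
  have h3 := slope_range_add_slope_ker hom Θ
  have h4 := hs hom.ker
  have h5 : (ofY s).totalSlope Θ = 0 := by
    rw [← h.total, totalSlope, totalSlope, hP, hQ]
  rcases h.eq_bot_or_eq_top (W := hom.map ⊤) (by linarith) with e | e
  · exfalso
    apply hne
    have e1 : LinearMap.range f = ⊥ := by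
      have := congrArg Sub.fst e
      simpa using this
    have e2 : LinearMap.range g = ⊥ := by
      have := congrArg Sub.snd e
      simpa using this
    rw [LinearMap.range_eq_bot] at e1 e2
    rw [e1, e2]
    rfl
  · have e1 : LinearMap.range f = ⊤ := by
      have := congrArg Sub.fst e
      simpa using this
    have e2 : LinearMap.range g = ⊤ := by
      have := congrArg Sub.snd e
      simpa using this
    rw [LinearMap.range_eq_top] at e1 e2
    let F := LinearEquiv.ofBijective f
      ⟨(LinearMap.injective_iff_surjective_of_finrank_eq_finrank hP).2 e1, e1⟩
    let G := LinearEquiv.ofBijective g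
      ⟨(LinearMap.injective_iff_surjective_of_finrank_eq_finrank hQ).2 e2, e2⟩
    have hG : ∀ q, g (G.symm q) = q := fun q => G.apply_symm_apply q
    refine ⟨F.symm, G.symm, by simp [hx], fun i q => ?_, by simp [hz], by simp [hw]⟩
    apply F.injective
    change F (F.symm _) = f (s i (G.symm q))
    rw [F.apply_symm_apply, hfg, hG]

/-- The square of the difference of the dimensions is at most `1`, and equal dimensions are
incompatible with slope zero when `θ₀ + θ₁ ≠ 0`. -/
theorem IsStable.finrank_eq_add_one (h : c.IsStable Θ) (hΘ : Θ.1 + Θ.2 ≠ 0) (h0 : Θ.1 ≤ 0) :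
    finrank ℂ P = finrank ℂ Q + 1 ∨ finrank ℂ Q = finrank ℂ P + 1 := by
  have h1 := h.finrank_sub_sq_le hΘ h0
  have h2 : finrank ℂ P ≠ finrank ℂ Q := by
    intro e
    have ht := h.total
    have hn := h.nonzero
    rw [totalSlope, e, ← add_mul] at ht
    rcases mul_eq_zero.1 ht with h' | h'
    · exact hΘ h'
    · have : finrank ℂ Q = 0 := by exact_mod_cast h'
      omega
  rcases lt_or_gt_of_ne h2 with h3 | h3
  · obtain ⟨a, ha⟩ := Nat.exists_eq_add_of_lt h3
    rw [ha] at h1 ⊢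
    right
    have : a * a + 2 * a ≤ 0 := by nlinarith
    have : a = 0 := by nlinarith
    omega
  · obtain ⟨a, ha⟩ := Nat.exists_eq_add_of_lt h3
    rw [ha] at h1 ⊢
    left
    have : a * a + 2 * a ≤ 0 := by nlinarith
    have : a = 0 := by nlinarith
    omega

/-- Without nilpotency the loops could be any common scalar: these are the translates of the sheaf
along the trivial factor `ℂ` of `X`. -/
theorem IsStable.z_w_eq_zero (h : c.IsStable Θ) (hz : IsNilpotent c.z) (hw : IsNilpotent c.w) :
    c.z = 0 ∧ c.w = 0 := by
  obtain ⟨μ, h1, h2⟩ := h.exists_scalar c.isHom_zw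
  suffices μ = 0 by simp [h1, h2, this]
  by_contra hμ
  have hunit : ∀ (V : Type) [AddCommGroup V] [Module ℂ V],
      IsNilpotent (μ • LinearMap.id : V →ₗ[ℂ] V) → 0 < finrank ℂ V → False := by
    intro V _ _ ⟨n, hn⟩ hpos
    have := Module.nontrivial_of_finrank_pos hpos
    obtain ⟨v, hv⟩ := exists_ne (0 : V)
    have h3 : (μ • LinearMap.id : V →ₗ[ℂ] V) ^ n = μ ^ n • (1 : V →ₗ[ℂ] V) := by
      rw [← Module.End.one_eq_id, smul_pow, one_pow]
    rw [h3] at hn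
    have := congrArg (fun F => F v) hn
    simp [hμ, hv] at this
  have hn := h.nonzero
  rcases Nat.eq_zero_or_pos (finrank ℂ P) with h0 | h0
  · exact hunit Q (h2 ▸ hw) (by omega)
  · exact hunit P (h1 ▸ hz) h0

theorem IsStable.exists_equiv_upMat (h : c.IsStable Θ) (m : ℕ) (hlt : Θ.1 < Θ.2)
    (hm : (m + 1 : ℝ) * Θ.1 + m * Θ.2 = 0) (hz : IsNilpotent c.z) (hw : IsNilpotent c.w) :
    ∃ (f : P ≃ₗ[ℂ] (Fin (m + 1) → ℂ)) (g : Q ≃ₗ[ℂ] (Fin m → ℂ)),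
      IsHom c (ofY fun i => (upMat (m + 1) m i).mulVecLin) f.toLinearMap g.toLinearMap := by
  have hm0 : (0 : ℝ) ≤ m := Nat.cast_nonneg m
  have hΘ : 0 < Θ.1 + Θ.2 := by nlinarith
  have h0 : Θ.1 ≤ 0 := by nlinarith
  obtain ⟨hz0, hw0⟩ := h.z_w_eq_zero hz hw
  have hdim := h.finrank_eq_add_one hΘ.ne' h0
  have ht := h.total
  have hQ : finrank ℂ Q = m ∧ finrank ℂ P = m + 1 := by
    have h2 : 0 < Θ.2 := by linarith
    -- Both `(m + 1, m)` and the dimension vector are annihilated by `Θ`, so they are proportional;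
    -- this is the vanishing of their determinant times `θ₀ + θ₁`.
    have e : (Θ.1 + Θ.2) * ((finrank ℂ P : ℝ) * m - (m + 1) * finrank ℂ Q) = 0 := by
      rw [totalSlope] at ht
      linear_combination ((finrank ℂ P : ℝ) - finrank ℂ Q) * hm - ht
    have e' : (finrank ℂ P : ℝ) * m = (m + 1) * finrank ℂ Q := by
      rcases mul_eq_zero.1 e with e | e
      · linarith
      · linarith
    have e'' : finrank ℂ P * m = (m + 1) * finrank ℂ Q := by exact_mod_cast e'
    rcases hdim with hd | hd
    · rw [hd] at e''
      have : finrank ℂ Q = m := by nlinarith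
      omega
    · rw [hd] at e''
      nlinarith
  refine h.exists_equiv_ofY (h.x_eq_zero hΘ.ne' h0) hz0 hw0 _ (by simp [hQ]) (by simp [hQ]) ?_ ?_
  · intro W
    by_cases hW : W.snd = ⊥
    · rw [Sub.slope, hW]
      simp only [finrank_bot, Nat.cast_zero, mul_zero, add_zero]
      exact mul_nonpos_of_nonpos_of_nonneg h0 (Nat.cast_nonneg _)
    · have h1 := finrank_lt_of_upMat_mem (fun i v hv => W.y_mem i v hv) hW
      have h2 : finrank ℂ W.snd ≤ m := by simpa using Submodule.finrank_le W.snd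
      have h1' : (finrank ℂ W.snd : ℝ) + 1 ≤ finrank ℂ W.fst := by exact_mod_cast h1
      have h2' : (finrank ℂ W.snd : ℝ) ≤ m := by exact_mod_cast h2
      rw [Sub.slope]
      nlinarith
  · rw [hQ.1, hQ.2]
    nlinarith

theorem IsStable.exists_equiv_downMat (h : c.IsStable Θ) (m : ℕ) (hlt : Θ.1 < Θ.2)
    (hm : (m : ℝ) * Θ.1 + (m + 1) * Θ.2 = 0) (hz : IsNilpotent c.z) (hw : IsNilpotent c.w) :
    ∃ (f : P ≃ₗ[ℂ] (Fin m → ℂ)) (g : Q ≃ₗ[ℂ] (Fin (m + 1) → ℂ)),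
      IsHom c (ofY fun i => (downMat m (m + 1) i).mulVecLin) f.toLinearMap g.toLinearMap := by
  have hm0 : (0 : ℝ) ≤ m := Nat.cast_nonneg m
  have hΘ : Θ.1 + Θ.2 < 0 := by nlinarith
  have h0 : Θ.1 ≤ 0 := by nlinarith
  obtain ⟨hz0, hw0⟩ := h.z_w_eq_zero hz hw
  have hdim := h.finrank_eq_add_one hΘ.ne h0
  have ht := h.total
  have hQ : finrank ℂ Q = m + 1 ∧ finrank ℂ P = m := by
    have e : (Θ.1 + Θ.2) * ((finrank ℂ P : ℝ) * (m + 1) - m * finrank ℂ Q) = 0 := by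
      rw [totalSlope] at ht
      linear_combination ((finrank ℂ P : ℝ) - finrank ℂ Q) * hm + ht
    have e' : (finrank ℂ P : ℝ) * (m + 1) = m * finrank ℂ Q := by
      rcases mul_eq_zero.1 e with e | e
      · linarith
      · linarith
    have e'' : finrank ℂ P * (m + 1) = m * finrank ℂ Q := by exact_mod_cast e'
    rcases hdim with hd | hd
    · rw [hd] at e''
      nlinarith
    · rw [hd] at e''
      have : finrank ℂ P = m := by nlinarith
      omega
  refine h.exists_equiv_ofY (h.x_eq_zero hΘ.ne h0) hz0 hw0 _ (by simp [hQ]) (by simp [hQ]) ?_ ?_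
  · intro W
    -- A subrepresentation of positive slope would need a larger second space than first one; that
    -- happens only for the whole representation, of slope zero.
    by_cases hlt' : finrank ℂ W.fst < finrank ℂ W.snd
    · have h1 := eq_top_of_downMat_mem (fun i v hv => W.y_mem i v hv) hlt'
      have h2 : W.fst = ⊤ := by
        rw [eq_top_iff]
        intro v _
        have := W.y_mem 0 (Fin.snoc v 0 : Fin (m + 1) → ℂ) (h1 ▸ trivial)
        simpa [downMat_zero_mulVec] using this
      rw [Sub.slope, h1, h2]
      simp only [finrank_top, finrank_fin_fun]
      push_cast
      linarith
    · have h1' : (finrank ℂ W.snd : ℝ) ≤ finrank ℂ W.fst := by exact_mod_cast not_lt.1 hlt'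
      have h2' : (0 : ℝ) ≤ finrank ℂ W.snd := Nat.cast_nonneg _
      rw [Sub.slope]
      nlinarith
  · rw [hQ.1, hQ.2]
    nlinarith

end ConifoldRep

end

/-! ### Cyclic framed representations with a torus action -/

section

/-! ### Independence of weight vectors. -/

section LinearAlgebra

variable {M : Type} [AddCommGroup M] [Module ℂ M]

theorem sum_eigenvectors_eq_zero {ι : Type} (g : M →ₗ[ℂ] M) (s : Finset ι) (v : ι → M)
    (χ : ι → ℂ) (hv : ∀ i ∈ s, g (v i) = χ i • v i) (h0 : ∑ i ∈ s, v i = 0) (μ : ℂ) :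
    ∑ i ∈ s with χ i = μ, v i = 0 := by
  classical
  by_contra hμ
  let V : ℂ → M := fun l => ∑ i ∈ s with χ i = l, v i
  let T := (s.image χ).filter fun l => V l ≠ 0
  have hsum : ∑ l ∈ T, V l = 0 := by
    rw [Finset.sum_filter_ne_zero, ← h0]
    exact Finset.sum_fiberwise_of_maps_to (fun i hi => Finset.mem_image_of_mem χ hi) v
  have hmem : μ ∈ T := by
    refine Finset.mem_filter.2 ⟨?_, hμ⟩
    by_contra hc
    apply hμ
    apply Finset.sum_eq_zero
    intro i hi
    rw [Finset.mem_filter] at hi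
    exact absurd (Finset.mem_image.2 ⟨i, hi.1, hi.2⟩) hc
  have hli := Module.End.eigenvectors_linearIndependent' g (fun l : T => (l : ℂ))
    Subtype.val_injective (fun l : T => V l) (by
      rintro ⟨l, hl⟩
      refine ⟨?_, (Finset.mem_filter.1 hl).2⟩
      rw [Module.End.mem_eigenspace_iff, map_sum, Finset.smul_sum]
      refine Finset.sum_congr rfl fun i hi => ?_
      rw [Finset.mem_filter] at hi
      rw [hv i hi.1, hi.2])
  have := Fintype.linearIndependent_iff.1 hli (fun _ => 1) (by
    simp only [one_smul]
    rw [Finset.sum_coe_sort T V, hsum]) ⟨μ, hmem⟩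
  exact one_ne_zero this

/-- Each application of `z` multiplies the weight by `ζ`, which has infinite order; nonvanishing
powers would give infinitely many eigenvalues. -/
theorem exists_pow_apply_eq_zero [FiniteDimensional ℂ M] (g z : M →ₗ[ℂ] M) {ζ χ : ℂ}
    (hgz : ∀ v, g (z v) = ζ • z (g v)) (hζ : ∀ m n : ℕ, ζ ^ m = ζ ^ n → m = n) (hχ : χ ≠ 0)
    {v : M} (hv : g v = χ • v) : ∃ L : ℕ, (z ^ L) v = 0 := by
  by_contra! hc
  have he : ∀ n : ℕ, g ((z ^ n) v) = (ζ ^ n * χ) • (z ^ n) v := by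
    intro n
    induction n with
    | zero => simpa using hv
    | succ n ih =>
      rw [pow_succ', Module.End.mul_apply, hgz, ih, map_smul, smul_smul]
      congr 1
      ring
  have hli := Module.End.eigenvectors_linearIndependent' g (fun n : ℕ => ζ ^ n * χ)
    (fun m n e => hζ m n (mul_right_cancel₀ hχ e)) (fun n => (z ^ n) v)
    (fun n => ⟨by rw [Module.End.mem_eigenspace_iff]; exact he n, hc n⟩)
  exact Set.infinite_univ.not_finite (Set.finite_univ_iff.2 hli.finite)

/-- Exponents `(s, b₀, b₁, c)` of monomials. -/
abbrev MonoIdx : Type := ℕ × ℕ × ℕ × ℕ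

/-- Multiplication with the monomial of weight zero. -/
def MonoIdx.shift (m : ℕ) (i : MonoIdx) : MonoIdx := (i.1 + m, i.2.1 + m, i.2.2.1 + m, i.2.2.2 + m)

/-- Eigenspaces of `g` separate the weights, so a relation may be taken within one weight. There the
indices differ only by shifts, which `N` realizes on vectors. The highest power of `N` that does not
kill the vector of lowest index kills all others, so its coefficient vanishes. -/
theorem linearIndependent_monomials (g N : M →ₗ[ℂ] M) (S : Set MonoIdx) (e : MonoIdx → M)
    (χ : MonoIdx → ℂ) (hg : ∀ i ∈ S, g (e i) = χ i • e i)
    (hS : ∀ i ∈ S, i.shift 1 ∈ S) (hN : ∀ i ∈ S, N (e i) = e (i.shift 1))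
    (hnil : ∀ i ∈ S, ∃ L, (N ^ L) (e i) = 0)
    (hχ : ∀ i j, χ i = χ j → ∃ m, j = i.shift m ∨ i = j.shift m) :
    LinearIndependent ℂ (fun i : {i // i ∈ S ∧ e i ≠ 0} => e i) := by
  classical
  rw [linearIndependent_iff']
  intro s a hs i hi
  by_contra hai
  have hNm : ∀ m : ℕ, ∀ j ∈ S, j.shift m ∈ S ∧ (N ^ m) (e j) = e (j.shift m) := by
    intro m
    induction m with
    | zero => exact fun j hj => ⟨hj, rfl⟩
    | succ m ih =>
      intro j hj
      obtain ⟨h1, h2⟩ := ih j hj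
      refine ⟨hS _ h1, ?_⟩
      rw [pow_succ', Module.End.mul_apply, h2, hN _ h1]
      rfl
  have h1 := sum_eigenvectors_eq_zero g s (fun i => a i • e i) (fun i => χ i)
    (fun i _ => by rw [map_smul, hg i i.2.1, smul_comm]) hs (χ i)
  let s' := (s.filter fun j : {i // i ∈ S ∧ e i ≠ 0} => χ j = χ i).filter fun j => a j ≠ 0
  have h2 : ∑ j ∈ s', a j • e j = 0 := by
    refine Eq.trans ?_ h1
    refine Finset.sum_subset (Finset.filter_subset _ _) fun j hj hj' => ?_
    have : a j = 0 := by
      by_contra hne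
      exact hj' (Finset.mem_filter.2 ⟨hj, hne⟩)
    rw [this, zero_smul]
  have hne : s'.Nonempty := ⟨i, by simp [s', hi, hai]⟩
  obtain ⟨i0, hi0, hmin⟩ := Finset.exists_min_image s' (fun j => j.1.1) hne
  obtain ⟨L, hL, hL'⟩ : ∃ L, (N ^ L) (e i0) ≠ 0 ∧ (N ^ (L + 1)) (e i0) = 0 := by
    have hex := hnil i0 i0.2.1
    have hpos : Nat.find hex ≠ 0 := by
      intro h0
      have := Nat.find_spec hex
      rw [h0] at this
      exact i0.2.2 this
    obtain ⟨L, hL⟩ := Nat.exists_eq_succ_of_ne_zero hpos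
    refine ⟨L, Nat.find_min hex (by omega), ?_⟩
    have := Nat.find_spec hex
    rwa [hL] at this
  have h3 := congrArg (N ^ L) h2
  rw [map_sum, map_zero, Finset.sum_eq_single_of_mem i0 hi0] at h3
  · rw [map_smul, smul_eq_zero] at h3
    rcases h3 with h3 | h3
    · exact (Finset.mem_filter.1 hi0).2 h3
    · exact hL h3
  · intro j hj hne'
    have hj2 := (Finset.mem_filter.1 (Finset.mem_filter.1 hj).1).2
    have hi2 := (Finset.mem_filter.1 (Finset.mem_filter.1 hi0).1).2
    have hm := hmin j hj
    obtain ⟨m, hm1⟩ := hχ i0 j (hi2.trans hj2.symm)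
    have hjm : ∃ m, j.1 = i0.1.shift (m + 1) := by
      rcases hm1 with hm1 | hm1
      · cases m with
        | zero => exact absurd (Subtype.ext hm1) hne'
        | succ m => exact ⟨m, hm1⟩
      · cases m with
        | zero => exact absurd (Subtype.ext hm1.symm) hne'
        | succ m =>
          have : i0.1.1 = j.1.1 + (m + 1) := congrArg Prod.fst hm1
          omega
    obtain ⟨m, hjm⟩ := hjm
    have : (N ^ L) (e j) = 0 := by
      rw [hjm, ← (hNm (m + 1) i0 i0.2.1).2, ← Module.End.mul_apply, ← pow_add,
        show L + (m + 1) = m + (L + 1) by ring, pow_add, Module.End.mul_apply, hL', map_zero]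
    rw [map_smul, this, smul_zero]

end LinearAlgebra

/-- Multiplicative independence of `ρ, τ₀, τ₁`, where `ρ τ₀ τ₁ ζ = 1`. -/
structure GenericWeights (ρ : ℂ) (τ : Fin 2 → ℂ) (ζ : ℂ) : Prop where
  prod : ρ * τ 0 * τ 1 * ζ = 1
  indep : ∀ a b c : ℤ, ρ ^ a * τ 0 ^ b * τ 1 ^ c = 1 → a = 0 ∧ b = 0 ∧ c = 0

namespace GenericWeights

variable {ρ : ℂ} {τ : Fin 2 → ℂ} {ζ : ℂ} (h : GenericWeights ρ τ ζ)
include h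

theorem ne_zero : ρ ≠ 0 ∧ τ 0 ≠ 0 ∧ τ 1 ≠ 0 ∧ ζ ≠ 0 := by
  have := h.prod
  refine ⟨?_, ?_, ?_, ?_⟩ <;> intro e <;> simp [e] at this

theorem zeta_pow_injective (m n : ℕ) (e : ζ ^ m = ζ ^ n) : m = n := by
  obtain ⟨h1, h2, h3, h4⟩ := h.ne_zero
  have hz : ζ = (ρ * τ 0 * τ 1)⁻¹ := eq_inv_of_mul_eq_one_right h.prod
  have e' : ζ ^ ((m : ℤ) - n) = 1 := by
    rw [zpow_sub₀ h4, zpow_natCast, zpow_natCast, e, div_self (pow_ne_zero _ h4)]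
  have e2 : ρ ^ (-((m : ℤ) - n)) * τ 0 ^ (-((m : ℤ) - n)) * τ 1 ^ (-((m : ℤ) - n)) = 1 := by
    rw [← mul_zpow, ← mul_zpow, ← e', hz, _root_.inv_zpow, ← _root_.zpow_neg]
  have := (h.indep _ _ _ e2).1
  omega

/-- Eliminating `ζ = (ρ τ₀ τ₁)⁻¹` leaves three independent weights, so the difference of the
exponents is a multiple of `(1, 1, 1, 1)`. -/
theorem shift_of_eq {ν : ℂ} (hν : ν ≠ 0) (i j : MonoIdx)
    (e : ν * (ρ ^ i.1 * τ 0 ^ i.2.1 * τ 1 ^ i.2.2.1 * ζ ^ i.2.2.2) =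
      ν * (ρ ^ j.1 * τ 0 ^ j.2.1 * τ 1 ^ j.2.2.1 * ζ ^ j.2.2.2)) :
    ∃ m, j = i.shift m ∨ i = j.shift m := by
  obtain ⟨h1, h2, h3, h4⟩ := h.ne_zero
  obtain ⟨s, a, b, c⟩ := i
  obtain ⟨s', a', b', c'⟩ := j
  have e := mul_left_cancel₀ hν e
  simp only at e
  have hz : ∀ n : ℕ, ζ ^ n = (ρ ^ n * τ 0 ^ n * τ 1 ^ n)⁻¹ := by
    intro n
    rw [← mul_pow, ← mul_pow, ← inv_pow, eq_inv_of_mul_eq_one_right h.prod]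
  rw [hz, hz] at e
  have e2 : ρ ^ ((s : ℤ) - s' - c + c') * τ 0 ^ ((a : ℤ) - a' - c + c') *
      τ 1 ^ ((b : ℤ) - b' - c + c') = 1 := by
    simp only [zpow_add₀ h1, zpow_sub₀ h1, zpow_add₀ h2, zpow_sub₀ h2, zpow_add₀ h3,
      zpow_sub₀ h3, zpow_natCast]
    field_simp at e ⊢
    linear_combination e
  obtain ⟨e3, e4, e5⟩ := h.indep _ _ _ e2
  rcases le_total c c' with hc | hc
  · refine ⟨c' - c, Or.inl ?_⟩
    simp only [MonoIdx.shift, Prod.mk.injEq]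
    omega
  · refine ⟨c - c', Or.inr ?_⟩
    simp only [MonoIdx.shift, Prod.mk.injEq]
    omega

end GenericWeights

namespace ConifoldRep

variable {P Q P' Q' : Type} [AddCommGroup P] [Module ℂ P] [AddCommGroup Q] [Module ℂ Q]
  [AddCommGroup P'] [Module ℂ P'] [AddCommGroup Q'] [Module ℂ Q']

/-- Vectors `n 0, …, n k` with `x₀ n_j = x₁ n_{j+1}`. -/
def IsFraming (c : ConifoldRep P Q) (k : ℕ) (n : ℕ → P) : Prop :=
  ∀ j, j < k → c.x 0 (n j) = c.x 1 (n (j + 1))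

/-- The vectors `n 0, …, n k` generate the representation. -/
def IsGenerated (c : ConifoldRep P Q) (k : ℕ) (n : ℕ → P) : Prop :=
  ∀ W : Sub c, (∀ j ≤ k, n j ∈ W.fst) → W = ⊤

/-- The pair `(g, h)` scales the arrows. -/
structure IsEquivariant (c : ConifoldRep P Q) (ρ : ℂ) (τ : Fin 2 → ℂ) (ζ : ℂ)
    (g : P →ₗ[ℂ] P) (h : Q →ₗ[ℂ] Q) : Prop where
  x0 : ∀ p, h (c.x 0 p) = ρ • c.x 0 (g p)
  x1 : ∀ p, h (c.x 1 p) = c.x 1 (g p)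
  y : ∀ i q, g (c.y i q) = τ i • c.y i (h q)
  z : ∀ p, g (c.z p) = ζ • c.z (g p)
  w : ∀ q, h (c.w q) = ζ • c.w (h q)

variable (c : ConifoldRep P Q) (k : ℕ) (n : ℕ → P)

/-- Monomials in `y₀ x i` applied to the framing. -/
def mono₀ : ℕ → ℕ → P
  | 0, s => n s
  -- The new factor is `x₁` whenever the index `s` allows it; only at the top value of `s` must it
  -- be `x₀`. `x_mono₀` shows that the choice does not matter.
  | b + 1, s => if s ≤ b + k then c.y 0 (c.x 1 (mono₀ b s)) else c.y 0 (c.x 0 (mono₀ b (s - 1)))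

/-- Monomials in `y j x i` applied to the framing: `b₁` factors `y₁`, `b₀` factors `y₀`, and `s` the
sum of the number of factors `x₀` and the index of the framing vector. -/
def mono₁ : ℕ → ℕ → ℕ → P
  | 0, b₀, s => mono₀ c k n b₀ s
  | b₁ + 1, b₀, s =>
    if s ≤ b₀ + b₁ + k then c.y 1 (c.x 1 (mono₁ b₁ b₀ s)) else c.y 1 (c.x 0 (mono₁ b₁ b₀ (s - 1)))

variable {c k n}

/-- This extends the framing relation to all monomials, so a monomial depends only on its exponents
and not on the order of the factors. -/
theorem x_mono₀ (hn : c.IsFraming k n) (b s : ℕ) (hs : s + 1 ≤ b + k) :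
    c.x 0 (mono₀ c k n b s) = c.x 1 (mono₀ c k n b (s + 1)) := by
  induction b generalizing s with
  | zero => exact hn s (by omega)
  | succ b ih =>
    rw [mono₀, mono₀, if_pos (by omega : s ≤ b + k), c.xyx_comm]
    split_ifs with h
    · rw [ih s h]
    · rfl

theorem x_mono₁ (hn : c.IsFraming k n) (b₁ b₀ s : ℕ) (hs : s + 1 ≤ b₀ + b₁ + k) :
    c.x 0 (mono₁ c k n b₁ b₀ s) = c.x 1 (mono₁ c k n b₁ b₀ (s + 1)) := by
  induction b₁ generalizing s with
  | zero => exact x_mono₀ hn b₀ s (by omega)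
  | succ b ih =>
    rw [mono₁, mono₁, if_pos (by omega : s ≤ b₀ + b + k), c.xyx_comm]
    split_ifs with h
    · rw [ih s h]
    · rfl

/-- The number of factors `x₀` in `x i`. -/
def xdeg (i : Fin 2) : ℕ := if i = 0 then 1 else 0

theorem yx_mono₀ (hn : c.IsFraming k n) (i : Fin 2) (b s : ℕ) (hs : s ≤ b + k) :
    c.y 0 (c.x i (mono₀ c k n b s)) = mono₀ c k n (b + 1) (s + xdeg i) := by
  fin_cases i
  · change c.y 0 (c.x 0 _) = mono₀ c k n (b + 1) (s + 1)
    rw [mono₀]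
    split_ifs with h
    · rw [x_mono₀ hn b s h]
    · rfl
  · change c.y 0 (c.x 1 _) = mono₀ c k n (b + 1) s
    rw [mono₀, if_pos hs]

theorem y₁x_mono₁ (hn : c.IsFraming k n) (i : Fin 2) (b₁ b₀ s : ℕ) (hs : s ≤ b₀ + b₁ + k) :
    c.y 1 (c.x i (mono₁ c k n b₁ b₀ s)) = mono₁ c k n (b₁ + 1) b₀ (s + xdeg i) := by
  fin_cases i
  · change c.y 1 (c.x 0 _) = mono₁ c k n (b₁ + 1) b₀ (s + 1)
    rw [mono₁]
    split_ifs with h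
    · rw [x_mono₁ hn b₁ b₀ s h]
    · rfl
  · change c.y 1 (c.x 1 _) = mono₁ c k n (b₁ + 1) b₀ s
    rw [mono₁, if_pos hs]

/-- The relations move the new factor `y₀` past the outermost `y₁`, which reduces to a monomial with
one factor `y₁` less. -/
theorem y₀x_mono₁ (hn : c.IsFraming k n) (i : Fin 2) (b₁ b₀ s : ℕ) (hs : s ≤ b₀ + b₁ + k) :
    c.y 0 (c.x i (mono₁ c k n b₁ b₀ s)) = mono₁ c k n b₁ (b₀ + 1) (s + xdeg i) := by
  induction b₁ generalizing s with
  | zero => exact yx_mono₀ hn i b₀ s hs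
  | succ b ih =>
    rw [mono₁]
    split_ifs with h
    · rw [c.yxy_comm, c.xyx_comm, ih s h, y₁x_mono₁ hn 1 _ _ _ (by unfold xdeg; split_ifs <;> omega)]
      rfl
    · have h1 : s - 1 ≤ b₀ + b + k := by omega
      rw [c.yxy_comm, c.xyx_comm, ih (s - 1) h1,
        y₁x_mono₁ hn 0 _ _ _ (by unfold xdeg; split_ifs <;> omega)]
      congr 1
      change s - 1 + xdeg i + 1 = _
      omega

variable (c k n)

/-- The monomials in the first vertex space. -/
def monoP (i : MonoIdx) : P := (c.z ^ i.2.2.2) (mono₁ c k n i.2.2.1 i.2.1 i.1)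

/-- The monomials in the second vertex space. -/
def monoQ (i : MonoIdx) : Q :=
  if i.1 ≤ i.2.1 + i.2.2.1 + k then c.x 1 (monoP c k n i)
  else c.x 0 (monoP c k n (i.1 - 1, i.2))

/-- The exponents of monomials in the first vertex space. -/
def idxP : Set MonoIdx := {i | i.1 ≤ i.2.1 + i.2.2.1 + k}

/-- The exponents of monomials in the second vertex space. -/
def idxQ : Set MonoIdx := {i | i.1 ≤ i.2.1 + i.2.2.1 + 1 + k}

/-- The exponent of `y l` times a monomial. -/
def ystep (l : Fin 2) (i : MonoIdx) : MonoIdx :=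
  if l = 0 then (i.1, i.2.1 + 1, i.2.2) else (i.1, i.2.1, i.2.2.1 + 1, i.2.2.2)

/-- The exponent of `x l` times a monomial. -/
def xstep (l : Fin 2) (i : MonoIdx) : MonoIdx := (i.1 + xdeg l, i.2)

/-- The exponent of a loop times a monomial. -/
def zstep (i : MonoIdx) : MonoIdx := (i.1, i.2.1, i.2.2.1, i.2.2.2 + 1)

variable {c k n}

theorem xstep_mem {i : MonoIdx} (hi : i ∈ idxP k) (l : Fin 2) : xstep l i ∈ idxQ k := by
  simp only [idxP, idxQ, Set.mem_ofPred_eq, xstep, xdeg] at *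
  split_ifs <;> omega

theorem ystep_mem {i : MonoIdx} (hi : i ∈ idxQ k) (l : Fin 2) : ystep l i ∈ idxP k := by
  simp only [idxP, idxQ, Set.mem_ofPred_eq, ystep] at *
  split_ifs <;> simp only <;> omega

theorem z_pow_y (m : ℕ) (l : Fin 2) (q : Q) : (c.z ^ m) (c.y l q) = c.y l ((c.w ^ m) q) := by
  induction m with
  | zero => rfl
  | succ m ih => rw [pow_succ', pow_succ', Module.End.mul_apply, ih, c.zy]; rfl

theorem w_pow_x (m : ℕ) (l : Fin 2) (p : P) : (c.w ^ m) (c.x l p) = c.x l ((c.z ^ m) p) :=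
  c.swap.z_pow_y m l p

theorem z_monoP (i : MonoIdx) : c.z (monoP c k n i) = monoP c k n (zstep i) := by
  simp only [monoP, zstep, pow_succ', Module.End.mul_apply]

theorem x_monoP (hn : c.IsFraming k n) {i : MonoIdx} (hi : i ∈ idxP k) (l : Fin 2) :
    c.x l (monoP c k n i) = monoQ c k n (xstep l i) := by
  have hi' : i.1 ≤ i.2.1 + i.2.2.1 + k := hi
  fin_cases l
  · change c.x 0 _ = monoQ c k n (i.1 + 1, i.2)
    rw [monoQ]
    split_ifs with h
    · simp only [monoP]
      rw [← w_pow_x, ← w_pow_x, x_mono₁ hn _ _ _ h]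
    · rfl
  · change c.x 1 _ = monoQ c k n i
    rw [monoQ, if_pos hi']

theorem yx_monoP (hn : c.IsFraming k n) {i : MonoIdx} (hi : i ∈ idxP k) (l j : Fin 2) :
    c.y l (c.x j (monoP c k n i)) = monoP c k n (ystep l (xstep j i)) := by
  have hi' : i.1 ≤ i.2.1 + i.2.2.1 + k := hi
  simp only [monoP]
  rw [← w_pow_x, ← z_pow_y]
  fin_cases l
  · exact congrArg _ (y₀x_mono₁ hn j _ _ _ hi')
  · exact congrArg _ (y₁x_mono₁ hn j _ _ _ hi')

theorem y_monoQ (hn : c.IsFraming k n) {i : MonoIdx} (hi : i ∈ idxQ k) (l : Fin 2) :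
    c.y l (monoQ c k n i) = monoP c k n (ystep l i) := by
  have hi' : i.1 ≤ i.2.1 + i.2.2.1 + 1 + k := hi
  rw [monoQ]
  split_ifs with h
  · rw [yx_monoP hn h]
    rfl
  · rw [yx_monoP hn (show (i.1 - 1, i.2) ∈ idxP k by
      simp only [idxP, Set.mem_ofPred_eq]; omega)]
    have : xstep 0 (i.1 - 1, i.2) = i := by
      change (i.1 - 1 + 1, i.2) = i
      rw [Nat.sub_add_cancel (by omega)]
    rw [this]

theorem w_monoQ (i : MonoIdx) : c.w (monoQ c k n i) = monoQ c k n (zstep i) := by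
  simp only [monoQ]
  rw [apply_ite c.w, c.wx, c.wx, z_monoP, z_monoP]
  rfl

variable {ρ : ℂ} {τ : Fin 2 → ℂ} {ζ ν : ℂ} {g : P →ₗ[ℂ] P} {h : Q →ₗ[ℂ] Q}

/-- The weight of a monomial. -/
def monoWeight (ρ : ℂ) (τ : Fin 2 → ℂ) (ζ ν : ℂ) (i : MonoIdx) : ℂ :=
  ν * (ρ ^ i.1 * τ 0 ^ i.2.1 * τ 1 ^ i.2.2.1 * ζ ^ i.2.2.2)

theorem IsEquivariant.yx (hg : c.IsEquivariant ρ τ ζ g h) (i l : Fin 2) (p : P) :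
    g (c.y l (c.x i p)) = (τ l * ρ ^ xdeg i) • c.y l (c.x i (g p)) := by
  rw [hg.y]
  fin_cases i
  · simp [hg.x0, xdeg, smul_smul]
  · simp [hg.x1, xdeg]

theorem IsEquivariant.g_mono₁ (hg : c.IsEquivariant ρ τ ζ g h)
    (hν : ∀ j ≤ k, g (n j) = (ν * ρ ^ j) • n j) (b₁ b₀ s : ℕ) (hs : s ≤ b₀ + b₁ + k) :
    g (mono₁ c k n b₁ b₀ s) = (ν * (ρ ^ s * τ 0 ^ b₀ * τ 1 ^ b₁)) • mono₁ c k n b₁ b₀ s := by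
  induction b₁ generalizing s with
  | zero =>
    change g (mono₀ c k n b₀ s) = _ • mono₀ c k n b₀ s
    induction b₀ generalizing s with
    | zero =>
      rw [mono₀, hν s (by omega)]
      simp
    | succ b ih =>
      rw [mono₀]
      split_ifs with h1
      · rw [hg.yx, ih s (by omega)]
        simp only [map_smul, smul_smul, xdeg]
        congr 1
        simp
        ring
      · rw [hg.yx, ih (s - 1) (by omega)]
        simp only [map_smul, smul_smul, xdeg]
        congr 1
        obtain ⟨t, rfl⟩ : ∃ t, s = t + 1 := ⟨s - 1, by omega⟩
        simp
        ring
  | succ b ih =>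
    rw [mono₁]
    split_ifs with h1
    · rw [hg.yx, ih s (by omega)]
      simp only [map_smul, smul_smul, xdeg]
      congr 1
      simp
      ring
    · rw [hg.yx, ih (s - 1) (by omega)]
      simp only [map_smul, smul_smul, xdeg]
      congr 1
      obtain ⟨t, rfl⟩ : ∃ t, s = t + 1 := ⟨s - 1, by omega⟩
      simp
      ring

theorem IsEquivariant.g_monoP (hg : c.IsEquivariant ρ τ ζ g h)
    (hν : ∀ j ≤ k, g (n j) = (ν * ρ ^ j) • n j) {i : MonoIdx} (hi : i ∈ idxP k) :
    g (monoP c k n i) = monoWeight ρ τ ζ ν i • monoP c k n i := by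
  obtain ⟨s, b₀, b₁, m⟩ := i
  induction m with
  | zero => simpa [monoP, monoWeight] using hg.g_mono₁ hν b₁ b₀ s hi
  | succ m ih =>
    have ih := ih hi
    have : monoP c k n (s, b₀, b₁, m + 1) = c.z (monoP c k n (s, b₀, b₁, m)) :=
      (z_monoP (s, b₀, b₁, m)).symm
    rw [this, hg.z, ih, map_smul, smul_smul]
    congr 1
    simp only [monoWeight]
    ring

theorem IsEquivariant.h_monoQ (hg : c.IsEquivariant ρ τ ζ g h)
    (hν : ∀ j ≤ k, g (n j) = (ν * ρ ^ j) • n j) {i : MonoIdx} (hi : i ∈ idxQ k) :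
    h (monoQ c k n i) = monoWeight ρ τ ζ ν i • monoQ c k n i := by
  have hi' : i.1 ≤ i.2.1 + i.2.2.1 + 1 + k := hi
  rw [monoQ]
  split_ifs with h1
  · rw [hg.x1, hg.g_monoP hν h1, map_smul]
  · rw [hg.x0, hg.g_monoP hν (show (i.1 - 1, i.2) ∈ idxP k by
      simp only [idxP, Set.mem_ofPred_eq]; omega), map_smul, smul_smul]
    congr 1
    obtain ⟨t, ht⟩ : ∃ t, i.1 = t + 1 := ⟨i.1 - 1, by omega⟩
    simp only [monoWeight, ht]
    simp
    ring

/-! ### The nonzero monomials as bases of the vertex spaces. -/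

section Independence

variable [FiniteDimensional ℂ P] [FiniteDimensional ℂ Q]

theorem monoWeight_ne_zero (hw : GenericWeights ρ τ ζ) (hν0 : ν ≠ 0) (i : MonoIdx) :
    monoWeight ρ τ ζ ν i ≠ 0 := by
  obtain ⟨h1, h2, h3, h4⟩ := hw.ne_zero
  simp [monoWeight, hν0, h1, h2, h3, h4]

theorem linearIndependent_monoP (hw : GenericWeights ρ τ ζ) (hn : c.IsFraming k n)
    (hg : c.IsEquivariant ρ τ ζ g h) (hν0 : ν ≠ 0) (hν : ∀ j ≤ k, g (n j) = (ν * ρ ^ j) • n j) :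
    LinearIndependent ℂ (fun i : {i // i ∈ idxP k ∧ monoP c k n i ≠ 0} => monoP c k n i) := by
  -- The loop times `T` raises each of the four exponents by one, so by `ρ τ₀ τ₁ ζ = 1` it preserves
  -- weights. It is nilpotent on each monomial because the loop is, and the loop commutes with `T`.
  let T : P →ₗ[ℂ] P := c.y 1 ∘ₗ c.x 1 ∘ₗ c.y 0 ∘ₗ c.x 0
  have hcomm : Commute c.z T := by
    ext p
    simp [T, Module.End.mul_apply, c.zy, c.wx]
  refine linearIndependent_monomials g (c.z * T) (idxP k) _ (monoWeight ρ τ ζ ν)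
    (fun i hi => hg.g_monoP hν hi) ?_ ?_ ?_ (fun i j e => hw.shift_of_eq hν0 i j e)
  · intro i hi
    simp only [idxP, Set.mem_ofPred_eq, MonoIdx.shift] at *
    omega
  · intro i hi
    have h1 : ystep 0 (xstep 0 i) ∈ idxP k := ystep_mem (xstep_mem hi 0) 0
    change c.z (c.y 1 (c.x 1 (c.y 0 (c.x 0 (monoP c k n i))))) = _
    rw [yx_monoP hn hi, yx_monoP hn h1, z_monoP]
    rfl
  · intro i hi
    obtain ⟨L, hL⟩ := exists_pow_apply_eq_zero g c.z hg.z hw.zeta_pow_injective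
      (monoWeight_ne_zero hw hν0 i) (hg.g_monoP hν hi)
    refine ⟨L, ?_⟩
    rw [hcomm.mul_pow, (hcomm.pow_pow L L).eq, Module.End.mul_apply, hL, map_zero]

theorem linearIndependent_monoQ (hw : GenericWeights ρ τ ζ) (hn : c.IsFraming k n)
    (hg : c.IsEquivariant ρ τ ζ g h) (hν0 : ν ≠ 0) (hν : ∀ j ≤ k, g (n j) = (ν * ρ ^ j) • n j) :
    LinearIndependent ℂ (fun i : {i // i ∈ idxQ k ∧ monoQ c k n i ≠ 0} => monoQ c k n i) := by
  let T : Q →ₗ[ℂ] Q := c.x 1 ∘ₗ c.y 1 ∘ₗ c.x 0 ∘ₗ c.y 0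
  have hcomm : Commute c.w T := by
    ext p
    simp [T, Module.End.mul_apply, c.zy, c.wx]
  refine linearIndependent_monomials h (c.w * T) (idxQ k) _ (monoWeight ρ τ ζ ν)
    (fun i hi => hg.h_monoQ hν hi) ?_ ?_ ?_ (fun i j e => hw.shift_of_eq hν0 i j e)
  · intro i hi
    simp only [idxQ, Set.mem_ofPred_eq, MonoIdx.shift] at *
    omega
  · intro i hi
    have h1 : ystep 0 i ∈ idxP k := ystep_mem hi 0
    have h2 := xstep_mem h1 0
    have h3 := ystep_mem h2 1
    change c.w (c.x 1 (c.y 1 (c.x 0 (c.y 0 (monoQ c k n i))))) = _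
    rw [y_monoQ hn hi, x_monoP hn h1, y_monoQ hn h2, x_monoP hn h3, w_monoQ]
    rfl
  · intro i hi
    obtain ⟨L, hL⟩ := exists_pow_apply_eq_zero h c.w hg.w hw.zeta_pow_injective
      (monoWeight_ne_zero hw hν0 i) (hg.h_monoQ hν hi)
    refine ⟨L, ?_⟩
    rw [hcomm.mul_pow, (hcomm.pow_pow L L).eq, Module.End.mul_apply, hL, map_zero]

theorem span_mono (hn : c.IsFraming k n) (hgen : c.IsGenerated k n) :
    Submodule.span ℂ (monoP c k n '' idxP k) = ⊤ ∧
      Submodule.span ℂ (monoQ c k n '' idxQ k) = ⊤ := by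
  have key : ∀ {V V' : Type} [AddCommGroup V] [Module ℂ V] [AddCommGroup V'] [Module ℂ V']
      (f : V →ₗ[ℂ] V') (s : Set V) (t : Submodule ℂ V'), (∀ v ∈ s, f v ∈ t) →
      ∀ v ∈ Submodule.span ℂ s, f v ∈ t := by
    intro V V' _ _ _ _ f s t hs v hv
    exact (Submodule.span_le (p := t.comap f)).2 hs hv
  let W : Sub c :=
    { fst := Submodule.span ℂ (monoP c k n '' idxP k)
      snd := Submodule.span ℂ (monoQ c k n '' idxQ k)
      x_mem := fun l => key _ _ _ (by
        rintro _ ⟨i, hi, rfl⟩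
        rw [x_monoP hn hi]
        exact Submodule.subset_span ⟨_, xstep_mem hi l, rfl⟩)
      y_mem := fun l => key _ _ _ (by
        rintro _ ⟨i, hi, rfl⟩
        rw [y_monoQ hn hi]
        exact Submodule.subset_span ⟨_, ystep_mem hi l, rfl⟩)
      z_mem := key _ _ _ (by
        rintro _ ⟨i, hi, rfl⟩
        rw [z_monoP]
        exact Submodule.subset_span ⟨zstep i, hi, rfl⟩)
      w_mem := key _ _ _ (by
        rintro _ ⟨i, hi, rfl⟩
        rw [w_monoQ]
        exact Submodule.subset_span ⟨zstep i, hi, rfl⟩) }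
  have hW := hgen W (fun j hj => Submodule.subset_span
    ⟨(j, 0, 0, 0), by simpa [idxP] using hj, rfl⟩)
  exact ⟨congrArg Sub.fst hW, congrArg Sub.snd hW⟩

/-- A nonzero monomial is obtained from one with a factor `y x` less, which is then nonzero too. -/
theorem exists_pred_monoP (hn : c.IsFraming k n) {i : MonoIdx} (hi : i ∈ idxP k)
    (h0 : monoP c k n i ≠ 0) (hb : 0 < i.2.1 + i.2.2.1) :
    ∃ i' ∈ idxP k, monoP c k n i' ≠ 0 ∧ i'.2.1 + i'.2.2.1 + 1 = i.2.1 + i.2.2.1 := by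
  suffices ∃ i' ∈ idxP k, ∃ l j, i = ystep l (xstep j i') ∧
      i'.2.1 + i'.2.2.1 + 1 = i.2.1 + i.2.2.1 by
    obtain ⟨i', hi', l, j, e, hb'⟩ := this
    refine ⟨i', hi', fun e0 => h0 ?_, hb'⟩
    rw [e, ← yx_monoP hn hi', e0, map_zero, map_zero]
  obtain ⟨s, b₀, b₁, m⟩ := i
  simp only [idxP, Set.mem_ofPred_eq] at hi hb ⊢
  cases b₁ with
  | succ b =>
    by_cases hs : s ≤ b₀ + b + k
    · exact ⟨(s, b₀, b, m), hs, 1, 1, rfl, by simp only; omega⟩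
    · refine ⟨(s - 1, b₀, b, m), by simp only; omega, 1, 0, ?_, by simp only; omega⟩
      change _ = (s - 1 + 1, b₀, b + 1, m)
      rw [Nat.sub_add_cancel (by omega)]
  | zero =>
    obtain ⟨b, rfl⟩ : ∃ b, b₀ = b + 1 := ⟨b₀ - 1, by omega⟩
    by_cases hs : s ≤ b + 0 + k
    · exact ⟨(s, b, 0, m), hs, 0, 1, rfl, by simp only⟩
    · refine ⟨(s - 1, b, 0, m), by simp only; omega, 0, 0, ?_, by simp only⟩
      change _ = (s - 1 + 1, b + 1, 0, m)
      rw [Nat.sub_add_cancel (by omega)]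

/-- Dividing a nonzero monomial successively by factors `y x`, or by the loop, yields distinct
nonzero monomials, which are independent; so their number is at most the dimension. The exponent `s`
is bounded through membership in `idxP`. -/
theorem lt_finrank_of_monoP_ne_zero (hw : GenericWeights ρ τ ζ) (hn : c.IsFraming k n)
    (hg : c.IsEquivariant ρ τ ζ g h) (hν0 : ν ≠ 0) (hν : ∀ j ≤ k, g (n j) = (ν * ρ ^ j) • n j)
    {i : MonoIdx} (hi : i ∈ idxP k) (h0 : monoP c k n i ≠ 0) :
    i.2.1 + i.2.2.1 < finrank ℂ P ∧ i.2.2.2 < finrank ℂ P := by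
  have hli := linearIndependent_monoP hw hn hg hν0 hν
  have hcard : ∀ (N : ℕ) (F : Fin (N + 1) → {i // i ∈ idxP k ∧ monoP c k n i ≠ 0}),
      Function.Injective F → N < finrank ℂ P := by
    intro N F hF
    have := (hli.comp F hF).fintype_card_le_finrank
    rw [Fintype.card_fin] at this
    omega
  constructor
  · have key : ∀ N : ℕ, ∀ i ∈ idxP k, monoP c k n i ≠ 0 → i.2.1 + i.2.2.1 = N → ∀ m ≤ N,
        ∃ i' ∈ idxP k, monoP c k n i' ≠ 0 ∧ i'.2.1 + i'.2.2.1 = m := by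
      intro N
      induction N with
      | zero => exact fun i hi h0 hb m hm => ⟨i, hi, h0, by omega⟩
      | succ N ih =>
        intro i hi h0 hb m hm
        rcases Nat.lt_or_ge N m with h1 | h1
        · exact ⟨i, hi, h0, by omega⟩
        · obtain ⟨i', hi', h0', hb'⟩ := exists_pred_monoP hn hi h0 (by omega)
          exact ih i' hi' h0' (by omega) m h1
    choose F hF hF0 hFm using key _ i hi h0 rfl
    refine hcard _ (fun m => ⟨F m.1 (by omega), hF _ _, hF0 _ _⟩) fun m m' e => ?_
    have e' : F m.1 (by omega) = F m'.1 (by omega) := congrArg Subtype.val e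
    have h1 := hFm m.1 (by omega)
    have h2 := hFm m'.1 (by omega)
    rw [e', h2] at h1
    exact Fin.ext h1.symm
  · refine hcard _ (fun m => ⟨(i.1, i.2.1, i.2.2.1, m.1), hi, fun e => h0 ?_⟩) fun m m' e => ?_
    · have hm : i.2.2.2 = (i.2.2.2 - m.1) + m.1 := by omega
      rw [monoP, hm, pow_add, Module.End.mul_apply]
      rw [monoP] at e
      simp only at e
      rw [e, map_zero]
    · simpa [Fin.ext_iff] using e

end Independence

theorem exists_linearMap_of_linearIndependent {ι M M' : Type} [AddCommGroup M] [Module ℂ M]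
    [AddCommGroup M'] [Module ℂ M'] (S : Set ι) (e : ι → M) (e' : ι → M')
    (hli : LinearIndependent ℂ (fun i : {i // i ∈ S ∧ e i ≠ 0} => e i))
    (hspan : Submodule.span ℂ (e '' S) = ⊤) (h0 : ∀ i ∈ S, e i = 0 → e' i = 0) :
    ∃ f : M →ₗ[ℂ] M', ∀ i ∈ S, f (e i) = e' i := by
  have hsp : ⊤ ≤ Submodule.span ℂ (Set.range fun i : {i // i ∈ S ∧ e i ≠ 0} => e i) := by
    rw [← hspan, Submodule.span_le]
    rintro _ ⟨i, hi, rfl⟩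
    by_cases hz : e i = 0
    · rw [hz]
      exact Submodule.zero_mem _
    · exact Submodule.subset_span ⟨⟨i, hi, hz⟩, rfl⟩
  let B := Basis.mk hli hsp
  refine ⟨B.constr ℂ fun i => e' i, fun i hi => ?_⟩
  by_cases hz : e i = 0
  · rw [hz, map_zero, h0 i hi hz]
  · have : e i = B ⟨i, hi, hz⟩ := by simp [B]
    rw [this, Basis.constr_basis]

theorem exists_linearEquiv_of_linearIndependent {ι M M' : Type} [AddCommGroup M] [Module ℂ M]
    [AddCommGroup M'] [Module ℂ M'] (S : Set ι) (e : ι → M) (e' : ι → M')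
    (hli : LinearIndependent ℂ (fun i : {i // i ∈ S ∧ e i ≠ 0} => e i))
    (hspan : Submodule.span ℂ (e '' S) = ⊤)
    (hli' : LinearIndependent ℂ (fun i : {i // i ∈ S ∧ e' i ≠ 0} => e' i))
    (hspan' : Submodule.span ℂ (e' '' S) = ⊤) (h0 : ∀ i ∈ S, e i = 0 ↔ e' i = 0) :
    ∃ f : M ≃ₗ[ℂ] M', ∀ i ∈ S, f (e i) = e' i := by
  obtain ⟨f, hf⟩ := exists_linearMap_of_linearIndependent S e e' hli hspan fun i hi => (h0 i hi).1
  obtain ⟨f', hf'⟩ :=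
    exists_linearMap_of_linearIndependent S e' e hli' hspan' fun i hi => (h0 i hi).2
  refine ⟨LinearEquiv.ofLinearMap f f' (LinearMap.ext_on hspan' ?_) (LinearMap.ext_on hspan ?_), hf⟩
  · rintro _ ⟨i, hi, rfl⟩
    simp [hf' i hi, hf i hi]
  · rintro _ ⟨i, hi, rfl⟩
    simp [hf' i hi, hf i hi]

end ConifoldRep

/-- A representation with an equivariant framing by `n 0, …, n k`. -/
structure FramedObj (ρ : ℂ) (τ : Fin 2 → ℂ) (ζ : ℂ) (k : ℕ) where
  P : Type
  Q : Type
  [addP : AddCommGroup P]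
  [modP : Module ℂ P]
  [addQ : AddCommGroup Q]
  [modQ : Module ℂ Q]
  [finP : FiniteDimensional ℂ P]
  [finQ : FiniteDimensional ℂ Q]
  c : ConifoldRep P Q
  n : ℕ → P
  framing : c.IsFraming k n
  g : P →ₗ[ℂ] P
  h : Q →ₗ[ℂ] Q
  equivariant : c.IsEquivariant ρ τ ζ g h
  ν : ℂ
  ν_ne : ν ≠ 0
  weight : ∀ j ≤ k, g (n j) = (ν * ρ ^ j) • n j

namespace FramedObj

attribute [instance] addP modP addQ modQ finP finQ

variable {ρ : ℂ} {τ : Fin 2 → ℂ} {ζ : ℂ} {k : ℕ}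

/-- Isomorphism of framed representations. -/
def Iso (X Y : FramedObj ρ τ ζ k) : Prop :=
  ∃ (f : X.P ≃ₗ[ℂ] Y.P) (g : X.Q ≃ₗ[ℂ] Y.Q),
    X.c.IsHom Y.c f.toLinearMap g.toLinearMap ∧ ∀ j ≤ k, f (X.n j) = Y.n j

/-- The set has finitely many isomorphism classes. -/
def FiniteClasses (S : Set (FramedObj ρ τ ζ k)) : Prop :=
  ∃ (ι : Type) (_ : Finite ι) (F : FramedObj ρ τ ζ k → ι), ∀ X ∈ S, ∀ Y ∈ S, F X = F Y → X.Iso Y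

theorem FiniteClasses.mono {S T : Set (FramedObj ρ τ ζ k)} (hT : FiniteClasses T) (h : S ⊆ T) :
    FiniteClasses S := by
  obtain ⟨ι, hι, F, hF⟩ := hT
  exact ⟨ι, hι, F, fun X hX Y hY => hF X (h hX) Y (h hY)⟩

open ConifoldRep

/-- The nonzero monomials are bases, and every arrow sends a monomial to a monomial by the same rule
in `X` and `Y`. Matching monomials is thus compatible with all arrows. -/
theorem iso_of_monomials (hw : GenericWeights ρ τ ζ) (X Y : FramedObj ρ τ ζ k)
    (hX : X.c.IsGenerated k X.n) (hY : Y.c.IsGenerated k Y.n)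
    (hP : ∀ i ∈ idxP k, monoP X.c k X.n i = 0 ↔ monoP Y.c k Y.n i = 0)
    (hQ : ∀ i ∈ idxQ k, monoQ X.c k X.n i = 0 ↔ monoQ Y.c k Y.n i = 0) : X.Iso Y := by
  obtain ⟨hXP, hXQ⟩ := span_mono X.framing hX
  obtain ⟨hYP, hYQ⟩ := span_mono Y.framing hY
  obtain ⟨f, hf⟩ := exists_linearEquiv_of_linearIndependent (idxP k) _ _
    (linearIndependent_monoP hw X.framing X.equivariant X.ν_ne X.weight) hXP
    (linearIndependent_monoP hw Y.framing Y.equivariant Y.ν_ne Y.weight) hYP hP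
  obtain ⟨g, hg⟩ := exists_linearEquiv_of_linearIndependent (idxQ k) _ _
    (linearIndependent_monoQ hw X.framing X.equivariant X.ν_ne X.weight) hXQ
    (linearIndependent_monoQ hw Y.framing Y.equivariant Y.ν_ne Y.weight) hYQ hQ
  have extP : ∀ {V : Type} [AddCommGroup V] [Module ℂ V] (F G : X.P →ₗ[ℂ] V),
      (∀ i ∈ idxP k, F (monoP X.c k X.n i) = G (monoP X.c k X.n i)) → ∀ p, F p = G p := by
    intro V _ _ F G hFG p
    refine LinearMap.congr_fun (LinearMap.ext_on hXP ?_) p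
    rintro _ ⟨i, hi, rfl⟩
    exact hFG i hi
  have extQ : ∀ {V : Type} [AddCommGroup V] [Module ℂ V] (F G : X.Q →ₗ[ℂ] V),
      (∀ i ∈ idxQ k, F (monoQ X.c k X.n i) = G (monoQ X.c k X.n i)) → ∀ p, F p = G p := by
    intro V _ _ F G hFG p
    refine LinearMap.congr_fun (LinearMap.ext_on hXQ ?_) p
    rintro _ ⟨i, hi, rfl⟩
    exact hFG i hi
  refine ⟨f, g, ⟨fun l => ?_, fun l => ?_, ?_, ?_⟩, fun j hj => ?_⟩
  · refine extP (g.toLinearMap ∘ₗ X.c.x l) (Y.c.x l ∘ₗ f.toLinearMap) fun i hi => ?_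
    simp only [LinearMap.comp_apply, LinearEquiv.coe_coe]
    rw [x_monoP X.framing hi, hf i hi, hg _ (xstep_mem hi l), x_monoP Y.framing hi]
  · refine extQ (f.toLinearMap ∘ₗ X.c.y l) (Y.c.y l ∘ₗ g.toLinearMap) fun i hi => ?_
    simp only [LinearMap.comp_apply, LinearEquiv.coe_coe]
    rw [y_monoQ X.framing hi, hg i hi, hf _ (ystep_mem hi l), y_monoQ Y.framing hi]
  · refine extP (f.toLinearMap ∘ₗ X.c.z) (Y.c.z ∘ₗ f.toLinearMap) fun i hi => ?_
    simp only [LinearMap.comp_apply, LinearEquiv.coe_coe]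
    rw [z_monoP, hf i hi, hf (zstep i) hi, z_monoP]
  · refine extQ (g.toLinearMap ∘ₗ X.c.w) (Y.c.w ∘ₗ g.toLinearMap) fun i hi => ?_
    simp only [LinearMap.comp_apply, LinearEquiv.coe_coe]
    rw [w_monoQ, hg i hi, hg (zstep i) hi, w_monoQ]
  · exact hf (j, 0, 0, 0) (by simpa [idxP] using hj)

/-- The exponents of size at most `N`. -/
def monoBox (N : ℕ) : Finset MonoIdx :=
  Finset.range N ×ˢ Finset.range N ×ˢ Finset.range N ×ˢ Finset.range N

/-- Monomials with exponents outside a box depending only on `D` and `k` vanish, so the sets of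
vanishing monomials inside the box determine the isomorphism class. -/
theorem finiteClasses_of_isGenerated (hw : GenericWeights ρ τ ζ) (D : ℕ) :
    FiniteClasses {X : FramedObj ρ τ ζ k | X.c.IsGenerated k X.n ∧ finrank ℂ X.P ≤ D} := by
  let N := D + k + 2
  refine ⟨Set (monoBox N) × Set (monoBox N), inferInstance,
    fun X => ({i | monoP X.c k X.n i = 0}, {i | monoQ X.c k X.n i = 0}), ?_⟩
  rintro X ⟨hX, hXD⟩ Y ⟨hY, hYD⟩ e
  have e1 := congrArg Prod.fst e
  have e2 := congrArg Prod.snd e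
  have hP : ∀ Z : FramedObj ρ τ ζ k, finrank ℂ Z.P ≤ D → ∀ i ∈ idxP k, i ∉ monoBox N →
      monoP Z.c k Z.n i = 0 := by
    intro Z hZ i hi hN
    by_contra h0
    have := lt_finrank_of_monoP_ne_zero hw Z.framing Z.equivariant Z.ν_ne Z.weight hi h0
    apply hN
    simp only [idxP, Set.mem_ofPred_eq] at hi
    simp only [monoBox, Finset.mem_product, Finset.mem_range, N]
    omega
  have hQ : ∀ Z : FramedObj ρ τ ζ k, finrank ℂ Z.P ≤ D → ∀ i ∈ idxQ k, i ∉ monoBox N →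
      monoQ Z.c k Z.n i = 0 := by
    intro Z hZ i hi hN
    have hi' : i.1 ≤ i.2.1 + i.2.2.1 + 1 + k := hi
    have bound : ∀ j ∈ idxP k, monoP Z.c k Z.n j ≠ 0 → j.2 = i.2 → False := by
      intro j hj h0 hji
      have := lt_finrank_of_monoP_ne_zero hw Z.framing Z.equivariant Z.ν_ne Z.weight hj h0
      rw [hji] at this
      apply hN
      simp only [monoBox, Finset.mem_product, Finset.mem_range, N]
      omega
    rw [monoQ]
    split_ifs with h1
    · have : monoP Z.c k Z.n i = 0 := by
        by_contra h0
        exact bound i h1 h0 rfl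
      rw [this, map_zero]
    · have : monoP Z.c k Z.n (i.1 - 1, i.2) = 0 := by
        by_contra h0
        refine bound _ ?_ h0 rfl
        simp only [idxP, Set.mem_ofPred_eq]
        omega
      rw [this, map_zero]
  refine iso_of_monomials hw X Y hX hY (fun i hi => ?_) fun i hi => ?_
  · by_cases hN : i ∈ monoBox N
    · exact Set.ext_iff.1 e1 ⟨i, hN⟩
    · simp [hP X hXD i hi hN, hP Y hYD i hi hN]
  · by_cases hN : i ∈ monoBox N
    · exact Set.ext_iff.1 e2 ⟨i, hN⟩
    · simp [hQ X hXD i hi hN, hQ Y hYD i hi hN]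

end FramedObj

end

/-! ### Reflection -/

section

theorem exists_equiv_of_range {P P' M M' : Type} [AddCommGroup P] [Module ℂ P] [AddCommGroup P']
    [Module ℂ P'] [AddCommGroup M] [Module ℂ M] [AddCommGroup M'] [Module ℂ M']
    (σ : P →ₗ[ℂ] M) (σ' : P' →ₗ[ℂ] M') (hσ : Function.Injective σ) (hσ' : Function.Injective σ')
    (F : M ≃ₗ[ℂ] M') (h : ∀ m, m ∈ LinearMap.range σ ↔ F m ∈ LinearMap.range σ') :
    ∃ f : P ≃ₗ[ℂ] P', ∀ p, σ' (f p) = F (σ p) := by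
  have hmap : (LinearMap.range σ).map (F : M →ₗ[ℂ] M') = LinearMap.range σ' := by
    ext m
    constructor
    · rintro ⟨a, ha, rfl⟩
      exact (h a).1 ha
    · intro hm
      refine ⟨F.symm m, (h _).2 (by simpa using hm), by simp⟩
  refine ⟨(LinearEquiv.ofInjective σ hσ).trans ((F.submoduleMap _).trans
    ((LinearEquiv.ofEq _ _ hmap).trans (LinearEquiv.ofInjective σ' hσ').symm)), fun p => ?_⟩
  have : ∀ m : LinearMap.range σ', σ' ((LinearEquiv.ofInjective σ' hσ').symm m) = m := by
    intro m
    exact congrArg Subtype.val ((LinearEquiv.ofInjective σ' hσ').apply_symm_apply m)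
  simp only [LinearEquiv.trans_apply]
  rw [this]
  rfl

namespace ConifoldRep

variable {P Q P' Q' : Type} [AddCommGroup P] [Module ℂ P] [AddCommGroup Q] [Module ℂ Q]
  [AddCommGroup P'] [Module ℂ P'] [AddCommGroup Q'] [Module ℂ Q']

/-- Stability of a representation with framing vectors `FP`, `FQ`. -/
def IsFramedStable (c : ConifoldRep P Q) (FP : Set P) (FQ : Set Q) (Θ : ℝ × ℝ) : Prop :=
  (∀ W : Sub c, W ≠ ⊥ → W.slope Θ < 0) ∧
  (∀ W : Sub c, FP ⊆ W.fst → FQ ⊆ W.snd → W ≠ ⊤ → W.slope Θ < c.totalSlope Θ)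

theorem IsFramedStable.swap {c : ConifoldRep P Q} {FP : Set P} {FQ : Set Q} {Θ : ℝ × ℝ}
    (h : c.IsFramedStable FP FQ Θ) : c.swap.IsFramedStable FQ FP Θ.swap := by
  have e : ∀ W : Sub c.swap, W.slope Θ.swap = W.unswap.slope Θ := fun W =>
    W.unswap.slope_swap Θ
  constructor
  · intro W hW
    rw [e]
    refine h.1 _ fun h0 => hW ?_
    ext1
    · exact congrArg Sub.snd h0
    · exact congrArg Sub.fst h0
  · intro W h1 h2 hW
    rw [e]
    refine (h.2 _ h2 h1 fun h0 => hW ?_).trans_eq (add_comm _ _)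
    ext1
    · exact congrArg Sub.snd h0
    · exact congrArg Sub.fst h0

theorem Sub.ext_dim {c : ConifoldRep P Q} [FiniteDimensional ℂ P] [FiniteDimensional ℂ Q]
    {W : Sub c} (h1 : finrank ℂ W.fst = 0) (h2 : finrank ℂ W.snd = 0) : W = ⊥ := by
  ext1
  · exact Submodule.finrank_eq_zero.1 h1
  · exact Submodule.finrank_eq_zero.1 h2

variable (c : ConifoldRep P Q)

/-- `p ↦ (x₀ p, x₁ p)`. -/
def xProd : P →ₗ[ℂ] Q × Q := (c.x 0).prod (c.x 1)

/-- `(q₀, q₁) ↦ x₁ y_i q₀ - x₀ y_i q₁`. -/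
def reflectY (i : Fin 2) : Q × Q →ₗ[ℂ] Q :=
  (c.x 1 ∘ₗ c.y i).coprod (-(c.x 0 ∘ₗ c.y i))

/-- The reflection at the first vertex: `P` is replaced by the cokernel of `P → Q²`, and the
vertices are exchanged. -/
def reflect : ConifoldRep Q ((Q × Q) ⧸ LinearMap.range c.xProd) where
  x i := if i = 0 then Submodule.mkQ _ ∘ₗ LinearMap.inr ℂ Q Q
    else -(Submodule.mkQ _ ∘ₗ LinearMap.inl ℂ Q Q)
  y i := (LinearMap.range c.xProd).liftQ (c.reflectY i) (by
    rintro _ ⟨p, rfl⟩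
    simp [xProd, reflectY, c.xyx])
  z := c.w
  w := (LinearMap.range c.xProd).mapQ _ (c.w.prodMap c.w) (by
    rintro _ ⟨p, rfl⟩
    exact ⟨c.z p, by simp [xProd, c.wx]⟩)
  xyx i q := by
    simp only [if_true, one_ne_zero, if_false, LinearMap.comp_apply, LinearMap.neg_apply, map_neg,
      Submodule.mkQ_apply, Submodule.liftQ_apply]
    rw [neg_eq_iff_eq_neg, neg_neg, ← sub_eq_zero, ← Submodule.Quotient.mk_sub,
      Submodule.Quotient.mk_eq_zero]
    exact ⟨-c.y i q, by simp [xProd, reflectY]⟩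
  yxy i q := by
    obtain ⟨⟨q₀, q₁⟩, rfl⟩ := Submodule.Quotient.mk_surjective _ q
    fin_cases i <;>
      simp [reflectY, c.yxy_comm 0 _ 1]
  wx i p := by
    fin_cases i
    · simp
    · simp
  zy i q := by
    obtain ⟨⟨q₀, q₁⟩, rfl⟩ := Submodule.Quotient.mk_surjective _ q
    simp [reflectY, c.wx, c.zy]

theorem reflect_x₀ (q : Q) : c.reflect.x 0 q = Submodule.Quotient.mk (0, q) := rfl

theorem reflect_x₁ (q : Q) : c.reflect.x 1 q = -Submodule.Quotient.mk (q, 0) := rfl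

theorem reflect_y (i : Fin 2) (q : Q × Q) :
    c.reflect.y i (Submodule.Quotient.mk q) = c.x 1 (c.y i q.1) - c.x 0 (c.y i q.2) := by
  simp [reflect, reflectY, sub_eq_add_neg]

theorem mk_eq_reflect (q : Q × Q) :
    (Submodule.Quotient.mk q : (Q × Q) ⧸ LinearMap.range c.xProd) =
      c.reflect.x 0 q.2 - c.reflect.x 1 q.1 := by
  rw [reflect_x₀, reflect_x₁, sub_neg_eq_add, ← Submodule.Quotient.mk_add]
  simp

/-- The closed paths at the retained vertex agree up to sign, so `c` can be read off from its
reflection. -/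
theorem reflect_yx (i l : Fin 2) (q : Q) :
    c.x i (c.y l q) = -c.reflect.y l (c.reflect.x i q) := by
  fin_cases i
  · change c.x 0 (c.y l q) = -c.reflect.y l (c.reflect.x 0 q)
    rw [reflect_x₀, reflect_y]
    simp
  · change c.x 1 (c.y l q) = -c.reflect.y l (c.reflect.x 1 q)
    rw [reflect_x₁, map_neg, reflect_y]
    simp

variable {c}

/-- The common kernel of the `x i` is a subrepresentation supported at the first vertex; its slope
is nonnegative when `θ₀ ≥ 0`. -/
theorem IsFramedStable.xProd_injective [FiniteDimensional ℂ P] [FiniteDimensional ℂ Q]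
    {FP : Set P} {FQ : Set Q} {Θ : ℝ × ℝ}
    (h : c.IsFramedStable FP FQ Θ) (h1 : 0 ≤ Θ.1) : Function.Injective c.xProd := by
  let W : Sub c :=
    { fst := LinearMap.ker c.xProd
      snd := ⊥
      x_mem := by
        intro i p hp
        have hp : (c.x 0 p, c.x 1 p) = 0 := hp
        rw [Prod.mk_eq_zero] at hp
        fin_cases i
        · exact hp.1
        · exact hp.2
      y_mem := by
        intro i q hq
        rw [Submodule.mem_bot] at hq
        simp [hq]
      z_mem := by
        intro p hp
        have hp : (c.x 0 p, c.x 1 p) = 0 := hp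
        rw [Prod.mk_eq_zero] at hp
        change (c.x 0 (c.z p), c.x 1 (c.z p)) = 0
        simp [← c.wx, hp.1, hp.2]
      w_mem := by simp }
  have hW : W = ⊥ := by
    by_contra hne
    have := h.1 W hne
    rw [Sub.slope] at this
    have h2 : finrank ℂ W.snd = 0 := finrank_bot ℂ Q
    rw [h2] at this
    have h3 : (0 : ℝ) ≤ finrank ℂ W.fst := Nat.cast_nonneg _
    simp only [Nat.cast_zero, mul_zero, add_zero] at this
    nlinarith
  exact LinearMap.ker_eq_bot.1 (congrArg Sub.fst hW)

/-- The subrepresentation of `c` defined by a subrepresentation of the reflection. -/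
@[simps] def Sub.ofReflect (W : Sub c.reflect) : Sub c where
  fst := (W.fst.prod W.fst).comap c.xProd
  snd := W.fst
  x_mem := by
    rintro i p ⟨h0, h1⟩
    fin_cases i
    · exact h0
    · exact h1
  y_mem := by
    intro i q hq
    have : ∀ l, c.x l (c.y i q) ∈ W.fst := fun l => by
      rw [reflect_yx]
      exact W.fst.neg_mem (W.y_mem _ _ (W.x_mem _ _ hq))
    exact ⟨this 0, this 1⟩
  z_mem := by
    rintro p ⟨h0, h1⟩
    have : ∀ l, c.x l p ∈ W.fst → c.x l (c.z p) ∈ W.fst := fun l hl => by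
      rw [← c.wx]
      exact W.z_mem _ hl
    exact ⟨this 0 h0, this 1 h1⟩
  w_mem := W.z_mem

theorem Sub.mk_mem_of_mem (W : Sub c.reflect) {q : Q × Q} (hq : q ∈ W.fst.prod W.fst) :
    (Submodule.Quotient.mk q : (Q × Q) ⧸ LinearMap.range c.xProd) ∈ W.snd := by
  rw [mk_eq_reflect]
  exact W.snd.sub_mem (W.x_mem 0 _ hq.2) (W.x_mem 1 _ hq.1)

theorem finrank_prod_self [FiniteDimensional ℂ Q] (U : Submodule ℂ Q) :
    finrank ℂ (U.prod U) = 2 * finrank ℂ U := by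
  let e : (U.prod U) ≃ₗ[ℂ] U × U :=
    { toFun := fun q => (⟨q.1.1, q.2.1⟩, ⟨q.1.2, q.2.2⟩)
      invFun := fun q => ⟨(q.1.1, q.2.1), q.1.2, q.2.2⟩
      map_add' := fun _ _ => rfl
      map_smul' := fun _ _ => rfl
      left_inv := fun _ => rfl
      right_inv := fun _ => rfl }
  rw [e.finrank_eq, finrank_prod, two_mul]

/-! ### Stability of the reflection. -/

section Stability

variable [FiniteDimensional ℂ P] [FiniteDimensional ℂ Q] {FP : Set P} {FQ : Set Q} {Θ : ℝ × ℝ}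

/-- The map from two copies of `W.fst` to `W.snd` has as kernel the part of the image of `P` lying
in them. -/
theorem Sub.two_mul_finrank_le_ofReflect (W : Sub c.reflect) :
    2 * finrank ℂ W.fst ≤ finrank ℂ W.snd + finrank ℂ W.ofReflect.fst := by
  have h := finrank_map_add_inf_ker (LinearMap.range c.xProd).mkQ (W.fst.prod W.fst)
  rw [finrank_prod_self, Submodule.ker_mkQ] at h
  have h1 : finrank ℂ ((W.fst.prod W.fst).map (LinearMap.range c.xProd).mkQ) ≤
      finrank ℂ W.snd := by
    apply Submodule.finrank_mono
    rintro _ ⟨q, hq, rfl⟩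
    exact W.mk_mem_of_mem hq
  have h2 : finrank ℂ ↥(W.fst.prod W.fst ⊓ LinearMap.range c.xProd) ≤
      finrank ℂ W.ofReflect.fst := by
    rw [inf_comm, ← Submodule.map_comap_eq]
    exact Submodule.finrank_map_le _ _
  omega

theorem totalSlope_reflect (h : Function.Injective c.xProd) :
    c.reflect.totalSlope (Θ.2 + 2 * Θ.1, -Θ.1) = c.totalSlope Θ := by
  have h1 := Submodule.finrank_quotient_add_finrank (LinearMap.range c.xProd)
  rw [LinearMap.finrank_range_of_inj h, finrank_prod] at h1
  have h2 : (finrank ℂ ((Q × Q) ⧸ LinearMap.range c.xProd) : ℝ) + finrank ℂ P =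
    finrank ℂ Q + finrank ℂ Q := by exact_mod_cast h1
  simp only [totalSlope]
  linear_combination -Θ.1 * h2

theorem Sub.slope_le_slope_ofReflect (h1 : 0 ≤ Θ.1) (W : Sub c.reflect) :
    W.slope (Θ.2 + 2 * Θ.1, -Θ.1) ≤ W.ofReflect.slope Θ := by
  have h := W.two_mul_finrank_le_ofReflect
  have h2 : (2 : ℝ) * finrank ℂ W.fst ≤ finrank ℂ W.snd + finrank ℂ W.ofReflect.fst := by
    exact_mod_cast h
  have h3 := mul_le_mul_of_nonneg_left h2 h1
  have h4 : finrank ℂ W.ofReflect.snd = finrank ℂ W.fst := rfl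
  simp only [Sub.slope, h4]
  linarith

/-- Destabilizing subrepresentations of the reflection give destabilizing ones of `c` with at least
the same slope. A subrepresentation giving zero is supported at the new vertex and has negative
slope because `θ₀ > 0`. The condition `hF` on the new framing `F` ensures that the pulled back
subrepresentation contains the old framing. -/
theorem IsFramedStable.reflect (h : c.IsFramedStable FP FQ Θ) (h1 : 0 < Θ.1) (F : Set Q)
    (hF : ∀ U : Submodule ℂ Q, F ⊆ U → (∀ p ∈ FP, ∀ i, c.x i p ∈ U) ∧ FQ ⊆ U) :
    c.reflect.IsFramedStable F ∅ (Θ.2 + 2 * Θ.1, -Θ.1) := by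
  constructor
  · intro W hW
    by_cases h0 : W.ofReflect = ⊥
    · have hfst : W.fst = ⊥ := congrArg Sub.snd h0
      have hsnd : finrank ℂ W.snd ≠ 0 := by
        intro h2
        exact hW (Sub.ext_dim (by rw [hfst, finrank_bot]) h2)
      have : (0 : ℝ) < finrank ℂ W.snd := by exact_mod_cast Nat.pos_of_ne_zero hsnd
      have hf : finrank ℂ W.fst = 0 := by rw [hfst, finrank_bot]
      simp only [Sub.slope, hf, Nat.cast_zero, mul_zero, zero_add]
      nlinarith
    · exact (W.slope_le_slope_ofReflect h1.le).trans_lt (h.1 _ h0)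
  · intro W hFW _ hW
    rw [totalSlope_reflect (h.xProd_injective h1.le)]
    refine (W.slope_le_slope_ofReflect h1.le).trans_lt (h.2 _ ?_ (hF _ hFW).2 fun h0 => hW ?_)
    · exact fun p hp => ⟨(hF _ hFW).1 p hp 0, (hF _ hFW).1 p hp 1⟩
    · have hfst : W.fst = ⊤ := congrArg Sub.snd h0
      ext1
      · exact hfst
      · refine eq_top_iff.2 fun q _ => ?_
        obtain ⟨q, rfl⟩ := Submodule.Quotient.mk_surjective _ q
        exact W.mk_mem_of_mem (by simp [hfst])

end Stability

/-- The space `P` is recovered as the kernel of `Q² → Q² / P`, on which the isomorphism `f` acts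
diagonally. -/
theorem exists_equiv_of_reflect {c' : ConifoldRep P' Q'} (hc : Function.Injective c.xProd)
    (hc' : Function.Injective c'.xProd) (f : Q ≃ₗ[ℂ] Q')
    (h : ((Q × Q) ⧸ LinearMap.range c.xProd) ≃ₗ[ℂ] ((Q' × Q') ⧸ LinearMap.range c'.xProd))
    (hom : IsHom c.reflect c'.reflect f.toLinearMap h.toLinearMap) :
    ∃ e : P ≃ₗ[ℂ] P', IsHom c c' e.toLinearMap f.toLinearMap := by
  have hx : ∀ i q, h (c.reflect.x i q) = c'.reflect.x i (f q) := hom.x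
  have hmk : ∀ q : Q × Q, h (Submodule.Quotient.mk q) = Submodule.Quotient.mk (f q.1, f q.2) := by
    intro q
    rw [mk_eq_reflect, map_sub, hx, hx, mk_eq_reflect]
  obtain ⟨e, he⟩ := exists_equiv_of_range c.xProd c'.xProd hc hc' (f.prodCongr f) (by
    intro q
    rw [← Submodule.Quotient.mk_eq_zero, ← h.map_eq_zero_iff, hmk, Submodule.Quotient.mk_eq_zero]
    rfl)
  have ex : ∀ i p, f (c.x i p) = c'.x i (e p) := by
    intro i p
    have := he p
    fin_cases i
    · exact (congrArg Prod.fst this).symm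
    · exact (congrArg Prod.snd this).symm
  have ext : ∀ p p' : P', (∀ i, c'.x i p = c'.x i p') → p = p' := fun p p' hp =>
    hc' (Prod.ext (hp 0) (hp 1))
  refine ⟨e, ex, fun i q => ext _ _ fun l => ?_, fun p => ext _ _ fun l => ?_, hom.z⟩
  · change c'.x l (e _) = c'.x l (c'.y i (f q))
    rw [← ex, reflect_yx, reflect_yx, map_neg, ← hx]
    exact congrArg _ (hom.y _ _)
  · change c'.x l (e _) = c'.x l (c'.z (e p))
    rw [← ex, ← c.wx, ← c'.wx, ← ex]
    exact hom.z _

/-- The torus action on the reflection. -/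
def reflectTorus {ρ : ℂ} {τ : Fin 2 → ℂ} {ζ : ℂ} {g : P →ₗ[ℂ] P} {h : Q →ₗ[ℂ] Q}
    (e : c.IsEquivariant ρ τ ζ g h) :
    ((Q × Q) ⧸ LinearMap.range c.xProd) →ₗ[ℂ] (Q × Q) ⧸ LinearMap.range c.xProd :=
  (LinearMap.range c.xProd).mapQ _ (h.prodMap (ρ • h)) (by
    rintro _ ⟨p, rfl⟩
    exact ⟨ρ • g p, by simp [xProd, e.x0, e.x1]⟩)

theorem IsEquivariant.reflect {ρ : ℂ} {τ : Fin 2 → ℂ} {ζ : ℂ} {g : P →ₗ[ℂ] P} {h : Q →ₗ[ℂ] Q}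
    (e : c.IsEquivariant ρ τ ζ g h) : c.reflect.IsEquivariant ρ τ ζ h (reflectTorus e) where
  x0 q := by
    rw [reflect_x₀, reflect_x₀, ← Submodule.Quotient.mk_smul]
    simp [reflectTorus]
  x1 q := by
    rw [reflect_x₁, reflect_x₁, map_neg]
    simp [reflectTorus]
  y i q := by
    obtain ⟨q, rfl⟩ := Submodule.Quotient.mk_surjective _ q
    rw [reflect_y, map_sub, e.x1, e.x0, e.y, e.y]
    have : reflectTorus e (Submodule.Quotient.mk q) = Submodule.Quotient.mk (h q.1, ρ • h q.2) := rfl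
    rw [this, reflect_y]
    simp only [map_smul, smul_sub]
    rw [smul_comm ρ]
  z := e.w
  w q := by
    obtain ⟨q, rfl⟩ := Submodule.Quotient.mk_surjective _ q
    have : ∀ q, reflectTorus e (Submodule.Quotient.mk q) =
      Submodule.Quotient.mk (h q.1, ρ • h q.2) := fun _ => rfl
    have hw : ∀ q : Q × Q, c.reflect.w (Submodule.Quotient.mk q) =
      Submodule.Quotient.mk (c.w q.1, c.w q.2) := fun _ => rfl
    rw [hw, this, this, hw, ← Submodule.Quotient.mk_smul]
    simp [e.w, smul_comm ρ]

end ConifoldRep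

namespace FramedObj

open ConifoldRep

variable {ρ : ℂ} {τ : Fin 2 → ℂ} {ζ : ℂ} {k : ℕ}

/-- The reflection of a framed representation. -/
@[simps P Q c n] def reflect (X : FramedObj ρ τ ζ k) : FramedObj ρ τ ζ (k + 1) where
  P := X.Q
  Q := (X.Q × X.Q) ⧸ LinearMap.range X.c.xProd
  c := X.c.reflect
  -- The list `x₁ n₀, x₀ n₀, …, x₀ n_k` contains every `x i n_j`, since `x₁ n_{j+1} = x₀ n_j`; hence
  -- the framing grows by one vector.
  n j := if j = 0 then X.c.x 1 (X.n 0) else X.c.x 0 (X.n (j - 1))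
  framing j hj := by
    have h1 : (if j = 0 then X.c.x 1 (X.n 0) else X.c.x 0 (X.n (j - 1))) = X.c.x 1 (X.n j) := by
      rcases j with _ | j
      · rfl
      · exact X.framing j (by omega)
    beta_reduce
    rw [h1, if_neg (Nat.succ_ne_zero j), reflect_x₀, reflect_x₁, ← sub_eq_zero, sub_neg_eq_add,
      ← Submodule.Quotient.mk_add, Submodule.Quotient.mk_eq_zero]
    exact ⟨X.n j, by simp [xProd]⟩
  g := X.h
  h := reflectTorus X.equivariant
  equivariant := X.equivariant.reflect
  ν := X.ν
  ν_ne := X.ν_ne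
  weight j hj := by
    rcases j with _ | j
    · simp [X.equivariant.x1, X.weight 0]
    · simp only [Nat.succ_ne_zero, if_false, Nat.add_sub_cancel]
      rw [X.equivariant.x0, X.weight j (by omega), map_smul, smul_smul]
      congr 1
      ring

theorem iso_of_reflect {X Y : FramedObj ρ τ ζ k} (hX : Function.Injective X.c.xProd)
    (hY : Function.Injective Y.c.xProd) (h : X.reflect.Iso Y.reflect) : X.Iso Y := by
  obtain ⟨f, g, hom, hn⟩ := h
  obtain ⟨e, he⟩ := exists_equiv_of_reflect hX hY f g hom
  have hnj : ∀ j ≤ k, ∀ i, f (X.c.x i (X.n j)) = Y.c.x i (Y.n j) := by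
    have h0 : ∀ j ≤ k, f (X.c.x 0 (X.n j)) = Y.c.x 0 (Y.n j) := fun j hj =>
      hn (j + 1) (by omega)
    intro j hj i
    fin_cases i
    · exact h0 j hj
    · rcases j with _ | j
      · exact hn 0 (by omega)
      · change f (X.c.x 1 _) = Y.c.x 1 _
        rw [← X.framing j hj, ← Y.framing j hj]
        exact h0 j (by omega)
  refine ⟨e, f, he, fun j hj => hY ?_⟩
  refine Prod.ext ((he.x 0 _).symm.trans (hnj j hj 0)) ((he.x 1 _).symm.trans (hnj j hj 1))

/-- The framing vectors. -/
def frame (X : FramedObj ρ τ ζ k) : Set X.P := {p | ∃ j ≤ k, p = X.n j}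

/-- With both parameters negative, a proper subrepresentation has slope at least that of the whole,
so none can contain the framing. -/
theorem isGenerated_of_isFramedStable {X : FramedObj ρ τ ζ k} {Θ : ℝ × ℝ}
    (h : X.c.IsFramedStable X.frame ∅ Θ) (h1 : Θ.1 < 0) (h2 : Θ.2 < 0) :
    X.c.IsGenerated k X.n := by
  intro W hW
  by_contra hne
  have := h.2 W (by rintro _ ⟨j, hj, rfl⟩; exact hW j hj) (Set.empty_subset _) hne
  have d1 : (finrank ℂ W.fst : ℝ) ≤ finrank ℂ X.P := by exact_mod_cast Submodule.finrank_le _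
  have d2 : (finrank ℂ W.snd : ℝ) ≤ finrank ℂ X.Q := by exact_mod_cast Submodule.finrank_le _
  simp only [Sub.slope, totalSlope] at this
  nlinarith

theorem reflect_frame_spec (X : FramedObj ρ τ ζ k) (U : Submodule ℂ X.Q)
    (hU : X.reflect.frame ⊆ (U : Set X.Q)) : ∀ p ∈ X.frame, ∀ i, X.c.x i p ∈ U := by
  rintro _ ⟨j, hj, rfl⟩ i
  have h0 : ∀ j ≤ k, X.c.x 0 (X.n j) ∈ U := fun j hj => hU ⟨j + 1, by omega, rfl⟩
  fin_cases i
  · exact h0 j hj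
  · rcases j with _ | j
    · exact hU ⟨0, by omega, rfl⟩
    · change X.c.x 1 _ ∈ U
      rw [← X.framing j hj]
      exact h0 j (by omega)

/-- A reflection preserves `θ₀ + θ₁` and adds it to the first parameter, so at most `N` reflections
lead to the cyclic chamber. Nonvanishing `hne` excludes stopping on a wall. -/
theorem finiteClasses_of_isFramedStable (hw : GenericWeights ρ τ ζ) (N : ℕ) (k : ℕ) (Θ : ℝ × ℝ)
    (h2 : Θ.2 < 0) (hN : Θ.1 + N * (Θ.1 + Θ.2) < 0)
    (hne : ∀ j : ℕ, Θ.1 + j * (Θ.1 + Θ.2) ≠ 0) (D : ℕ) :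
    FiniteClasses {X : FramedObj ρ τ ζ k | X.c.IsFramedStable X.frame ∅ Θ ∧
      finrank ℂ X.P ≤ D ∧ finrank ℂ X.Q ≤ D} := by
  have base : ∀ (k : ℕ) (Θ : ℝ × ℝ) (D : ℕ), Θ.1 < 0 → Θ.2 < 0 →
      FiniteClasses {X : FramedObj ρ τ ζ k | X.c.IsFramedStable X.frame ∅ Θ ∧
        finrank ℂ X.P ≤ D ∧ finrank ℂ X.Q ≤ D} := fun k Θ D h1 h2 =>
    (finiteClasses_of_isGenerated hw D).mono fun X hX =>
      ⟨isGenerated_of_isFramedStable hX.1 h1 h2, hX.2.1⟩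
  induction N generalizing k Θ D with
  | zero => exact base k Θ D (by simpa using hN) h2
  | succ N ih =>
    rcases lt_trichotomy Θ.1 0 with h1 | h1 | h1
    · exact base k Θ D h1 h2
    · exact absurd h1 (by simpa using hne 0)
    · obtain ⟨ι, hι, F, hF⟩ := ih (k + 1) (Θ.2 + 2 * Θ.1, -Θ.1) (by simpa using h1)
        (by push_cast at hN; simp only; linarith)
        -- The bound doubles because the new vertex space is a quotient of `Q²`.
        (fun j e => hne (j + 1) (by push_cast; simp only at e; linarith)) (D + D)
      refine ⟨ι, hι, fun X => F X.reflect, fun X hX Y hY e => ?_⟩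
      have key : ∀ Z : FramedObj ρ τ ζ k, Z.c.IsFramedStable Z.frame ∅ Θ ∧
          finrank ℂ Z.P ≤ D ∧ finrank ℂ Z.Q ≤ D →
          Z.reflect.c.IsFramedStable Z.reflect.frame ∅ (Θ.2 + 2 * Θ.1, -Θ.1) ∧
          finrank ℂ Z.reflect.P ≤ D + D ∧ finrank ℂ Z.reflect.Q ≤ D + D := by
        intro Z hZ
        refine ⟨hZ.1.reflect h1 _ fun U hU => ⟨Z.reflect_frame_spec U hU, Set.empty_subset _⟩,
          ?_, ?_⟩
        · exact hZ.2.2.trans (Nat.le_add_left _ _)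
        · refine (Submodule.finrank_quotient_le _).trans ?_
          rw [finrank_prod]
          exact add_le_add hZ.2.2 hZ.2.2
      exact iso_of_reflect (hX.1.xProd_injective h1.le) (hY.1.xProd_injective h1.le)
        (hF _ (key X hX) _ (key Y hY) e)

end FramedObj

end

/-! ### Tilting -/

section

/-! ### Nilpotent operators and their common kernels. -/

section Nilpotent

variable {V : Type} [AddCommGroup V] [Module ℂ V]

/-- A nonzero eigenvalue `μ` of `T` would, through the powers of `g`, produce the infinitely many
eigenvalues `l⁻ⁿ μ`. -/
theorem isNilpotent_of_intertwine [FiniteDimensional ℂ V] (g T : V →ₗ[ℂ] V)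
    (hg : Function.Injective g) {l : ℂ} (hl : ∀ m n : ℕ, l ^ m = l ^ n → m = n) (hl0 : l ≠ 0)
    (h : ∀ v, g (T v) = l • T (g v)) : IsNilpotent T := by
  have hev : ∀ μ : ℂ, Module.End.HasEigenvalue T μ → μ = 0 := by
    intro μ hμ
    by_contra h0
    obtain ⟨v, hv⟩ := hμ.exists_hasEigenvector
    have hn : ∀ n : ℕ, T ((g ^ n) v) = ((l ^ n)⁻¹ * μ) • (g ^ n) v ∧ (g ^ n) v ≠ 0 := by
      intro n
      induction n with
      | zero => exact ⟨by simpa using hv.apply_eq_smul, hv.2⟩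
      | succ n ih =>
        rw [pow_succ', Module.End.mul_apply]
        refine ⟨?_, fun e => ih.2 (hg (by rw [e, map_zero]))⟩
        have := h ((g ^ n) v)
        rw [ih.1, map_smul] at this
        rw [← (inv_smul_eq_iff₀ hl0).2 this, smul_smul, pow_succ, mul_inv]
        congr 1
        ring
    have hli := Module.End.eigenvectors_linearIndependent' T (fun n : ℕ => (l ^ n)⁻¹ * μ)
      (fun m n e => hl m n (inv_injective (mul_right_cancel₀ h0 e))) (fun n => (g ^ n) v)
      (fun n => ⟨by rw [Module.End.mem_eigenspace_iff]; exact (hn n).1, (hn n).2⟩)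
    exact Set.infinite_univ.not_finite (Set.finite_univ_iff.2 hli.finite)
  have htop := Module.End.iSup_maxGenEigenspace_eq_top T
  have h0 : Module.End.maxGenEigenspace T 0 = ⊤ := by
    rw [eq_top_iff, ← htop]
    refine iSup_le fun μ => ?_
    by_cases hμ : Module.End.HasEigenvalue T μ
    · rw [hev μ hμ]
    · have : Module.End.maxGenEigenspace T μ = ⊥ := by
        by_contra hne
        have hu : Module.End.HasUnifEigenvalue T μ ⊤ := hne
        exact hμ (hu.lt zero_lt_one)
      rw [this]
      exact bot_le
  rw [Module.End.maxGenEigenspace_eq_genEigenspace_finrank] at h0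
  refine ⟨finrank ℂ V, LinearMap.ext fun v => ?_⟩
  have : v ∈ Module.End.genEigenspace T 0 (finrank ℂ V) := by rw [h0]; trivial
  rw [Module.End.mem_genEigenspace_nat] at this
  simpa using this

/-- The kernel of one operator meets `U` nontrivially, and by commutativity the intersection is
stable under the remaining ones. -/
theorem exists_ne_zero_of_nilpotent (l : List (V →ₗ[ℂ] V)) (U : Submodule ℂ V) (hU : U ≠ ⊥)
    (hnil : ∀ T ∈ l, IsNilpotent T) (hcomm : ∀ S ∈ l, ∀ T ∈ l, Commute S T)
    (hinv : ∀ T ∈ l, ∀ u ∈ U, T u ∈ U) : ∃ u ∈ U, u ≠ 0 ∧ ∀ T ∈ l, T u = 0 := by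
  classical
  induction l generalizing U with
  | nil =>
    obtain ⟨u, hu, h0⟩ := Submodule.exists_mem_ne_zero_of_ne_bot hU
    exact ⟨u, hu, h0, by simp⟩
  | cons S l ih =>
    have hne : U ⊓ LinearMap.ker S ≠ ⊥ := by
      obtain ⟨u, hu, h0⟩ := Submodule.exists_mem_ne_zero_of_ne_bot hU
      have hex : ∃ L, (S ^ L) u = 0 := by
        obtain ⟨L, hL⟩ := hnil S (by simp)
        exact ⟨L, by simp [hL]⟩
      have hmem : ∀ L : ℕ, (S ^ L) u ∈ U := by
        intro L
        induction L with
        | zero => exact hu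
        | succ L ih' =>
          rw [pow_succ', Module.End.mul_apply]
          exact hinv S (by simp) _ ih'
      have hpos : Nat.find hex ≠ 0 := by
        intro e
        have := Nat.find_spec hex
        rw [e] at this
        exact h0 this
      obtain ⟨L, hL⟩ := Nat.exists_eq_succ_of_ne_zero hpos
      have h1 := Nat.find_spec hex
      rw [hL, pow_succ', Module.End.mul_apply] at h1
      have h2 : (S ^ L) u ≠ 0 := Nat.find_min hex (by omega)
      intro e
      exact h2 ((Submodule.eq_bot_iff _).1 e _ ⟨hmem L, h1⟩)
    obtain ⟨u, hu, h0, h1⟩ := ih (U ⊓ LinearMap.ker S) hne (fun T hT => hnil T (by simp [hT]))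
      (fun T hT T' hT' => hcomm T (by simp [hT]) T' (by simp [hT']))
      (fun T hT u hu => ⟨hinv T (by simp [hT]) u hu.1, by
        have := LinearMap.congr_fun (hcomm S (by simp) T (by simp [hT])) u
        change S (T u) = T (S u) at this
        change S (T u) = 0
        rw [this, show S u = 0 from hu.2, map_zero]⟩)
    refine ⟨u, hu.1, h0, ?_⟩
    intro T hT
    rcases List.mem_cons.1 hT with rfl | hT
    · exact hu.2
    · exact h1 T hT

theorem isNilpotent_compLeft {T : V →ₗ[ℂ] V} (h : IsNilpotent T) (ι : Type) :
    IsNilpotent (T.compLeft ι) := by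
  obtain ⟨L, hL⟩ := h
  refine ⟨L, ?_⟩
  have : ∀ L : ℕ, ∀ f i, ((T.compLeft ι) ^ L) f i = (T ^ L) (f i) := by
    intro L
    induction L with
    | zero => intros; rfl
    | succ L ih =>
      intro f i
      rw [pow_succ', pow_succ', Module.End.mul_apply, Module.End.mul_apply, ← ih]
      rfl
  ext1 f
  funext i
  rw [this, hL]
  rfl

end Nilpotent

namespace ConifoldRep

variable {P Q P' Q' : Type} [AddCommGroup P] [Module ℂ P] [AddCommGroup Q] [Module ℂ Q]
  [AddCommGroup P'] [Module ℂ P'] [AddCommGroup Q'] [Module ℂ Q']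

/-- The sequences whose first `k` members are `y₀ g_j - y₁ g_{j+1}`. -/
def tiltSub (c : ConifoldRep P Q) (k : ℕ) : Submodule ℂ (ℕ → P) where
  carrier := {f | ∃ g : ℕ → Q, ∀ j < k, f j = c.y 0 (g j) - c.y 1 (g (j + 1))}
  zero_mem' := ⟨0, by simp⟩
  add_mem' := by
    rintro f f' ⟨g, hg⟩ ⟨g', hg'⟩
    refine ⟨g + g', fun j hj => ?_⟩
    simp only [Pi.add_apply, map_add, hg j hj, hg' j hj]
    abel
  smul_mem' := by
    rintro a f ⟨g, hg⟩
    exact ⟨a • g, fun j hj => by simp [hg j hj, smul_sub]⟩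

variable (c : ConifoldRep P Q)

theorem shift_mem_tiltSub (i : Fin 2) (m : ℕ) :
    c.tiltSub (m + 1) ≤ (c.tiltSub m).comap (LinearMap.funLeft ℂ P fun j => j + (i : ℕ)) := by
  rintro f ⟨g, hg⟩
  refine ⟨fun j => g (j + i), fun j hj => ?_⟩
  rw [LinearMap.funLeft_apply, hg _ (by omega), add_right_comm]

theorem yx_mem_tiltSub (i : Fin 2) (m : ℕ) :
    c.tiltSub m ≤ (c.tiltSub (m + 1)).comap ((c.y 1 ∘ₗ c.x i).compLeft ℕ) := by
  rintro f ⟨g, hg⟩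
  -- Up to index `m` the witness is `x i y₁ g_j`, by the relation exchanging `y₀` and `y₁`. The
  -- extra index `m + 1` has no `g` to use, and its value is forced by the equation in position `m`.
  refine ⟨fun j => if j ≤ m then c.x i (c.y 1 (g j)) else c.x i (c.y 0 (g m)) - c.x i (f m),
    fun j hj => ?_⟩
  change c.y 1 (c.x i (f j)) = _
  beta_reduce
  rw [if_pos (by omega), c.yxy_comm 0]
  split_ifs with h
  · rw [hg j (by omega)]
    simp
  · obtain rfl : j = m := by omega
    simp

theorem loop_mem_tiltSub (k : ℕ) :
    c.tiltSub k ≤ (c.tiltSub k).comap (c.z.compLeft ℕ) := by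
  rintro f ⟨g, hg⟩
  exact ⟨fun j => c.w (g j), fun j hj => by simp [hg j hj, c.zy]⟩

/-- A tilt of the representation: the vertex spaces are the cokernels of `Q^{m+2} → P^{m+1}` and
`Q^{m+1} → P^m`. -/
def tilt (m : ℕ) : ConifoldRep ((ℕ → P) ⧸ c.tiltSub (m + 1)) ((ℕ → P) ⧸ c.tiltSub m) where
  x i := Submodule.mapQ _ _ _ (c.shift_mem_tiltSub i m)
  y i := Submodule.mapQ _ _ _ (c.yx_mem_tiltSub i m)
  z := Submodule.mapQ _ _ _ (c.loop_mem_tiltSub _)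
  w := Submodule.mapQ _ _ _ (c.loop_mem_tiltSub _)
  xyx i f := by
    obtain ⟨f, rfl⟩ := Submodule.Quotient.mk_surjective _ f
    rfl
  yxy i f := by
    obtain ⟨f, rfl⟩ := Submodule.Quotient.mk_surjective _ f
    refine congrArg Submodule.Quotient.mk (funext fun j => ?_)
    exact congrArg (c.y 1) (c.xyx_comm 1 1 0 _)
  wx i f := by
    obtain ⟨f, rfl⟩ := Submodule.Quotient.mk_surjective _ f
    rfl
  zy i f := by
    obtain ⟨f, rfl⟩ := Submodule.Quotient.mk_surjective _ f
    refine congrArg Submodule.Quotient.mk (funext fun j => ?_)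
    change c.z (c.y 1 (c.x i _)) = c.y 1 (c.x i (c.z _))
    rw [c.zy, c.wx]

theorem exists_extend_surjective (k : ℕ) :
    ∃ E : (Fin k → P) →ₗ[ℂ] (ℕ → P) ⧸ c.tiltSub k, Function.Surjective E := by
  let E : (Fin k → P) →ₗ[ℂ] (ℕ → P) :=
    { toFun := fun f j => if h : j < k then f ⟨j, h⟩ else 0
      map_add' := fun f f' => by
        funext j
        by_cases h : j < k <;> simp [h]
      map_smul' := fun a f => by
        funext j
        by_cases h : j < k <;> simp [h] }
  refine ⟨(c.tiltSub k).mkQ ∘ₗ E, fun f => ?_⟩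
  obtain ⟨f, rfl⟩ := Submodule.Quotient.mk_surjective _ f
  refine ⟨fun j => f j, ?_⟩
  rw [LinearMap.comp_apply, Submodule.mkQ_apply, Submodule.Quotient.eq]
  exact ⟨0, fun j hj => by simp [E, hj]⟩

instance [FiniteDimensional ℂ P] (k : ℕ) : FiniteDimensional ℂ ((ℕ → P) ⧸ c.tiltSub k) := by
  obtain ⟨E, hE⟩ := c.exists_extend_surjective k
  exact Module.Finite.of_surjective E hE

theorem finrank_tilt_le [FiniteDimensional ℂ P] (k : ℕ) :
    finrank ℂ ((ℕ → P) ⧸ c.tiltSub k) ≤ k * finrank ℂ P := by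
  obtain ⟨E, hE⟩ := c.exists_extend_surjective k
  have := LinearMap.finrank_le_finrank_of_surjective hE
  rwa [finrank_pi_fintype, Finset.sum_const, Finset.card_univ, Fintype.card_fin, smul_eq_mul] at this

/-- The class of the sequence with the only member `p` in position `j`. -/
def slot (m j : ℕ) : P →ₗ[ℂ] (ℕ → P) ⧸ c.tiltSub (m + 1) :=
  (c.tiltSub (m + 1)).mkQ ∘ₗ LinearMap.single ℂ (fun _ => P) j

variable {c} {m : ℕ}

theorem slot_eq_zero {j : ℕ} (hj : m < j) (p : P) : c.slot m j p = 0 := by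
  change Submodule.Quotient.mk _ = _
  rw [Submodule.Quotient.mk_eq_zero]
  refine ⟨0, fun i hi => ?_⟩
  rw [LinearMap.single_apply, Pi.single_eq_of_ne (by omega)]
  simp

theorem tilt_x_mk (i : Fin 2) (f : ℕ → P) :
    (c.tilt m).x i (Submodule.Quotient.mk f) = Submodule.Quotient.mk fun j => f (j + i) := rfl

theorem tilt_y_mk (i : Fin 2) (f : ℕ → P) :
    (c.tilt m).y i (Submodule.Quotient.mk f) = Submodule.Quotient.mk fun j => c.y 1 (c.x i (f j)) :=
  rfl

theorem tilt_z_mk (f : ℕ → P) :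
    (c.tilt m).z (Submodule.Quotient.mk f) = Submodule.Quotient.mk fun j => c.z (f j) := rfl

theorem slot_eq (j : ℕ) (p : P) : c.slot m j p = Submodule.Quotient.mk (Pi.single j p) := rfl

theorem slot_framing (j : ℕ) (p : P) :
    (c.tilt m).x 0 (c.slot m j p) = (c.tilt m).x 1 (c.slot m (j + 1) p) := by
  rw [slot_eq, slot_eq, tilt_x_mk, tilt_x_mk]
  congr 1
  funext i
  by_cases h : i = j
  · subst h
    simp
  · simp [h]

theorem slot_z (j : ℕ) (p : P) : (c.tilt m).z (c.slot m j p) = c.slot m j (c.z p) := by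
  rw [slot_eq, slot_eq, tilt_z_mk]
  congr 1
  funext i
  by_cases h : i = j
  · subst h
    simp
  · simp [h]

theorem slot_yx (i : Fin 2) (j : ℕ) (p : P) :
    (c.tilt m).y i ((c.tilt m).x 0 (c.slot m j p)) = c.slot m j (c.y 1 (c.x i p)) := by
  rw [slot_eq, slot_eq, tilt_x_mk, tilt_y_mk]
  congr 1
  funext i
  by_cases h : i = j
  · subst h
    simp
  · simp [h]

theorem slot_zero_y (q : Q) : c.slot m 0 (c.y 0 q) = 0 := by
  rw [slot_eq, Submodule.Quotient.mk_eq_zero]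
  refine ⟨Pi.single 0 q, fun j hj => ?_⟩
  rcases j with _ | j
  · simp
  · simp

theorem slot_succ_y (j : ℕ) (q : Q) : c.slot m (j + 1) (c.y 0 q) = c.slot m j (c.y 1 q) := by
  rw [slot_eq, slot_eq, Submodule.Quotient.eq]
  refine ⟨Pi.single (j + 1) q, fun i hi => ?_⟩
  simp only [Pi.sub_apply, Pi.single_apply, Nat.add_right_cancel_iff]
  split_ifs <;> simp

end ConifoldRep

end

/-! ### Stability and tilting -/

section

theorem exists_ne_zero_of_nilpotent_family {V : Type} [AddCommGroup V] [Module ℂ V] {ι : Type}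
    [Fintype ι] (T : ι → V →ₗ[ℂ] V) (U : Submodule ℂ V) (hU : U ≠ ⊥)
    (hnil : ∀ i, IsNilpotent (T i)) (hcomm : ∀ i j v, T i (T j v) = T j (T i v))
    (hinv : ∀ i, ∀ u ∈ U, T i u ∈ U) : ∃ u ∈ U, u ≠ 0 ∧ ∀ i, T i u = 0 := by
  obtain ⟨u, hu, h0, h1⟩ := exists_ne_zero_of_nilpotent (Finset.univ.toList.map T) U hU
    (by simpa using hnil) (by
      simp only [List.mem_map, Finset.mem_toList, Finset.mem_univ, true_and]
      rintro _ ⟨i, rfl⟩ _ ⟨j, rfl⟩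
      exact LinearMap.ext fun v => hcomm i j v) (by simpa using hinv)
  exact ⟨u, hu, h0, by simpa using h1⟩

theorem isNilpotent_dualMap {V : Type} [AddCommGroup V] [Module ℂ V] {T : V →ₗ[ℂ] V}
    (h : IsNilpotent T) : IsNilpotent (LinearMap.dualMap T : Module.Dual ℂ V →ₗ[ℂ] Module.Dual ℂ V) := by
  obtain ⟨L, hL⟩ := h
  refine ⟨L, ?_⟩
  have : ∀ L : ℕ, ∀ f v, (((LinearMap.dualMap T : Module.Dual ℂ V →ₗ[ℂ] Module.Dual ℂ V) ^ L) f) v =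
      f ((T ^ L) v) := by
    intro L
    induction L with
    | zero => intros; rfl
    | succ L ih =>
      intro f v
      rw [pow_succ', pow_succ, Module.End.mul_apply, Module.End.mul_apply, ← ih]
      rfl
  ext f v
  rw [this, hL]
  simp

namespace ConifoldRep

variable {P Q P' Q' : Type} [AddCommGroup P] [Module ℂ P] [AddCommGroup Q] [Module ℂ Q]
  [AddCommGroup P'] [Module ℂ P'] [AddCommGroup Q'] [Module ℂ Q']

/-- All closed paths act nilpotently. -/
structure IsNil (c : ConifoldRep P Q) : Prop where
  yx : ∀ i l, IsNilpotent (c.y l ∘ₗ c.x i)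
  xy : ∀ i l, IsNilpotent (c.x i ∘ₗ c.y l)
  z : IsNilpotent c.z
  w : IsNilpotent c.w

variable {c : ConifoldRep P Q} {m : ℕ}

theorem mk_eq_sum_slot (f : ℕ → P) : (Submodule.Quotient.mk f : (ℕ → P) ⧸ c.tiltSub (m + 1)) =
    ∑ j ∈ Finset.range (m + 1), c.slot m j (f j) := by
  have : ∑ j ∈ Finset.range (m + 1), c.slot m j (f j) =
      (c.tiltSub (m + 1)).mkQ (∑ j ∈ Finset.range (m + 1), Pi.single j (f j)) := by
    rw [map_sum]
    rfl
  rw [this, Submodule.mkQ_apply, Submodule.Quotient.eq]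
  refine ⟨0, fun i hi => ?_⟩
  simp [Finset.sum_apply, Pi.single_apply, hi]

theorem slot_ext {V : Type} [AddCommGroup V] [Module ℂ V]
    {F G : ((ℕ → P) ⧸ c.tiltSub (m + 1)) →ₗ[ℂ] V}
    (h : ∀ j ≤ m, ∀ p, F (c.slot m j p) = G (c.slot m j p)) : F = G := by
  ext1
  refine LinearMap.ext fun f => ?_
  change F (Submodule.Quotient.mk f) = G (Submodule.Quotient.mk f)
  rw [mk_eq_sum_slot, map_sum, map_sum]
  exact Finset.sum_congr rfl fun j hj => h j (by simpa [Nat.lt_succ_iff] using hj) _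

theorem isNilpotent_of_slot {T : P →ₗ[ℂ] P} (hT : IsNilpotent T)
    {T' : ((ℕ → P) ⧸ c.tiltSub (m + 1)) →ₗ[ℂ] ((ℕ → P) ⧸ c.tiltSub (m + 1))}
    (h : ∀ j p, T' (c.slot m j p) = c.slot m j (T p)) : IsNilpotent T' := by
  obtain ⟨L, hL⟩ := hT
  refine ⟨L, ?_⟩
  have : ∀ L : ℕ, ∀ j p, (T' ^ L) (c.slot m j p) = c.slot m j ((T ^ L) p) := by
    intro L
    induction L with
    | zero => intros; rfl
    | succ L ih =>
      intro j p
      rw [pow_succ', pow_succ', Module.End.mul_apply, Module.End.mul_apply, ih, h]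
  refine slot_ext fun j _ p => ?_
  rw [this, hL]
  simp

/-- A proper subrepresentation of the tilt gives a functional `φ` vanishing on it and on the images
of the commuting nilpotent closed paths. Its values on the slots form a nonzero morphism from `c` to
the Kronecker module of dimension `(m + 1, m)`. The image has negative slope by the choice of `m`,
so the kernel `K` destabilizes. -/
theorem exists_sub_of_not_isGenerated_tilt [FiniteDimensional ℂ P] [FiniteDimensional ℂ Q]
    {Θ : ℝ × ℝ} (hnil : c.IsNil) (h1 : Θ.1 < 0) (hd : 0 < Θ.1 + Θ.2)
    (hm : Θ.1 + m * (Θ.1 + Θ.2) < 0) (v : P)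
    (h : ¬ (c.tilt m).IsGenerated m fun j => c.slot m j v) :
    ∃ K : Sub c, v ∈ K.fst ∧ (∀ q, c.y 1 q ∈ K.fst → q ∈ K.snd) ∧ K ≠ ⊤ ∧
      c.totalSlope Θ < K.slope Θ := by
  simp only [IsGenerated, not_forall] at h
  obtain ⟨W, hv, hne⟩ := h
  have hfst : W.fst ≠ ⊤ := by
    intro e
    apply hne
    ext1
    · exact e
    · refine eq_top_iff.2 fun f _ => ?_
      obtain ⟨f, rfl⟩ := Submodule.Quotient.mk_surjective _ f
      exact W.x_mem 0 (Submodule.Quotient.mk f) (by simp [e])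
  -- The loop and the two closed paths `y i x₀`; on slots they are the operators `z` and `y₁ x i` of
  -- `c`, which are nilpotent.
  let T : Option (Fin 2) → Module.End ℂ ((ℕ → P) ⧸ c.tiltSub (m + 1)) := fun o =>
    o.elim (c.tilt m).z fun i => (c.tilt m).y i ∘ₗ (c.tilt m).x 0
  have hTnil : ∀ o, IsNilpotent (T o) := by
    rintro (_ | i)
    · exact isNilpotent_of_slot hnil.z slot_z
    · exact isNilpotent_of_slot (hnil.yx i 1) fun j p => slot_yx i j p
  have hTcomm : ∀ o o' f, T o (T o' f) = T o' (T o f) := by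
    rintro (_ | i) (_ | i') f
    · rfl
    · exact ((c.tilt m).zy i' _).trans (congrArg _ ((c.tilt m).wx 0 f))
    · exact (((c.tilt m).zy i _).trans (congrArg _ ((c.tilt m).wx 0 f))).symm
    · exact (c.tilt m).yxy_comm i 0 i' _
  have hTinv : ∀ o, ∀ f ∈ W.fst, T o f ∈ W.fst := by
    rintro (_ | i) f hf
    · exact W.z_mem f hf
    · exact W.y_mem i _ (W.x_mem 0 f hf)
  obtain ⟨φ, hφ, hφ0, hφT⟩ := exists_ne_zero_of_nilpotent_family
    (fun o => (LinearMap.dualMap (T o) : Module.Dual ℂ _ →ₗ[ℂ] Module.Dual ℂ _))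
    W.fst.dualAnnihilator (by
      obtain ⟨f, hf, hle⟩ := Submodule.exists_le_ker_of_lt_top W.fst (lt_top_iff_ne_top.2 hfst)
      intro e
      apply hf
      rw [← Submodule.mem_bot ℂ, ← e, Submodule.mem_dualAnnihilator]
      exact fun w hw => hle hw)
    (fun o => isNilpotent_dualMap (hTnil o))
    (fun o o' φ => LinearMap.ext fun f => congrArg φ (hTcomm o' o f))
    (fun o φ hφ => by
      rw [Submodule.mem_dualAnnihilator] at hφ ⊢
      exact fun w hw => hφ _ (hTinv o w hw))
  have hφT : ∀ o f, φ (T o f) = 0 := fun o f => LinearMap.congr_fun (hφT o) f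
  rw [Submodule.mem_dualAnnihilator] at hφ
  let A : ℕ → P →ₗ[ℂ] ℂ := fun j => φ ∘ₗ c.slot m j
  have hAz : ∀ j p, A j (c.z p) = 0 := fun j p => by
    change φ (c.slot m j (c.z p)) = 0
    rw [← slot_z]
    exact hφT none _
  have hAx : ∀ j i p, A j (c.y 1 (c.x i p)) = 0 := fun j i p => by
    change φ (c.slot m j _) = 0
    rw [← slot_yx]
    exact hφT (some i) (c.slot m j p)
  have hA0 : ∀ q, A 0 (c.y 0 q) = 0 := fun q => by
    change φ (c.slot m 0 _) = 0
    rw [slot_zero_y, map_zero]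
  have hAs : ∀ j q, A (j + 1) (c.y 0 q) = A j (c.y 1 q) := fun j q => by
    change φ (c.slot m _ _) = φ (c.slot m _ _)
    rw [slot_succ_y]
  have hAm : ∀ j, m < j → ∀ p, A j p = 0 := fun j hj p => by
    change φ (c.slot m _ _) = 0
    rw [slot_eq_zero hj, map_zero]
  let Φ : P →ₗ[ℂ] (Fin (m + 1) → ℂ) := LinearMap.pi fun j => A j
  let Ψ : Q →ₗ[ℂ] (Fin m → ℂ) := LinearMap.pi fun j => A j ∘ₗ c.y 1
  have hΦ : ∀ p, p ∈ LinearMap.ker Φ ↔ ∀ j, A j p = 0 := by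
    intro p
    rw [LinearMap.mem_ker, funext_iff]
    refine ⟨fun h j => ?_, fun h j => h j⟩
    rcases Nat.lt_or_ge m j with hj | hj
    · exact hAm j hj p
    · exact h ⟨j, Nat.lt_succ_of_le hj⟩
  have hΨ : ∀ q, q ∈ LinearMap.ker Ψ ↔ ∀ j, A j (c.y 1 q) = 0 := by
    intro p
    rw [LinearMap.mem_ker, funext_iff]
    refine ⟨fun h j => ?_, fun h j => h j⟩
    rcases Nat.lt_or_ge j m with hj | hj
    · exact h ⟨j, hj⟩
    · rw [← hAs]
      exact hAm _ (by omega) _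
  have hAy0 : ∀ q, (∀ j, A j (c.y 1 q) = 0) → ∀ j, A j (c.y 0 q) = 0 := by
    intro q hq j
    rcases j with _ | j
    · exact hA0 q
    · rw [hAs, hq]
  let K : Sub c :=
    { fst := LinearMap.ker Φ
      snd := LinearMap.ker Ψ
      x_mem := fun i p _ => (hΨ _).2 fun j => hAx j i p
      y_mem := fun i q hq => by
        rw [hΨ] at hq
        rw [hΦ]
        fin_cases i
        · exact hAy0 q hq
        · exact hq
      z_mem := fun p _ => (hΦ _).2 fun j => hAz j p
      w_mem := fun q _ => (hΨ _).2 fun j => by rw [← c.zy]; exact hAz j _ }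
  -- The relations between the `A j` say that `(Φ, Ψ)` is a morphism to the polynomial Kronecker
  -- module, so its image has first dimension strictly larger than the second.
  have hrange : ∀ i, ∀ u ∈ LinearMap.range Ψ, upMat (m + 1) m i *ᵥ u ∈ LinearMap.range Φ := by
    rintro i _ ⟨q, rfl⟩
    fin_cases i
    · refine ⟨c.y 1 q, ?_⟩
      change _ = upMat (m + 1) m 0 *ᵥ _
      rw [upMat_zero_mulVec]
      funext j
      refine Fin.lastCases ?_ (fun j => ?_) j
      · rw [Fin.snoc_last]
        change A m (c.y 1 q) = 0
        rw [← hAs]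
        exact hAm _ (by omega) _
      · rw [Fin.snoc_castSucc]
        rfl
    · refine ⟨c.y 0 q, ?_⟩
      change _ = upMat (m + 1) m 1 *ᵥ _
      rw [upMat_one_mulVec]
      funext j
      refine Fin.cases ?_ (fun j => ?_) j
      · exact hA0 q
      · exact hAs j q
  have hΦ0 : LinearMap.range Φ ≠ ⊥ := by
    intro e
    apply hφ0
    refine slot_ext fun j _ p => ?_
    have : p ∈ LinearMap.ker Φ := by rw [LinearMap.range_eq_bot.1 e]; simp
    exact (hΦ p).1 this j
  have hlt : finrank ℂ (LinearMap.range Ψ) + 1 ≤ finrank ℂ (LinearMap.range Φ) := by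
    by_cases h0 : LinearMap.range Ψ = ⊥
    · have := Submodule.one_le_finrank_iff.2 hΦ0
      rw [h0, finrank_bot]
      omega
    · exact finrank_lt_of_upMat_mem hrange h0
  have hle : finrank ℂ (LinearMap.range Ψ) ≤ m := by
    simpa using Submodule.finrank_le (LinearMap.range Ψ)
  have r1 : (finrank ℂ (LinearMap.range Φ) : ℝ) + finrank ℂ (LinearMap.ker Φ) = finrank ℂ P := by
    exact_mod_cast LinearMap.finrank_range_add_finrank_ker Φ
  have r2 : (finrank ℂ (LinearMap.range Ψ) : ℝ) + finrank ℂ (LinearMap.ker Ψ) = finrank ℂ Q := by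
    exact_mod_cast LinearMap.finrank_range_add_finrank_ker Ψ
  have hlt' : (finrank ℂ (LinearMap.range Ψ) : ℝ) + 1 ≤ finrank ℂ (LinearMap.range Φ) := by
    exact_mod_cast hlt
  have hle' : (finrank ℂ (LinearMap.range Ψ) : ℝ) ≤ m := by exact_mod_cast hle
  have hslope : c.totalSlope Θ < K.slope Θ := by
    simp only [totalSlope, Sub.slope]
    rw [← r1, ← r2]
    change _ < Θ.1 * (finrank ℂ (LinearMap.ker Φ) : ℝ) + Θ.2 * (finrank ℂ (LinearMap.ker Ψ) : ℝ)
    have e1 := mul_le_mul_of_nonpos_left hlt' h1.le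
    have e2 := mul_le_mul_of_nonneg_left hle' hd.le
    nlinarith
  refine ⟨K, (hΦ v).2 fun j => ?_, fun q hq => (hΨ q).2 ((hΦ _).1 hq), ?_, hslope⟩
  · rcases Nat.lt_or_ge m j with hj | hj
    · exact hAm j hj v
    · exact hφ _ (hv j hj)
  · intro e
    rw [e, Sub.slope_top] at hslope
    exact lt_irrefl _ hslope

/-- The map `Q^{m+1} → P^m` is injective. -/
def IsTiltInjective (c : ConifoldRep P Q) (m : ℕ) : Prop :=
  ∀ g : ℕ → Q, (∀ j < m, c.y 0 (g j) = c.y 1 (g (j + 1))) → ∀ j ≤ m, g j = 0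

/-- A nonzero kernel contains a tuple killed by all closed paths. Its members `g_j` and the vectors
`h_j = y₁ g_j`, `h_{j+1} = y₀ g_j` span a quotient of the Kronecker module of dimension `(m + 2, m +
1)`. Such a quotient has positive slope by the choice of `m`, contrary to stability. -/
theorem isTiltInjective [FiniteDimensional ℂ P] [FiniteDimensional ℂ Q] {Θ : ℝ × ℝ}
    (hst : ∀ W : Sub c, W ≠ ⊥ → W.slope Θ < 0) (hnil : c.IsNil) (h1 : Θ.1 < 0)
    (hd : 0 < Θ.1 + Θ.2) (hm : 0 < Θ.1 + (m + 1) * (Θ.1 + Θ.2)) : c.IsTiltInjective m := by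
  by_contra hc
  simp only [IsTiltInjective, not_forall] at hc
  obtain ⟨g₀, hg₀, j₀, hj₀, hne₀⟩ := hc
  let U : Submodule ℂ (ℕ → Q) :=
    { carrier := {g | (∀ j < m, c.y 0 (g j) = c.y 1 (g (j + 1))) ∧ ∀ j, m < j → g j = 0}
      zero_mem' := ⟨by simp, by simp⟩
      add_mem' := by
        rintro f g ⟨hf, hf'⟩ ⟨hg, hg'⟩
        exact ⟨fun j hj => by simp [hf j hj, hg j hj], fun j hj => by simp [hf' j hj, hg' j hj]⟩
      smul_mem' := by
        rintro a g ⟨hg, hg'⟩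
        exact ⟨fun j hj => by simp [hg j hj], fun j hj => by simp [hg' j hj]⟩ }
  have hU : U ≠ ⊥ := by
    intro e
    have hmem : (fun j => if j ≤ m then g₀ j else 0) ∈ U := by
      refine ⟨fun j hj => ?_, fun j hj => ?_⟩
      · simp only
        rw [if_pos (by omega), if_pos (by omega), hg₀ j hj]
      · simp only
        rw [if_neg (by omega)]
    rw [e, Submodule.mem_bot] at hmem
    have := congrFun hmem j₀
    rw [if_pos hj₀] at this
    exact hne₀ this
  let B : Option (Fin 2 × Fin 2) → Module.End ℂ Q := fun o =>
    o.elim c.w fun i => c.x i.1 ∘ₗ c.y i.2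
  have hBcomm : ∀ o o' q, B o (B o' q) = B o' (B o q) := by
    rintro (_ | i) (_ | i') q
    · rfl
    · exact (c.wx _ _).trans (congrArg _ (c.zy _ _))
    · exact ((c.wx _ _).trans (congrArg _ (c.zy _ _))).symm
    · exact (c.xyx_comm _ _ _ _).trans (congrArg _ (c.yxy_comm _ _ _ _))
  obtain ⟨g, hgU, hg0, hgB⟩ := exists_ne_zero_of_nilpotent_family
    (fun o => (B o).compLeft ℕ) U hU
    (by
      rintro (_ | i)
      · exact isNilpotent_compLeft hnil.w ℕ
      · exact isNilpotent_compLeft (hnil.xy _ _) ℕ)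
    (fun o o' f => funext fun j => hBcomm o o' _)
    (by
      rintro o f ⟨hf, hf'⟩
      refine ⟨fun j hj => ?_, fun j hj => ?_⟩
      · change c.y 0 (B o (f j)) = c.y 1 (B o (f (j + 1)))
        rcases o with _ | ⟨i, l⟩
        · change c.y 0 (c.w _) = c.y 1 (c.w _)
          rw [← c.zy, hf j hj, c.zy]
        · change c.y 0 (c.x i (c.y l _)) = c.y 1 (c.x i (c.y l _))
          rw [c.yxy_comm 0, c.yxy_comm 1, hf j hj]
      · change B o (f j) = 0
        rw [hf' j hj, map_zero])
  have hgw : ∀ j, c.w (g j) = 0 := fun j => congrFun (hgB none) j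
  have hgx : ∀ i l j, c.x i (c.y l (g j)) = 0 := fun i l j => congrFun (hgB (some (i, l))) j
  -- The last vector `h_{m+1} = y₀ g_m` has to be prescribed separately, as there is no `g_{m+1}`.
  let h : ℕ → P := fun j => if j ≤ m then c.y 1 (g j) else c.y 0 (g m)
  have hy1 : ∀ j ≤ m, c.y 1 (g j) = h j := fun j hj => (if_pos hj).symm
  have hy0 : ∀ j ≤ m, c.y 0 (g j) = h (j + 1) := by
    intro j hj
    rcases hj.lt_or_eq with hj' | rfl
    · rw [hgU.1 j hj', hy1 _ hj']
    · simp [h]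
  let G : (Fin (m + 1) → ℂ) →ₗ[ℂ] Q := Fintype.linearCombination ℂ fun j : Fin (m + 1) => g j
  let H : (Fin (m + 1 + 1) → ℂ) →ₗ[ℂ] P :=
    Fintype.linearCombination ℂ fun j : Fin (m + 1 + 1) => h j
  have hG : ∀ a, G a = ∑ j, a j • g j := fun a => rfl
  have hH : ∀ a, H a = ∑ j, a j • h j := fun a => rfl
  have hyG : ∀ i a, H (upMat (m + 1 + 1) (m + 1) i *ᵥ a) = c.y (if i = 0 then 1 else 0) (G a) := by
    intro i a
    fin_cases i
    · change H (upMat _ _ 0 *ᵥ a) = c.y 1 _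
      rw [upMat_zero_mulVec, hH, hG, Fin.sum_univ_castSucc, Fin.snoc_last, zero_smul, add_zero,
        map_sum]
      refine Finset.sum_congr rfl fun j _ => ?_
      rw [Fin.snoc_castSucc, map_smul, hy1 j (Nat.lt_succ_iff.1 j.2)]
      rfl
    · change H (upMat _ _ 1 *ᵥ a) = c.y 0 _
      rw [upMat_one_mulVec, hH, hG, Fin.sum_univ_succ, Fin.cons_zero, zero_smul, zero_add,
        map_sum]
      refine Finset.sum_congr rfl fun j _ => ?_
      rw [Fin.cons_succ, map_smul, hy0 j (Nat.lt_succ_iff.1 j.2)]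
      rfl
  have hxh : ∀ i j, c.x i (h j) = 0 := by
    intro i j
    simp only [h]
    split_ifs <;> exact hgx _ _ _
  have hzh : ∀ j, c.z (h j) = 0 := by
    intro j
    simp only [h]
    split_ifs <;> rw [c.zy, hgw, map_zero]
  let K : Sub c :=
    { fst := LinearMap.range H
      snd := LinearMap.range G
      x_mem := by
        rintro i _ ⟨a, rfl⟩
        rw [hH, map_sum]
        simp [hxh]
      y_mem := by
        rintro i _ ⟨a, rfl⟩
        fin_cases i
        · exact ⟨_, hyG 1 a⟩
        · exact ⟨_, hyG 0 a⟩
      z_mem := by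
        rintro _ ⟨a, rfl⟩
        rw [hH, map_sum]
        simp [hzh]
      w_mem := by
        rintro _ ⟨a, rfl⟩
        rw [hG, map_sum]
        simp [hgw] }
  have hrange : LinearMap.range G ≠ ⊥ := by
    intro e
    apply hg0
    funext j
    rcases Nat.lt_or_ge m j with hj | hj
    · exact hgU.2 j hj
    · have : g j ∈ LinearMap.range G := ⟨Pi.single ⟨j, Nat.lt_succ_of_le hj⟩ 1, by
        simp [G]⟩
      rw [e] at this
      simpa using this
  have hK := hst K fun e => hrange (congrArg Sub.snd e)
  have h1G := Submodule.one_le_finrank_iff.2 hrange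
  have r1 := LinearMap.finrank_range_add_finrank_ker G
  have r2 := LinearMap.finrank_range_add_finrank_ker H
  rw [finrank_pi, Fintype.card_fin] at r1 r2
  have hK : Θ.1 * (finrank ℂ (LinearMap.range H) : ℝ) + Θ.2 * (finrank ℂ (LinearMap.range G) : ℝ)
    < 0 := hK
  have hup : LinearMap.ker G ≠ ⊥ → finrank ℂ (LinearMap.ker G) < finrank ℂ (LinearMap.ker H) :=
    finrank_lt_of_upMat_mem fun i a ha => by
      rw [LinearMap.mem_ker, hyG, show G a = 0 from ha, map_zero]
  -- If `G` is injective the span has second dimension `m + 1` and first at most `m + 2`. Otherwise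
  -- the kernels grow from `G` to `H`, so the first dimension is at most the second.
  by_cases h0 : LinearMap.ker G = ⊥
  · rw [h0, finrank_bot] at r1
    have e1 : (finrank ℂ (LinearMap.range G) : ℝ) = m + 1 := by exact_mod_cast r1
    have e2 : (finrank ℂ (LinearMap.range H) : ℝ) ≤ m + 2 := by
      exact_mod_cast (by omega : finrank ℂ (LinearMap.range H) ≤ m + 2)
    rw [e1] at hK
    have := mul_le_mul_of_nonpos_left e2 h1.le
    nlinarith
  · have := hup h0
    have e2 : (finrank ℂ (LinearMap.range H) : ℝ) ≤ finrank ℂ (LinearMap.range G) := by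
      exact_mod_cast (by omega : finrank ℂ (LinearMap.range H) ≤ finrank ℂ (LinearMap.range G))
    have e3 : (1 : ℝ) ≤ finrank ℂ (LinearMap.range G) := by exact_mod_cast h1G
    have := mul_le_mul_of_nonpos_left e2 h1.le
    nlinarith

end ConifoldRep

end

/-! ### Recovering a representation from its tilt -/

section

/-- Puts `a` in front of a sequence. -/
def consSeq {P : Type} (a : P) (f : ℕ → P) : ℕ → P
  | 0 => a
  | j + 1 => f j

namespace ConifoldRep

variable {P Q P' Q' : Type} [AddCommGroup P] [Module ℂ P] [AddCommGroup Q] [Module ℂ Q]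
  [AddCommGroup P'] [Module ℂ P'] [AddCommGroup Q'] [Module ℂ Q']

variable {c : ConifoldRep P Q} {m : ℕ}

theorem IsTiltInjective.y_eq_zero (h : c.IsTiltInjective m) {q : Q} (h0 : c.y 0 q = 0)
    (h1 : c.y 1 q = 0) : q = 0 :=
  h (fun _ => q) (fun _ _ => h0.trans h1.symm) 0 (Nat.zero_le _)

/-- Injectivity is applied to the tuple with `q` in the last position only, where no condition on
`y₀ q` enters. -/
theorem IsTiltInjective.eq_zero_of_y_one (h : c.IsTiltInjective m) {q : Q} (h1 : c.y 1 q = 0) :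
    q = 0 := by
  have := h (fun j => if j = m then q else 0) (fun j hj => by
    rw [if_neg (by omega), map_zero]
    split_ifs
    · exact h1.symm
    · simp) m le_rfl
  simpa using this

/-- Each slot equation has a witness tuple in `Q`. The equations are translates of each other, so
injectivity makes the witnesses constant along diagonals. The zero entries beside the first and last
positions leave a single `q`, read off as `p = y₀ q` and `p' = y₁ q` at the two ends. -/
theorem exists_y_eq_of_slot (h : c.IsTiltInjective m) (p p' : P) (h0 : c.slot m 0 p = 0)
    (hs : ∀ j ≤ m, c.slot m (j + 1) p = c.slot m j p') :
    ∃ q, c.y 0 q = p ∧ c.y 1 q = p' := by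
  let s : ℕ → ℕ → P := fun j => consSeq (Pi.single 0 p)
    (fun j => Pi.single (j + 1) p - Pi.single j p') j
  have hs' : ∀ j i, s (j + 1) (i + 1) = s j i := by
    intro j i
    rcases j with _ | j
    · rcases i with _ | i <;> simp [s, consSeq]
    · simp [s, consSeq, Pi.single_apply]
  have hmem : ∀ j ≤ m + 1, ∃ g : ℕ → Q, ∀ i < m + 1, s j i = c.y 0 (g i) - c.y 1 (g (i + 1)) := by
    intro j hj
    rcases j with _ | j
    · have := (Submodule.Quotient.mk_eq_zero _).1 h0
      exact this
    · have := (Submodule.Quotient.eq _).1 (hs j (by omega))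
      exact this
  choose! g hg using hmem
  -- The difference of one witness and the translate of the next satisfies the homogeneous
  -- equations.
  have hstep : ∀ j ≤ m, ∀ i ≤ m, g j i = g (j + 1) (i + 1) := by
    intro j hj i hi
    have := h (fun i => g j i - g (j + 1) (i + 1)) (fun i hi => by
      have e1 := hg j (by omega) i (by omega)
      have e2 := hg (j + 1) (by omega) (i + 1) (by omega)
      rw [hs', e1] at e2
      rw [map_sub, map_sub, sub_eq_sub_iff_sub_eq_sub]
      exact e2) i hi
    exact sub_eq_zero.1 this
  have hdiag : ∀ j ≤ m + 1, g j j = g 0 0 := by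
    intro j
    induction j with
    | zero => exact fun _ => rfl
    | succ j ih => exact fun hj => (hstep j (by omega) j (by omega)).symm.trans (ih (by omega))
  have hfirst : g 0 1 = 0 := by
    refine h (fun i => g 0 (i + 1)) (fun i hi => ?_) 0 (Nat.zero_le _)
    have := hg 0 (by omega) (i + 1) (by omega)
    rw [show s 0 (i + 1) = 0 by simp [s, consSeq]] at this
    exact (sub_eq_zero.1 this.symm)
  have hlast : g (m + 1) m = 0 := by
    refine h (g (m + 1)) (fun i hi => ?_) m le_rfl
    have := hg (m + 1) le_rfl i (by omega)
    rw [show s (m + 1) i = 0 by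
      simp [s, consSeq, show i ≠ m + 1 by omega, show i ≠ m by omega]] at this
    exact (sub_eq_zero.1 this.symm)
  refine ⟨g 0 0, ?_, ?_⟩
  · have := hg 0 (by omega) 0 (by omega)
    rw [hfirst, map_zero, sub_zero] at this
    rw [← this]
    simp [s, consSeq]
  · have := hg (m + 1) le_rfl m (by omega)
    rw [hlast, map_zero, zero_sub, hdiag (m + 1) le_rfl] at this
    rw [← neg_inj, ← this]
    simp [s, consSeq]

theorem slot_injective (h : c.IsTiltInjective m) {p p' : P}
    (hp : ∀ j ≤ m, c.slot m j p = c.slot m j p') : p = p' := by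
  have hp : ∀ j, c.slot m j (p - p') = 0 := by
    intro j
    rcases Nat.lt_or_ge m j with hj | hj
    · exact slot_eq_zero hj _
    · rw [map_sub, hp j hj, sub_self]
  obtain ⟨q, hq0, hq1⟩ := exists_y_eq_of_slot h (p - p') 0 (hp 0) fun j _ => by
    rw [hp, map_zero]
  rw [h.eq_zero_of_y_one hq1, map_zero] at hq0
  exact sub_eq_zero.1 hq0.symm

theorem exists_mk_consSeq (f T : ℕ → P)
    (h : (c.tilt m).x 1 (Submodule.Quotient.mk f) = Submodule.Quotient.mk T) :
    ∃ r, (Submodule.Quotient.mk f : (ℕ → P) ⧸ c.tiltSub (m + 1)) =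
      Submodule.Quotient.mk (consSeq r T) := by
  rw [tilt_x_mk, Submodule.Quotient.eq] at h
  obtain ⟨g, hg⟩ := h
  refine ⟨f 0 + c.y 1 (g 0), ?_⟩
  rw [Submodule.Quotient.eq]
  refine ⟨consSeq 0 g, fun j hj => ?_⟩
  rcases j with _ | j
  · simp [consSeq]
  · exact hg j (by omega)

/-- The compatibility of neighbours allows lifts `T j` each of which is the previous one with one
entry put in front. Vanishing beyond `m` makes the first `m` entries of `T m` a boundary with
witness `G`; removing it leaves one entry, `p = T 0 0 - y₀ (G m)`, in position `j` of each `T j`. -/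
theorem exists_slot_eq (w : ℕ → (ℕ → P) ⧸ c.tiltSub (m + 1)) (h0 : (c.tilt m).x 1 (w 0) = 0)
    (hs : ∀ j, (c.tilt m).x 0 (w j) = (c.tilt m).x 1 (w (j + 1))) (hm : ∀ j, m < j → w j = 0) :
    ∃ p, ∀ j, w j = c.slot m j p := by
  have hstep : ∀ j T, ∃ r, w j = Submodule.Quotient.mk T →
      w (j + 1) = Submodule.Quotient.mk (consSeq r T) := by
    intro j T
    by_cases hT : w j = Submodule.Quotient.mk T
    · obtain ⟨f, hf⟩ := Submodule.Quotient.mk_surjective _ (w (j + 1))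
      obtain ⟨r, hr⟩ := exists_mk_consSeq (c := c) (m := m) f T (by
        rw [hf, ← hs, hT]
        rfl)
      exact ⟨r, fun _ => by rw [← hf, hr]⟩
    · exact ⟨0, fun h => absurd h hT⟩
  choose r hr using hstep
  obtain ⟨r₀, hr₀⟩ : ∃ r₀, w 0 = Submodule.Quotient.mk (consSeq r₀ 0) := by
    obtain ⟨f, hf⟩ := Submodule.Quotient.mk_surjective _ (w 0)
    obtain ⟨r₀, h⟩ := exists_mk_consSeq (c := c) (m := m) f 0 (by rw [hf, h0]; rfl)
    exact ⟨r₀, by rw [← hf, h]⟩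
  let T : ℕ → ℕ → P := fun j => Nat.rec (consSeq r₀ 0) (fun j T => consSeq (r j T) T) j
  have hT : ∀ j, w j = Submodule.Quotient.mk (T j) := by
    intro j
    induction j with
    | zero => exact hr₀
    | succ j ih => exact hr j _ ih
  have hT0 : ∀ j i, T (j + i) i = T j 0 := by
    intro j i
    induction i with
    | zero => rfl
    | succ i ih => exact ih
  have hT1 : ∀ j i, T j (j + (i + 1)) = 0 := by
    intro j i
    induction j with
    | zero =>
      rw [zero_add]
      rfl
    | succ j ih =>
      rw [Nat.add_right_comm]
      exact ih
  obtain ⟨G, hG⟩ : ∃ G : ℕ → Q, ∀ i < m, T m i = c.y 0 (G i) - c.y 1 (G (i + 1)) := by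
    have := hs m
    rw [hm (m + 1) (by omega), map_zero, hT m] at this
    exact (Submodule.Quotient.mk_eq_zero _).1 this
  refine ⟨T 0 0 - c.y 0 (G m), fun j => ?_⟩
  rcases Nat.lt_or_ge m j with hj | hj
  · rw [hm j hj, slot_eq_zero hj]
  rw [hT, slot_eq, Submodule.Quotient.eq]
  -- The entry `T j i` equals the entry of `T m` in position `m - j + i`, which accounts for the
  -- translation of `G`.
  refine ⟨fun i => if i ≤ j then G (m - j + i) else 0, fun i _ => ?_⟩
  simp only [Pi.sub_apply]
  rcases lt_trichotomy i j with h | rfl | h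
  · rw [if_pos h.le, if_pos (by omega), Pi.single_eq_of_ne (by omega), sub_zero]
    have e1 := hT0 (j - i) i
    have e2 := hT0 (j - i) (m - j + i)
    rw [show j - i + i = j by omega] at e1
    rw [show j - i + (m - j + i) = m by omega] at e2
    rw [e1, ← e2, hG _ (by omega)]
    rfl
  · rw [if_pos le_rfl, if_neg (by omega), Pi.single_eq_same, Nat.sub_add_cancel hj, map_zero]
    have := hT0 0 i
    rw [zero_add] at this
    rw [this]
    abel
  · rw [if_neg (by omega), if_neg (by omega), Pi.single_eq_of_ne (by omega)]
    obtain ⟨a, rfl⟩ := Nat.exists_eq_add_of_lt h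
    rw [add_assoc, hT1]
    simp

/-- All slots. -/
def slots (c : ConifoldRep P Q) (m : ℕ) : P →ₗ[ℂ] (ℕ → (ℕ → P) ⧸ c.tiltSub (m + 1)) :=
  LinearMap.pi fun j => c.slot m j

/-- This describes `P` inside the tilt by conditions involving only the arrows of the tilt, which an
isomorphism preserves. -/
theorem mem_range_slots (w : ℕ → (ℕ → P) ⧸ c.tiltSub (m + 1)) :
    w ∈ LinearMap.range (c.slots m) ↔ (c.tilt m).x 1 (w 0) = 0 ∧
      (∀ j, (c.tilt m).x 0 (w j) = (c.tilt m).x 1 (w (j + 1))) ∧ ∀ j, m < j → w j = 0 := by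
  constructor
  · rintro ⟨p, rfl⟩
    refine ⟨?_, fun j => slot_framing j p, fun j hj => slot_eq_zero hj p⟩
    change (c.tilt m).x 1 (c.slot m 0 p) = 0
    rw [slot_eq, tilt_x_mk]
    have : (fun j => (Pi.single 0 p : ℕ → P) (j + ((1 : Fin 2) : ℕ))) = 0 := by
      funext j
      simp
    rw [this, Submodule.Quotient.mk_zero]
  · rintro ⟨h0, hs, hm⟩
    obtain ⟨p, hp⟩ := exists_slot_eq w h0 hs hm
    exact ⟨p, (funext hp).symm⟩

theorem slots_injective (h : c.IsTiltInjective m) : Function.Injective (c.slots m) :=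
  fun _ _ e => slot_injective h fun j _ => congrFun e j

/-- The tilt determines `P` through the slots, and then `Q` as the pairs `(y₀ q, y₁ q)`, which are
also characterized by slots. The arrows `x` and `w` are recovered after composition with the
injective pair `(y₀, y₁)`. -/
theorem exists_equiv_of_tilt {c' : ConifoldRep P' Q'} (hc : c.IsTiltInjective m)
    (hc' : c'.IsTiltInjective m)
    (F : ((ℕ → P) ⧸ c.tiltSub (m + 1)) ≃ₗ[ℂ] ((ℕ → P') ⧸ c'.tiltSub (m + 1)))
    (G : ((ℕ → P) ⧸ c.tiltSub m) ≃ₗ[ℂ] ((ℕ → P') ⧸ c'.tiltSub m))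
    (hom : IsHom (c.tilt m) (c'.tilt m) F.toLinearMap G.toLinearMap) :
    ∃ (e : P ≃ₗ[ℂ] P') (e' : Q ≃ₗ[ℂ] Q'), IsHom c c' e.toLinearMap e'.toLinearMap ∧
      ∀ j p, c'.slot m j (e p) = F (c.slot m j p) := by
  have hx : ∀ i f, G ((c.tilt m).x i f) = (c'.tilt m).x i (F f) := hom.x
  have hy : ∀ i f, F ((c.tilt m).y i f) = (c'.tilt m).y i (G f) := hom.y
  have hz : ∀ f, F ((c.tilt m).z f) = (c'.tilt m).z (F f) := hom.z
  obtain ⟨e, he⟩ := exists_equiv_of_range (c.slots m) (c'.slots m) (slots_injective hc)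
    (slots_injective hc') (LinearEquiv.piCongrRight fun _ => F) (by
      intro w
      rw [mem_range_slots, mem_range_slots]
      simp only [LinearEquiv.piCongrRight_apply, ← hx, LinearEquiv.map_eq_zero_iff,
        EmbeddingLike.apply_eq_iff_eq])
  have he : ∀ j p, c'.slot m j (e p) = F (c.slot m j p) := fun j p => congrFun (he p) j
  have hypair : ∀ {P Q : Type} [AddCommGroup P] [Module ℂ P] [AddCommGroup Q] [Module ℂ Q]
      {c : ConifoldRep P Q}, c.IsTiltInjective m →
      Function.Injective ((c.y 0).prod (c.y 1)) := by
    intro P Q _ _ _ _ c hc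
    rw [← LinearMap.ker_eq_bot, Submodule.eq_bot_iff]
    intro q hq
    have hq : (c.y 0 q, c.y 1 q) = 0 := hq
    rw [Prod.mk_eq_zero] at hq
    exact hc.y_eq_zero hq.1 hq.2
  have hrange : ∀ {P Q : Type} [AddCommGroup P] [Module ℂ P] [AddCommGroup Q] [Module ℂ Q]
      {c : ConifoldRep P Q}, c.IsTiltInjective m → ∀ p : P × P,
      p ∈ LinearMap.range ((c.y 0).prod (c.y 1)) ↔
        c.slot m 0 p.1 = 0 ∧ ∀ j ≤ m, c.slot m (j + 1) p.1 = c.slot m j p.2 := by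
    intro P Q _ _ _ _ c hc p
    constructor
    · rintro ⟨q, rfl⟩
      exact ⟨slot_zero_y q, fun j _ => slot_succ_y j q⟩
    · rintro ⟨h0, hs⟩
      obtain ⟨q, h1, h2⟩ := exists_y_eq_of_slot hc p.1 p.2 h0 hs
      exact ⟨q, Prod.ext h1 h2⟩
  obtain ⟨e', he'⟩ := exists_equiv_of_range ((c.y 0).prod (c.y 1)) ((c'.y 0).prod (c'.y 1))
    (hypair hc) (hypair hc') (e.prodCongr e) (by
      intro p
      rw [hrange hc, hrange hc']
      simp only [LinearEquiv.prodCongr_apply, he, LinearEquiv.map_eq_zero_iff,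
        EmbeddingLike.apply_eq_iff_eq])
  have hey : ∀ i q, e (c.y i q) = c'.y i (e' q) := by
    intro i q
    fin_cases i
    · exact (congrArg Prod.fst (he' q)).symm
    · exact (congrArg Prod.snd (he' q)).symm
  have hez : ∀ p, e (c.z p) = c'.z (e p) := by
    intro p
    refine slot_injective hc' fun j _ => ?_
    rw [he, ← slot_z, hz, ← he, slot_z]
  have hyx1 : ∀ i p, e (c.y 1 (c.x i p)) = c'.y 1 (c'.x i (e p)) := by
    intro i p
    refine slot_injective hc' fun j _ => ?_
    rw [he, ← slot_yx, hy, hx, ← he, slot_yx]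
  have hyx0 : ∀ i p, e (c.y 0 (c.x i p)) = c'.y 0 (c'.x i (e p)) := by
    intro i p
    refine slot_injective hc' fun j _ => ?_
    rcases j with _ | j
    · rw [slot_zero_y, he, slot_zero_y, map_zero]
    · rw [slot_succ_y, he, slot_succ_y, ← he, hyx1]
  refine ⟨e, e', ⟨fun i p => hypair hc' (Prod.ext ?_ ?_), hey, hez, fun q =>
    hypair hc' (Prod.ext ?_ ?_)⟩, he⟩
  · exact (hey 0 _).symm.trans (hyx0 i p)
  · exact (hey 1 _).symm.trans (hyx1 i p)
  · change c'.y 0 (e' (c.w q)) = c'.y 0 (c'.w (e' q))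
    rw [← hey, ← c.zy, ← c'.zy, hez, hey]
  · change c'.y 1 (e' (c.w q)) = c'.y 1 (c'.w (e' q))
    rw [← hey, ← c.zy, ← c'.zy, hez, hey]

theorem eq_of_y_one_eq (hc : c.IsTiltInjective m) {q q' : Q} (h : c.y 1 q = c.y 1 q') : q = q' := by
  refine sub_eq_zero.1 (hc.eq_zero_of_y_one ?_)
  rw [map_sub, h, sub_self]

/-- The pair `(g, h)` scales the arrows, with arbitrary weights. -/
structure IsTorus (c : ConifoldRep P Q) (ξ η : Fin 2 → ℂ) (ζ : ℂ) (g : P →ₗ[ℂ] P)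
    (h : Q →ₗ[ℂ] Q) : Prop where
  x : ∀ i p, h (c.x i p) = ξ i • c.x i (g p)
  y : ∀ i q, g (c.y i q) = η i • c.y i (h q)
  z : ∀ p, g (c.z p) = ζ • c.z (g p)
  w : ∀ q, h (c.w q) = ζ • c.w (h q)

theorem IsTorus.swap {ξ η : Fin 2 → ℂ} {ζ : ℂ} {g : P →ₗ[ℂ] P} {h : Q →ₗ[ℂ] Q}
    (e : c.IsTorus ξ η ζ g h) : c.swap.IsTorus η ξ ζ h g :=
  ⟨e.y, e.x, e.w, e.z⟩

/-- Rescaling the action on the second vertex normalizes the weight of `x₁` to one. -/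
theorem IsTorus.isEquivariant {ξ η : Fin 2 → ℂ} {ζ : ℂ} {g : P →ₗ[ℂ] P} {h : Q →ₗ[ℂ] Q}
    (e : c.IsTorus ξ η ζ g h) (h1 : ξ 1 ≠ 0) :
    c.IsEquivariant (ξ 0 / ξ 1) (fun i => ξ 1 * η i) ζ g ((ξ 1)⁻¹ • h) where
  x0 p := by
    simp only [LinearMap.smul_apply, e.x, smul_smul]
    congr 1
    field_simp
  x1 p := by
    simp only [LinearMap.smul_apply, e.x, smul_smul, inv_mul_cancel₀ h1, one_smul]
  y i q := by
    simp only [LinearMap.smul_apply, e.y, map_smul, smul_smul]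
    congr 1
    field_simp
  z := e.z
  w q := by
    simp only [LinearMap.smul_apply, e.w, map_smul, smul_smul]
    congr 1
    ring

/-! ### The torus action on the tilt. -/

section Torus

variable {ξ η : Fin 2 → ℂ} {ζ : ℂ} {g : P →ₗ[ℂ] P} {h : Q →ₗ[ℂ] Q}

/-- The torus action on sequences. -/
def seqTorus (ω a : ℂ) (g : P →ₗ[ℂ] P) : (ℕ → P) →ₗ[ℂ] (ℕ → P) :=
  LinearMap.pi fun j => (a * ω ^ j) • (g ∘ₗ LinearMap.proj j)

theorem seqTorus_apply (ω a : ℂ) (f : ℕ → P) (j : ℕ) :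
    seqTorus ω a g f j = (a * ω ^ j) • g (f j) := rfl

theorem IsTorus.seqTorus_mem (e : c.IsTorus ξ η ζ g h) (h0 : η 0 ≠ 0) (a : ℂ) (k : ℕ) :
    c.tiltSub k ≤ (c.tiltSub k).comap (seqTorus (η 1 / η 0) a g) := by
  rintro f ⟨u, hu⟩
  refine ⟨fun j => (a * (η 1 / η 0) ^ j * η 0) • h (u j), fun j hj => ?_⟩
  rw [seqTorus_apply, hu j hj, map_sub, e.y, e.y, smul_sub, smul_smul, smul_smul, map_smul,
    map_smul]
  congr 2
  rw [pow_succ]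
  field_simp

/-- The torus action on the tilt. -/
def tiltTorus (e : c.IsTorus ξ η ζ g h) (h0 : η 0 ≠ 0) (a : ℂ) (k : ℕ) :
    ((ℕ → P) ⧸ c.tiltSub k) →ₗ[ℂ] ((ℕ → P) ⧸ c.tiltSub k) :=
  Submodule.mapQ _ _ _ (e.seqTorus_mem h0 a k)

theorem IsTorus.tilt (e : c.IsTorus ξ η ζ g h) (h0 : η 0 ≠ 0) (h1 : η 1 ≠ 0) (m : ℕ) :
    (c.tilt m).IsEquivariant (η 1 / η 0) (fun i => η 0 * ξ i) ζ (tiltTorus e h0 1 (m + 1))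
      (tiltTorus e h0 (η 1 / η 0) m) where
  x0 f := by
    obtain ⟨f, rfl⟩ := Submodule.Quotient.mk_surjective _ f
    refine congrArg Submodule.Quotient.mk (funext fun j => ?_)
    change (η 1 / η 0 * (η 1 / η 0) ^ j) • g (f j) = (η 1 / η 0) • (1 * (η 1 / η 0) ^ j) • g (f j)
    rw [smul_smul, one_mul]
  x1 f := by
    obtain ⟨f, rfl⟩ := Submodule.Quotient.mk_surjective _ f
    refine congrArg Submodule.Quotient.mk (funext fun j => ?_)
    change (η 1 / η 0 * (η 1 / η 0) ^ j) • g (f (j + 1)) =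
      (1 * (η 1 / η 0) ^ (j + 1)) • g (f (j + 1))
    rw [one_mul, pow_succ']
  y i f := by
    obtain ⟨f, rfl⟩ := Submodule.Quotient.mk_surjective _ f
    refine congrArg Submodule.Quotient.mk (funext fun j => ?_)
    change (1 * (η 1 / η 0) ^ j) • g (c.y 1 (c.x i (f j))) =
      (η 0 * ξ i) • c.y 1 (c.x i ((η 1 / η 0 * (η 1 / η 0) ^ j) • g (f j)))
    rw [e.y, e.x]
    simp only [map_smul, smul_smul]
    congr 1
    field_simp
  z f := by
    obtain ⟨f, rfl⟩ := Submodule.Quotient.mk_surjective _ f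
    refine congrArg Submodule.Quotient.mk (funext fun j => ?_)
    change (1 * (η 1 / η 0) ^ j) • g (c.z (f j)) = ζ • c.z ((1 * (η 1 / η 0) ^ j) • g (f j))
    rw [e.z, map_smul, smul_comm]
  w f := by
    obtain ⟨f, rfl⟩ := Submodule.Quotient.mk_surjective _ f
    refine congrArg Submodule.Quotient.mk (funext fun j => ?_)
    change (η 1 / η 0 * (η 1 / η 0) ^ j) • g (c.z (f j)) =
      ζ • c.z ((η 1 / η 0 * (η 1 / η 0) ^ j) • g (f j))
    rw [e.z, map_smul, smul_comm]

theorem tiltTorus_slot (e : c.IsTorus ξ η ζ g h) (h0 : η 0 ≠ 0) {ν : ℂ} {p : P} (hp : g p = ν • p)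
    (j : ℕ) : tiltTorus e h0 1 (m + 1) (c.slot m j p) = (ν * (η 1 / η 0) ^ j) • c.slot m j p := by
  rw [slot_eq, ← Submodule.Quotient.mk_smul]
  refine congrArg Submodule.Quotient.mk (funext fun i => ?_)
  rw [seqTorus_apply, Pi.smul_apply]
  by_cases hi : i = j
  · subst hi
    rw [Pi.single_eq_same, hp, smul_smul, one_mul, mul_comm]
  · rw [Pi.single_eq_of_ne hi, map_zero, smul_zero, smul_zero]

end Torus

end ConifoldRep

end

/-! ### Framed objects from stable representations -/

section

namespace FramedObj

open ConifoldRep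

variable {P Q : Type} [AddCommGroup P] [Module ℂ P] [AddCommGroup Q] [Module ℂ Q]
  [FiniteDimensional ℂ P] [FiniteDimensional ℂ Q] {P' Q' : Type} [AddCommGroup P'] [Module ℂ P']
  [AddCommGroup Q'] [Module ℂ Q'] [FiniteDimensional ℂ P'] [FiniteDimensional ℂ Q']
  {c : ConifoldRep P Q} {c' : ConifoldRep P' Q'} {ξ η : Fin 2 → ℂ} {ζ : ℂ}
  {g : P →ₗ[ℂ] P} {h : Q →ₗ[ℂ] Q} {g' : P' →ₗ[ℂ] P'} {h' : Q' →ₗ[ℂ] Q'}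

/-- The tilt of a representation as a framed representation. -/
@[simps P Q c n] def ofTilt (e : c.IsTorus ξ η ζ g h) (h0 : η 0 ≠ 0) (h1 : η 1 ≠ 0) (m : ℕ)
    {ν : ℂ} (hν : ν ≠ 0) {p : P} (hp : g p = ν • p) :
    FramedObj (η 1 / η 0) (fun i => η 0 * ξ i) ζ m where
  P := (ℕ → P) ⧸ c.tiltSub (m + 1)
  Q := (ℕ → P) ⧸ c.tiltSub m
  c := c.tilt m
  n j := c.slot m j p
  framing j _ := slot_framing j p
  g := tiltTorus e h0 1 (m + 1)
  h := tiltTorus e h0 (η 1 / η 0) m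
  equivariant := e.tilt h0 h1 m
  ν := ν
  ν_ne := hν
  weight j _ := tiltTorus_slot e h0 hp j

theorem exists_isHom_of_ofTilt_iso {e : c.IsTorus ξ η ζ g h} {e' : c'.IsTorus ξ η ζ g' h'}
    {h0 : η 0 ≠ 0} {h1 : η 1 ≠ 0} {m : ℕ} {ν ν' : ℂ} {hν : ν ≠ 0} {hν' : ν' ≠ 0} {p : P}
    {p' : P'} {hp : g p = ν • p} {hp' : g' p' = ν' • p'} (hc : c.IsTiltInjective m)
    (hc' : c'.IsTiltInjective m) (iso : (ofTilt e h0 h1 m hν hp).Iso (ofTilt e' h0 h1 m hν' hp')) :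
    ∃ (a : P ≃ₗ[ℂ] P') (b : Q ≃ₗ[ℂ] Q'), IsHom c c' a.toLinearMap b.toLinearMap ∧ a p = p' := by
  obtain ⟨F, G, hom, hn⟩ := iso
  obtain ⟨a, b, hab, hs⟩ := exists_equiv_of_tilt hc hc' F G hom
  refine ⟨a, b, hab, slot_injective hc' fun j hj => ?_⟩
  rw [hs]
  exact hn j hj

theorem isGenerated_ofTilt_left {e : c.IsTorus ξ η ζ g h} {h0 : η 0 ≠ 0} {h1 : η 1 ≠ 0} {m : ℕ}
    {ν : ℂ} {hν : ν ≠ 0} {p : P} {hp : g p = ν • p} {Θ : ℝ × ℝ}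
    (hst : c.IsFramedStable {p} ∅ Θ) (hnil : c.IsNil) (hΘ : Θ.1 < 0) (hd : 0 < Θ.1 + Θ.2)
    (hm : Θ.1 + m * (Θ.1 + Θ.2) < 0) :
    (ofTilt e h0 h1 m hν hp).c.IsGenerated m (ofTilt e h0 h1 m hν hp).n := by
  by_contra hc
  obtain ⟨K, hv, -, hK, hlt⟩ := exists_sub_of_not_isGenerated_tilt hnil hΘ hd hm p hc
  exact (hst.2 K (by simpa using hv) (Set.empty_subset _) hK).not_gt hlt

/-- When the framing vector `q` sits at the second vertex, the tilt is framed by `y₁ q`; the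
destabilizing `K` contains `q` as soon as it contains `y₁ q`. -/
theorem isGenerated_ofTilt_right {e : c.IsTorus ξ η ζ g h} {h0 : η 0 ≠ 0} {h1 : η 1 ≠ 0} {m : ℕ}
    {ν : ℂ} {hν : ν ≠ 0} {q : Q} {hp : g (c.y 1 q) = ν • c.y 1 q} {Θ : ℝ × ℝ}
    (hst : c.IsFramedStable ∅ {q} Θ) (hnil : c.IsNil) (hΘ : Θ.1 < 0) (hd : 0 < Θ.1 + Θ.2)
    (hm : Θ.1 + m * (Θ.1 + Θ.2) < 0) :
    (ofTilt e h0 h1 m hν hp).c.IsGenerated m (ofTilt e h0 h1 m hν hp).n := by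
  by_contra hc
  obtain ⟨K, hv, hK', hK, hlt⟩ := exists_sub_of_not_isGenerated_tilt hnil hΘ hd hm _ hc
  exact (hst.2 K (Set.empty_subset _) (by simpa using hK' q hv) hK).not_gt hlt

/-- A representation with a framing vector in the first vertex space. -/
@[simps P Q c n] def ofVector (e : c.IsTorus ξ η ζ g h) (h1 : ξ 1 ≠ 0) {ν : ℂ} (hν : ν ≠ 0) {p : P}
    (hp : g p = ν • p) : FramedObj (ξ 0 / ξ 1) (fun i => ξ 1 * η i) ζ 0 where
  P := P
  Q := Q
  c := c
  n _ := p
  framing j hj := absurd hj (Nat.not_lt_zero j)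
  g := g
  h := (ξ 1)⁻¹ • h
  equivariant := e.isEquivariant h1
  ν := ν
  ν_ne := hν
  weight j hj := by rw [Nat.le_zero.1 hj, pow_zero, mul_one, hp]

/-- The reflection of a representation with a framing vector in the second vertex space. -/
@[simps P Q c n] def ofReflect (e : c.IsTorus ξ η ζ g h) (h1 : ξ 1 ≠ 0) {ν : ℂ} (hν : ν ≠ 0)
    {q : Q} (hq : h q = ν • q) : FramedObj (ξ 0 / ξ 1) (fun i => ξ 1 * η i) ζ 0 where
  P := Q
  Q := (Q × Q) ⧸ LinearMap.range c.xProd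
  c := c.reflect
  n _ := q
  framing j hj := absurd hj (Nat.not_lt_zero j)
  g := (ξ 1)⁻¹ • h
  h := reflectTorus (e.isEquivariant h1)
  equivariant := (e.isEquivariant h1).reflect
  ν := (ξ 1)⁻¹ * ν
  ν_ne := mul_ne_zero (inv_ne_zero h1) hν
  weight j hj := by
    rw [Nat.le_zero.1 hj, pow_zero, mul_one, LinearMap.smul_apply, hq, smul_smul]

end FramedObj

/-! ### Framed representations of the quiver -/

variable {d₀ d₁ e₀ e₁ : ℕ}

open ConifoldRep

/-- The representation on coordinate spaces defined by matrices. -/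
@[simps] def QRep.toConifold (V : QRep d₀ d₁) : ConifoldRep (Fin d₀ → ℂ) (Fin d₁ → ℂ) where
  x i := (V.a i).mulVecLin
  y i := (V.b i).mulVecLin
  z := V.c.mulVecLin
  w := V.d.mulVecLin
  xyx i p := by
    simp only [mulVecLin_apply, mulVec_mulVec]
    rw [← Matrix.mul_assoc, ← Matrix.mul_assoc, V.rel_aba]
  yxy i p := by
    simp only [mulVecLin_apply, mulVec_mulVec]
    rw [← Matrix.mul_assoc, ← Matrix.mul_assoc, V.rel_bab]
  wx i p := by simp only [mulVecLin_apply, mulVec_mulVec, V.rel_da]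
  zy i p := by simp only [mulVecLin_apply, mulVec_mulVec, V.rel_cb]

/-- A subrepresentation as a subrepresentation of the representation on coordinate spaces. -/
@[simps] def SubRep.toSub {V : QRep d₀ d₁} (W : SubRep V) : Sub V.toConifold :=
  ⟨W.W₀, W.W₁, W.a_mem, W.b_mem, W.c_mem, W.d_mem⟩

/-- The converse of `SubRep.toSub`. -/
@[simps] def SubRep.ofSub {V : QRep d₀ d₁} (W : Sub V.toConifold) : SubRep V :=
  ⟨W.fst, W.snd, W.x_mem, W.y_mem, W.z_mem, W.w_mem⟩

theorem SubRep.isZero_iff {V : QRep d₀ d₁} (W : SubRep V) : W.IsZero ↔ W.toSub = ⊥ :=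
  ⟨fun h => Sub.ext h.1 h.2, fun h => ⟨congrArg Sub.fst h, congrArg Sub.snd h⟩⟩

theorem SubRep.isAll_iff {V : QRep d₀ d₁} (W : SubRep V) : W.IsAll ↔ W.toSub = ⊤ :=
  ⟨fun h => Sub.ext h.1 h.2, fun h => ⟨congrArg Sub.fst h, congrArg Sub.snd h⟩⟩

theorem FramedRep.isStable_iff (V : FramedRep d₀ d₁) (Θ : ℝ × ℝ) :
    V.IsStable Θ ↔ V.toQRep.toConifold.IsFramedStable {V.v} ∅ Θ := by
  have ht : V.toQRep.toConifold.totalSlope Θ = Θ.1 * (d₀ : ℝ) + Θ.2 * (d₁ : ℝ) := by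
    simp [totalSlope]
  constructor
  · rintro ⟨h1, h2⟩
    refine ⟨fun W hW => h1 (SubRep.ofSub W) fun h => hW ((SubRep.isZero_iff _).1 h),
      fun W hv _ hW => ?_⟩
    rw [ht]
    exact h2 (SubRep.ofSub W) (by simpa using hv) fun h => hW ((SubRep.isAll_iff _).1 h)
  · rintro ⟨h1, h2⟩
    refine ⟨fun W hW => h1 W.toSub fun h => hW ((SubRep.isZero_iff _).2 h), fun W hv hW => ?_⟩
    rw [← ht]
    exact h2 W.toSub (by simpa using hv) (Set.empty_subset _)
      fun h => hW ((SubRep.isAll_iff _).2 h)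

/-- The invertible matrix of a linear equivalence. -/
def glOfEquiv {n : ℕ} (e : (Fin n → ℂ) ≃ₗ[ℂ] (Fin n → ℂ)) : GL (Fin n) ℂ where
  val := LinearMap.toMatrix' e.toLinearMap
  inv := LinearMap.toMatrix' e.symm.toLinearMap
  val_inv := by
    rw [← LinearMap.toMatrix'_comp]
    simp
  inv_val := by
    rw [← LinearMap.toMatrix'_comp]
    simp

theorem glOfEquiv_mulVec {n : ℕ} (e : (Fin n → ℂ) ≃ₗ[ℂ] (Fin n → ℂ)) (v : Fin n → ℂ) :
    (glOfEquiv e).1 *ᵥ v = e v :=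
  LinearMap.toMatrix'_mulVec _ _

/-- The linear equivalence of an invertible matrix. -/
def equivOfGL {n : ℕ} (g : GL (Fin n) ℂ) : (Fin n → ℂ) ≃ₗ[ℂ] (Fin n → ℂ) :=
  LinearEquiv.ofLinearMap g.1.mulVecLin (g⁻¹).1.mulVecLin
    (by
      have : g.1 * (g⁻¹).1 = 1 := by simp
      rw [← mulVecLin_mul, this, mulVecLin_one])
    (by
      have : (g⁻¹).1 * g.1 = 1 := by simp
      rw [← mulVecLin_mul, this, mulVecLin_one])

@[simp] theorem equivOfGL_apply {n : ℕ} (g : GL (Fin n) ℂ) (v : Fin n → ℂ) :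
    equivOfGL g v = g.1 *ᵥ v := rfl

theorem FramedRep.iso_iff (V U : FramedRep d₀ d₁) : V.Iso U ↔
    ∃ (e : (Fin d₀ → ℂ) ≃ₗ[ℂ] (Fin d₀ → ℂ)) (e' : (Fin d₁ → ℂ) ≃ₗ[ℂ] (Fin d₁ → ℂ)),
      IsHom V.toQRep.toConifold U.toQRep.toConifold e.toLinearMap e'.toLinearMap ∧ e V.v = U.v := by
  constructor
  · rintro ⟨g₀, g₁, ha, hb, hc, hd, hv⟩
    refine ⟨equivOfGL g₀, equivOfGL g₁, ⟨fun i p => ?_, fun i p => ?_, fun p => ?_, fun p => ?_⟩, hv⟩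
    · change g₁.1 *ᵥ (V.a i *ᵥ p) = U.a i *ᵥ (g₀.1 *ᵥ p)
      rw [mulVec_mulVec, mulVec_mulVec, ha]
    · change g₀.1 *ᵥ (V.b i *ᵥ p) = U.b i *ᵥ (g₁.1 *ᵥ p)
      rw [mulVec_mulVec, mulVec_mulVec, hb]
    · change g₀.1 *ᵥ (V.c *ᵥ p) = U.c *ᵥ (g₀.1 *ᵥ p)
      rw [mulVec_mulVec, mulVec_mulVec, hc]
    · change g₁.1 *ᵥ (V.d *ᵥ p) = U.d *ᵥ (g₁.1 *ᵥ p)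
      rw [mulVec_mulVec, mulVec_mulVec, hd]
  · rintro ⟨e, e', h, hv⟩
    have ext : ∀ {m n : ℕ} {A B : Matrix (Fin m) (Fin n) ℂ}, (∀ v, A *ᵥ v = B *ᵥ v) → A = B :=
      fun h => Matrix.ext_of_mulVec_single fun i => h _
    refine ⟨glOfEquiv e, glOfEquiv e', fun i => ext fun p => ?_, fun i => ext fun p => ?_,
      ext fun p => ?_, ext fun p => ?_, ?_⟩
    · rw [← mulVec_mulVec, ← mulVec_mulVec, glOfEquiv_mulVec, glOfEquiv_mulVec]
      exact h.x i p
    · rw [← mulVec_mulVec, ← mulVec_mulVec, glOfEquiv_mulVec, glOfEquiv_mulVec]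
      exact h.y i p
    · rw [← mulVec_mulVec, ← mulVec_mulVec, glOfEquiv_mulVec, glOfEquiv_mulVec]
      exact h.z p
    · rw [← mulVec_mulVec, ← mulVec_mulVec, glOfEquiv_mulVec, glOfEquiv_mulVec]
      exact h.w p
    · rw [glOfEquiv_mulVec, hv]

theorem IsoClass.eq_of_equiv (I J : IsoClass) (e : (Fin I.dim₀ → ℂ) ≃ₗ[ℂ] (Fin J.dim₀ → ℂ))
    (e' : (Fin I.dim₁ → ℂ) ≃ₗ[ℂ] (Fin J.dim₁ → ℂ))
    (h : IsHom I.rep.toQRep.toConifold J.rep.toQRep.toConifold e.toLinearMap e'.toLinearMap)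
    (hv : e I.rep.v = J.rep.v) : I = J := by
  have h0 : I.dim₀ = J.dim₀ := by simpa using e.finrank_eq
  have h1 : I.dim₁ = J.dim₁ := by simpa using e'.finrank_eq
  obtain ⟨⟨a, b⟩, q⟩ := I
  obtain ⟨⟨a', b'⟩, q'⟩ := J
  change a = a' at h0
  change b = b' at h1
  subst h0 h1
  have : FramedRep.Iso (Quotient.out q) (Quotient.out q') := (FramedRep.iso_iff _ _).2 ⟨e, e', h, hv⟩
  have hq : q = q' := by
    rw [← Quotient.out_eq q, ← Quotient.out_eq q']
    exact Quotient.sound this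
  rw [hq]

/-- The weights `(1/3, 1/5)` of the arrows `a`. -/
def genXi : Fin 2 → ℂ := ![1 / 3, 1 / 5]

/-- The weights `(1, 1/2)` of the arrows `b`. -/
def genEta : Fin 2 → ℂ := ![1, 1 / 2]

theorem FramedRep.IsTorusFixed.exists_isTorus {V : FramedRep d₀ d₁} (h : V.IsTorusFixed) :
    ∃ (g : (Fin d₀ → ℂ) →ₗ[ℂ] (Fin d₀ → ℂ)) (h : (Fin d₁ → ℂ) →ₗ[ℂ] (Fin d₁ → ℂ)),
      V.toQRep.toConifold.IsTorus genXi genEta 30 g h ∧ g V.v = (1 : ℂ) • V.v ∧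
      Function.Injective g ∧ Function.Injective h := by
  -- A single torus element with multiplicatively independent `t₀, t₁, t₂` suffices. The isomorphism
  -- goes from the scaled to the original arrows, so the resulting operators have the inverse
  -- weights.
  let t : Fin 4 → ℂˣ := ![Units.mk0 2 (by norm_num), Units.mk0 3 (by norm_num),
    Units.mk0 5 (by norm_num), Units.mk0 (1 / 30) (by norm_num)]
  have ht : t ∈ T₀ := by
    change ∏ i, t i = 1
    ext
    simp [t, Fin.prod_univ_four]
    norm_num
  obtain ⟨e, e', hom, hv⟩ := (FramedRep.iso_iff _ _).1 (h t ht)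
  have hx : ∀ i p, e' ((![(3 : ℂ), 5] i) • (V.a i *ᵥ p)) = V.a i *ᵥ e p := by
    intro i p
    have := hom.x i p
    simp only [FramedRep.act, QRep.toConifold, mulVecLin_apply, Matrix.smul_mulVec] at this
    fin_cases i <;> exact this
  have hy : ∀ i p, e ((![(1 : ℂ), 2] i) • (V.b i *ᵥ p)) = V.b i *ᵥ e' p := by
    intro i p
    have := hom.y i p
    simp only [FramedRep.act, QRep.toConifold, mulVecLin_apply, Matrix.smul_mulVec] at this
    fin_cases i <;> exact this
  have hz : ∀ p, e ((1 / 30 : ℂ) • (V.c *ᵥ p)) = V.c *ᵥ e p := by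
    intro p
    have := hom.z p
    simp only [FramedRep.act, QRep.toConifold, mulVecLin_apply, Matrix.smul_mulVec] at this
    exact this
  have hw : ∀ p, e' ((1 / 30 : ℂ) • (V.d *ᵥ p)) = V.d *ᵥ e' p := by
    intro p
    have := hom.w p
    simp only [FramedRep.act, QRep.toConifold, mulVecLin_apply, Matrix.smul_mulVec] at this
    exact this
  refine ⟨e.toLinearMap, e'.toLinearMap, ⟨fun i p => ?_, fun i p => ?_, fun p => ?_, fun p => ?_⟩,
    ?_, e.injective, e'.injective⟩
  · change e' (V.a i *ᵥ p) = genXi i • (V.a i *ᵥ e p)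
    rw [← hx, map_smul, smul_smul]
    fin_cases i <;> simp [genXi]
  · change e (V.b i *ᵥ p) = genEta i • (V.b i *ᵥ e' p)
    rw [← hy, map_smul, smul_smul]
    fin_cases i <;> simp [genEta]
  · change e (V.c *ᵥ p) = (30 : ℂ) • (V.c *ᵥ e p)
    rw [← hz, map_smul, smul_smul]
    norm_num
  · change e' (V.d *ᵥ p) = (30 : ℂ) • (V.d *ᵥ e' p)
    rw [← hw, map_smul, smul_smul]
    norm_num
  · rw [one_smul]
    exact hv

theorem isNil_of_isTorus {P Q : Type} [AddCommGroup P] [Module ℂ P] [AddCommGroup Q] [Module ℂ Q]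
    [FiniteDimensional ℂ P] [FiniteDimensional ℂ Q] {c : ConifoldRep P Q} {g : P →ₗ[ℂ] P}
    {h : Q →ₗ[ℂ] Q} (e : c.IsTorus genXi genEta 30 g h) (hg : Function.Injective g)
    (hh : Function.Injective h) : c.IsNil := by
  have hpow : ∀ x : ℝ, 0 < x → x ≠ 1 → ∀ m n : ℕ, (x : ℂ) ^ m = (x : ℂ) ^ n → m = n := by
    intro x hx hx1 m n hmn
    have : x ^ m = x ^ n := by exact_mod_cast hmn
    exact pow_right_injective₀ hx hx1 this
  obtain ⟨X, hX⟩ : ∃ X : Fin 2 → ℝ, X = ![1 / 3, 1 / 5] := ⟨_, rfl⟩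
  obtain ⟨Y, hY⟩ : ∃ Y : Fin 2 → ℝ, Y = ![1, 1 / 2] := ⟨_, rfl⟩
  -- Every closed path through both vertices has as weight a positive real number different from
  -- `1`, hence of infinite order.
  have hl : ∀ i l, ∃ x : ℝ, 0 < x ∧ x ≠ 1 ∧ genEta l * genXi i = x := by
    intro i l
    refine ⟨Y l * X i, ?_, ?_, ?_⟩ <;> rw [hX, hY] <;> fin_cases i <;> fin_cases l <;>
      norm_num [genXi, genEta]
  refine ⟨fun i l => ?_, fun i l => ?_, ?_, ?_⟩
  · obtain ⟨x, hx0, hx1, hx⟩ := hl i l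
    refine isNilpotent_of_intertwine g _ hg (hpow x hx0 hx1) (by exact_mod_cast hx0.ne')
      fun p => ?_
    rw [LinearMap.comp_apply, e.y, e.x, map_smul, smul_smul, hx]
    rfl
  · obtain ⟨x, hx0, hx1, hx⟩ := hl i l
    refine isNilpotent_of_intertwine h _ hh (hpow x hx0 hx1) (by exact_mod_cast hx0.ne')
      fun p => ?_
    rw [LinearMap.comp_apply, e.x, e.y, map_smul, smul_smul, mul_comm, hx]
    rfl
  · exact isNilpotent_of_intertwine g _ hg (by exact_mod_cast hpow 30 (by norm_num) (by norm_num))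
      (by norm_num) e.z
  · exact isNilpotent_of_intertwine h _ hh (by exact_mod_cast hpow 30 (by norm_num) (by norm_num))
      (by norm_num) e.w

end

/-! ### Finiteness of the set of fixed points -/

section

open ConifoldRep FramedObj

/-- `2^a 3^b 5^c`. -/
def smoothNum (a b c : ℤ) : ℂ := 2 ^ a * 3 ^ b * 5 ^ c

/-- The exponents are the valuations at `2`, `3` and `5`. -/
theorem smoothNum_eq_one {a b c : ℤ} (h : smoothNum a b c = 1) : a = 0 ∧ b = 0 ∧ c = 0 := by
  have h' : ((2 : ℚ) ^ a * 3 ^ b * 5 ^ c) = 1 := by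
    have : (((2 : ℚ) ^ a * 3 ^ b * 5 ^ c : ℚ) : ℂ) = 1 := by
      push_cast
      exact h
    exact_mod_cast this
  have key : ∀ (p : ℕ) [Fact p.Prime], a * padicValRat p 2 + b * padicValRat p 3 +
      c * padicValRat p 5 = 0 := by
    intro p _
    have := congrArg (padicValRat p) h'
    rwa [padicValRat.mul (by positivity) (by positivity),
      padicValRat.mul (by positivity) (by positivity), padicValRat.zpow, padicValRat.zpow,
      padicValRat.zpow, padicValRat.one] at this
  have val : ∀ (p q : ℕ) [Fact p.Prime] [Fact q.Prime], p ≠ q →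
      padicValRat p (q : ℚ) = 0 := by
    intro p q _ _ hpq
    rw [padicValRat.of_nat, padicValNat_primes hpq, Nat.cast_zero]
  have val' : ∀ (p : ℕ) [Fact p.Prime], padicValRat p (p : ℚ) = 1 := by
    intro p hp
    exact padicValRat.self hp.out.one_lt
  have : Fact (Nat.Prime 5) := ⟨by norm_num⟩
  have k2 := key 2
  have k3 := key 3
  have k5 := key 5
  have a1 := val 2 3 (by norm_num)
  have a2 := val 2 5 (by norm_num)
  have a3 := val 3 2 (by norm_num)
  have a4 := val 3 5 (by norm_num)
  have a5 := val 5 2 (by norm_num)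
  have a6 := val 5 3 (by norm_num)
  have b2 := val' 2
  have b3 := val' 3
  have b5 := val' 5
  push_cast at a1 a2 a3 a4 a5 a6 b2 b3 b5
  rw [b2, a1, a2] at k2
  rw [a3, b3, a4] at k3
  rw [a5, a6, b5] at k5
  omega

theorem smoothNum_zpow (a b c n : ℤ) : smoothNum a b c ^ n = smoothNum (a * n) (b * n) (c * n) := by
  simp only [smoothNum, mul_zpow, ← _root_.zpow_mul]

theorem smoothNum_mul (a b c a' b' c' : ℤ) :
    smoothNum a b c * smoothNum a' b' c' = smoothNum (a + a') (b + b') (c + c') := by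
  simp only [smoothNum, _root_.zpow_add₀ (two_ne_zero : (2 : ℂ) ≠ 0),
    _root_.zpow_add₀ (three_ne_zero : (3 : ℂ) ≠ 0),
    _root_.zpow_add₀ (show (5 : ℂ) ≠ 0 by norm_num)]
  ring

theorem genericWeights_of_smoothNum {ρ : ℂ} {τ : Fin 2 → ℂ} {r₀ r₁ r₂ s₀ s₁ s₂ u₀ u₁ u₂ : ℤ}
    (hr : ρ = smoothNum r₀ r₁ r₂) (hs : τ 0 = smoothNum s₀ s₁ s₂) (hu : τ 1 = smoothNum u₀ u₁ u₂)
    (hprod : ρ * τ 0 * τ 1 * 30 = 1)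
    (h : ∀ a b c : ℤ, r₀ * a + s₀ * b + u₀ * c = 0 ∧ r₁ * a + s₁ * b + u₁ * c = 0 ∧
      r₂ * a + s₂ * b + u₂ * c = 0 → a = 0 ∧ b = 0 ∧ c = 0) :
    GenericWeights ρ τ 30 := by
  refine ⟨hprod, fun a b c habc => h a b c (smoothNum_eq_one ?_)⟩
  rw [← habc, hr, hs, hu]
  simp only [smoothNum_zpow, smoothNum_mul]

theorem genericWeights_reflect :
    GenericWeights (genXi 0 / genXi 1) (fun i => genXi 1 * genEta i) 30 := by
  refine genericWeights_of_smoothNum (r₀ := 0) (r₁ := -1) (r₂ := 1) (s₀ := 0) (s₁ := 0) (s₂ := -1)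
    (u₀ := -1) (u₁ := 0) (u₂ := -1)
    ?_ ?_ ?_ ?_ ?_
  · norm_num [genXi, smoothNum]
  · norm_num [genXi, genEta, smoothNum]
  · norm_num [genXi, genEta, smoothNum]
  · norm_num [genXi, genEta]
  · intro a b c h
    omega

theorem genericWeights_reflect_swap :
    GenericWeights (genEta 0 / genEta 1) (fun i => genEta 1 * genXi i) 30 := by
  refine genericWeights_of_smoothNum (r₀ := 1) (r₁ := 0) (r₂ := 0) (s₀ := -1) (s₁ := -1) (s₂ := 0)
    (u₀ := -1) (u₁ := 0) (u₂ := -1)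
    ?_ ?_ ?_ ?_ ?_
  · norm_num [genEta, smoothNum]
  · norm_num [genXi, genEta, smoothNum]
  · norm_num [genXi, genEta, smoothNum]
  · norm_num [genXi, genEta]
  · intro a b c h
    omega

theorem genericWeights_tilt :
    GenericWeights (genEta 1 / genEta 0) (fun i => genEta 0 * genXi i) 30 := by
  refine genericWeights_of_smoothNum (r₀ := -1) (r₁ := 0) (r₂ := 0) (s₀ := 0) (s₁ := -1) (s₂ := 0)
    (u₀ := 0) (u₁ := 0) (u₂ := -1)
    ?_ ?_ ?_ ?_ ?_
  · norm_num [genEta, smoothNum]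
  · norm_num [genXi, genEta, smoothNum]
  · norm_num [genXi, genEta, smoothNum]
  · norm_num [genXi, genEta]
  · intro a b c h
    omega

theorem genericWeights_tilt_swap :
    GenericWeights (genXi 1 / genXi 0) (fun i => genXi 0 * genEta i) 30 := by
  refine genericWeights_of_smoothNum (r₀ := 0) (r₁ := 1) (r₂ := -1) (s₀ := 0) (s₁ := -1) (s₂ := 0)
    (u₀ := -1) (u₁ := -1) (u₂ := 0)
    ?_ ?_ ?_ ?_ ?_
  · norm_num [genXi, smoothNum]
  · norm_num [genXi, genEta, smoothNum]
  · norm_num [genXi, genEta, smoothNum]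
  · norm_num [genXi, genEta]
  · intro a b c h
    omega

theorem genXi_ne_zero (i : Fin 2) : genXi i ≠ 0 := by
  fin_cases i <;> norm_num [genXi]

theorem genEta_ne_zero (i : Fin 2) : genEta i ≠ 0 := by
  fin_cases i <;> norm_num [genEta]

/-- Isomorphism of the representations on coordinate spaces, compatible with the framing. -/
def FramedRep.Equivalent {d₀ d₁ e₀ e₁ : ℕ} (V : FramedRep d₀ d₁) (U : FramedRep e₀ e₁) : Prop :=
  ∃ (e : (Fin d₀ → ℂ) ≃ₗ[ℂ] (Fin e₀ → ℂ)) (e' : (Fin d₁ → ℂ) ≃ₗ[ℂ] (Fin e₁ → ℂ)),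
    IsHom V.toQRep.toConifold U.toQRep.toConifold e.toLinearMap e'.toLinearMap ∧ e V.v = U.v

theorem finite_of_finiteClasses {ρ : ℂ} {τ : Fin 2 → ℂ} {ζ : ℂ} {k : ℕ} (S : Set IsoClass)
    (T : Set (FramedObj ρ τ ζ k)) (hT : FiniteClasses T) (X : S → FramedObj ρ τ ζ k)
    (hX : ∀ I, X I ∈ T)
    (h : ∀ I J : S, (X I).Iso (X J) → I.1.rep.Equivalent J.1.rep) : S.Finite := by
  obtain ⟨ι, hι, F, hF⟩ := hT
  have : Finite S := Finite.of_injective (fun I => F (X I)) fun I J e => by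
    obtain ⟨a, b, hab, hv⟩ := h I J (hF _ (hX I) _ (hX J) e)
    exact Subtype.ext (IsoClass.eq_of_equiv _ _ a b hab hv)
  exact S.toFinite

/-! ### Finiteness chamber by chamber. -/

section Finiteness

variable {Θ : ℝ × ℝ} (n d : ℤ)

theorem exists_nat_add_mul_neg {a b : ℝ} (hb : b < 0) : ∃ N : ℕ, a + N * b < 0 := by
  obtain ⟨N, hN⟩ := exists_nat_gt (a / -b)
  refine ⟨N, ?_⟩
  rw [div_lt_iff₀ (by linarith)] at hN
  linarith

theorem finrank_rep_le {I : IsoClass} (hI : I ∈ fixedPointsOf Θ n d) :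
    finrank ℂ (Fin I.dim₀ → ℂ) ≤ n.toNat ∧
    finrank ℂ (Fin I.dim₁ → ℂ) ≤ (n - d).toNat := by
  obtain ⟨-, h1, h2⟩ := hI
  rw [finrank_fin_fun, finrank_fin_fun]
  simp only [IsoClass.n, IsoClass.deg] at h1 h2
  omega

theorem frame_zero {ρ : ℂ} {τ : Fin 2 → ℂ} {ζ : ℂ} (X : FramedObj ρ τ ζ 0) :
    X.frame = {X.n 0} := by
  ext p
  constructor
  · rintro ⟨j, hj, rfl⟩
    rw [Nat.le_zero.1 hj]
    rfl
  · rintro rfl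
    exact ⟨0, le_rfl, rfl⟩

theorem finite_of_reflect_left (h1 : Θ.2 < 0) (hd : Θ.1 + Θ.2 < 0)
    (hne : ∀ j : ℕ, Θ.1 + j * (Θ.1 + Θ.2) ≠ 0) : (fixedPointsOf Θ n d).Finite := by
  obtain ⟨N, hN⟩ := exists_nat_add_mul_neg (a := Θ.1) hd
  have ht := fun I : fixedPointsOf Θ n d => I.2.1.2.exists_isTorus
  choose g h e hv hg hh using ht
  refine finite_of_finiteClasses _ _
    (finiteClasses_of_isFramedStable genericWeights_reflect N 0 Θ h1 hN hne
      (max n.toNat (n - d).toNat))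
    (fun I => ofVector (e I) (genXi_ne_zero 1) one_ne_zero (hv I)) (fun I => ⟨?_, ?_, ?_⟩) ?_
  · rw [frame_zero]
    exact (FramedRep.isStable_iff _ _).1 I.2.1.1
  · exact (finrank_rep_le n d I.2).1.trans (le_max_left _ _)
  · exact (finrank_rep_le n d I.2).2.trans (le_max_right _ _)
  · rintro I J ⟨a, b, hab, hn⟩
    exact ⟨a, b, hab, hn 0 le_rfl⟩

/-- Here the unframed vertex has positive parameter. After exchanging the vertices, one reflection
at it turns the framing vector into an ordinary framing at the first vertex, with parameters `(θ₀ +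
2θ₁, -θ₁)`. -/
theorem finite_of_reflect_right (h0 : 0 < Θ.2) (hd : Θ.1 + Θ.2 < 0)
    (hne : ∀ j : ℕ, (Θ.1 + 2 * Θ.2) + j * (Θ.1 + Θ.2) ≠ 0) : (fixedPointsOf Θ n d).Finite := by
  obtain ⟨N, hN⟩ := exists_nat_add_mul_neg (a := Θ.1 + 2 * Θ.2) hd
  have ht := fun I : fixedPointsOf Θ n d => I.2.1.2.exists_isTorus
  choose g h e hv hg hh using ht
  have hst : ∀ I : fixedPointsOf Θ n d,
      I.1.rep.toQRep.toConifold.swap.IsFramedStable ∅ {I.1.rep.v} Θ.swap := fun I =>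
    ((FramedRep.isStable_iff _ _).1 I.2.1.1).swap
  refine finite_of_finiteClasses _ _
    (finiteClasses_of_isFramedStable genericWeights_reflect_swap N 0 (Θ.1 + 2 * Θ.2, -Θ.2)
      (by simpa using h0) (by simp only; linarith) (fun j => by
        have := hne j
        simp only
        rwa [show Θ.1 + 2 * Θ.2 + -Θ.2 = Θ.1 + Θ.2 by ring])
      (max n.toNat ((n - d).toNat + (n - d).toNat) + n.toNat + n.toNat))
    (fun I => FramedObj.ofReflect (e I).swap (genEta_ne_zero 1) one_ne_zero (hv I))
    (fun I => ⟨?_, ?_, ?_⟩) ?_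
  · rw [frame_zero]
    refine (hst I).reflect h0 _ fun U hU => ⟨by simp, hU⟩
  · refine (finrank_rep_le n d I.2).1.trans ?_
    omega
  · refine (Submodule.finrank_quotient_le _).trans ?_
    rw [finrank_prod]
    have := (finrank_rep_le n d I.2).1
    omega
  · rintro I J ⟨a, b, hab, hn⟩
    obtain ⟨f, hf⟩ := exists_equiv_of_reflect ((hst I).xProd_injective h0.le)
      ((hst J).xProd_injective h0.le) a b hab
    exact ⟨a, f, hf.swap, hn 0 le_rfl⟩

/-- This locates a parameter strictly between consecutive walls and supplies the index `m` of the
tilt. -/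
theorem exists_nat_between {a b : ℝ} (ha : a < 0) (hb : 0 < b) (hne : ∀ j : ℕ, a + j * b ≠ 0) :
    ∃ m : ℕ, a + m * b < 0 ∧ 0 < a + (m + 1) * b := by
  classical
  obtain ⟨N, hN⟩ := exists_nat_gt (-a / b)
  have hex : ∃ N : ℕ, 0 < a + N * b := ⟨N, by
    rw [div_lt_iff₀ hb] at hN
    linarith⟩
  have hpos : Nat.find hex ≠ 0 := by
    intro e
    have := Nat.find_spec hex
    rw [e] at this
    simp only [Nat.cast_zero, zero_mul, add_zero] at this
    linarith
  obtain ⟨m, hm⟩ := Nat.exists_eq_succ_of_ne_zero hpos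
  refine ⟨m, lt_of_le_of_ne (not_lt.1 (Nat.find_min hex (by omega))) (hne m), ?_⟩
  have := Nat.find_spec hex
  rw [hm] at this
  exact_mod_cast this

theorem finite_of_tilt_left (h1 : Θ.1 < 0) (hd : 0 < Θ.1 + Θ.2)
    (hne : ∀ j : ℕ, Θ.1 + j * (Θ.1 + Θ.2) ≠ 0) : (fixedPointsOf Θ n d).Finite := by
  obtain ⟨m, hm, hm'⟩ := exists_nat_between h1 hd hne
  have ht := fun I : fixedPointsOf Θ n d => I.2.1.2.exists_isTorus
  choose g h e hv hg hh using ht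
  have hst : ∀ I : fixedPointsOf Θ n d,
      I.1.rep.toQRep.toConifold.IsFramedStable {I.1.rep.v} ∅ Θ := fun I =>
    (FramedRep.isStable_iff _ _).1 I.2.1.1
  have hnil := fun I => isNil_of_isTorus (e I) (hg I) (hh I)
  have hinj := fun I => isTiltInjective (hst I).1 (hnil I) h1 hd hm'
  refine finite_of_finiteClasses _ _
    (finiteClasses_of_isGenerated genericWeights_tilt ((m + 1) * n.toNat))
    (fun I => ofTilt (e I) (genEta_ne_zero 0) (genEta_ne_zero 1) m one_ne_zero (hv I))
    (fun I => ⟨isGenerated_ofTilt_left (hst I) (hnil I) h1 hd hm, ?_⟩) fun I J iso => ?_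
  · exact (finrank_tilt_le _ _).trans (Nat.mul_le_mul_left _ (finrank_rep_le n d I.2).1)
  · exact exists_isHom_of_ofTilt_iso (hinj I) (hinj J) iso

/-- After exchange of the vertices the framing vector is at the second vertex, so the tilt is framed
by its image under one arrow; injectivity of that arrow recovers the vector. -/
theorem finite_of_tilt_right (h1 : Θ.2 < 0) (hd : 0 < Θ.1 + Θ.2)
    (hne : ∀ j : ℕ, Θ.2 + j * (Θ.1 + Θ.2) ≠ 0) : (fixedPointsOf Θ n d).Finite := by
  obtain ⟨m, hm, hm'⟩ := exists_nat_between h1 hd hne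
  rw [add_comm] at hd
  rw [add_comm Θ.1] at hm hm'
  have ht := fun I : fixedPointsOf Θ n d => I.2.1.2.exists_isTorus
  choose g h e hv hg hh using ht
  have hst : ∀ I : fixedPointsOf Θ n d,
      I.1.rep.toQRep.toConifold.swap.IsFramedStable ∅ {I.1.rep.v} Θ.swap := fun I =>
    ((FramedRep.isStable_iff _ _).1 I.2.1.1).swap
  have hnil : ∀ I : fixedPointsOf Θ n d, I.1.rep.toQRep.toConifold.swap.IsNil := fun I =>
    have := isNil_of_isTorus (e I) (hg I) (hh I)
    ⟨fun i l => this.xy l i, fun i l => this.yx l i, this.w, this.z⟩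
  have hinj := fun I => isTiltInjective (Θ := Θ.swap) (hst I).1 (hnil I) h1 hd hm'
  have hv' : ∀ I : fixedPointsOf Θ n d, h I (I.1.rep.toQRep.toConifold.x 1 I.1.rep.v) =
      genXi 1 • I.1.rep.toQRep.toConifold.x 1 I.1.rep.v := fun I => by
    rw [(e I).x, hv, one_smul]
  refine finite_of_finiteClasses _ _
    (finiteClasses_of_isGenerated genericWeights_tilt_swap ((m + 1) * (n - d).toNat))
    (fun I => ofTilt (e I).swap (genXi_ne_zero 0) (genXi_ne_zero 1) m (genXi_ne_zero 1) (hv' I))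
    (fun I => ⟨isGenerated_ofTilt_right (Θ := Θ.swap) (hst I) (hnil I) h1 hd hm, ?_⟩)
    fun I J iso => ?_
  · exact (finrank_tilt_le _ _).trans (Nat.mul_le_mul_left _ (finrank_rep_le n d I.2).2)
  · obtain ⟨a, b, hab, hp⟩ := exists_isHom_of_ofTilt_iso (hinj I) (hinj J) iso
    refine ⟨b, a, hab.swap, eq_of_y_one_eq (hinj J) ?_⟩
    exact (hab.y 1 _).symm.trans hp

theorem finite_of_nonneg (h0 : 0 ≤ Θ.1) (h1 : 0 ≤ Θ.2) : (fixedPointsOf Θ n d).Finite := by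
  refine Set.Subsingleton.finite fun I hI J hJ => ?_
  have key : ∀ I : IsoClass, I ∈ fixedPointsOf Θ n d →
      Subsingleton (Fin I.dim₀ → ℂ) ∧ Subsingleton (Fin I.dim₁ → ℂ) := by
    intro I hI
    have hst := (FramedRep.isStable_iff _ _).1 hI.1.1
    have htop : (⊤ : Sub I.rep.toQRep.toConifold) = ⊥ := by
      by_contra hne
      have := hst.1 _ hne
      rw [Sub.slope_top, totalSlope] at this
      have := mul_nonneg h0 (Nat.cast_nonneg (α := ℝ) (finrank ℂ (Fin I.dim₀ → ℂ)))
      have := mul_nonneg h1 (Nat.cast_nonneg (α := ℝ) (finrank ℂ (Fin I.dim₁ → ℂ)))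
      linarith
    exact ⟨(Submodule.subsingleton_iff ℂ).1 (subsingleton_of_bot_eq_top
      (congrArg Sub.fst htop).symm), (Submodule.subsingleton_iff ℂ).1 (subsingleton_of_bot_eq_top
      (congrArg Sub.snd htop).symm)⟩
  obtain ⟨hI0, hI1⟩ := key I hI
  obtain ⟨hJ0, hJ1⟩ := key J hJ
  exact IsoClass.eq_of_equiv I J (LinearEquiv.ofSubsingleton _ _) (LinearEquiv.ofSubsingleton _ _)
    ⟨fun _ _ => Subsingleton.elim _ _, fun _ _ => Subsingleton.elim _ _,
      fun _ => Subsingleton.elim _ _, fun _ => Subsingleton.elim _ _⟩ (Subsingleton.elim _ _)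

/-- The case distinction is by the signs of `θ₀ + θ₁` and of the parameters. The nonvanishing
conditions of each case are exactly the wall equations; the sign assumptions select the half-line.
-/
theorem finite_fixedPointsOf (hΘ : Θ ∉ walls) : (fixedPointsOf Θ n d).Finite := by
  have w1 : ∀ j : ℕ, Θ.1 < Θ.2 → ((j : ℝ) + 1) * Θ.1 + j * Θ.2 ≠ 0 := fun j hlt e =>
    hΘ (Or.inl ⟨j + 1, by omega, Or.inl ⟨hlt, by push_cast; linarith⟩⟩)
  have w2 : ∀ j : ℕ, Θ.2 < Θ.1 → ((j : ℝ) + 1) * Θ.1 + j * Θ.2 ≠ 0 := fun j hlt e =>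
    hΘ (Or.inl ⟨j + 1, by omega, Or.inr ⟨hlt, by push_cast; linarith⟩⟩)
  have w3 : ∀ j : ℕ, Θ.1 < Θ.2 → (j : ℝ) * Θ.1 + (j + 1) * Θ.2 ≠ 0 := fun j hlt e =>
    hΘ (Or.inr (Or.inl ⟨j, Or.inl ⟨hlt, e⟩⟩))
  have w4 : ∀ j : ℕ, Θ.2 < Θ.1 → (j : ℝ) * Θ.1 + (j + 1) * Θ.2 ≠ 0 := fun j hlt e =>
    hΘ (Or.inr (Or.inl ⟨j, Or.inr ⟨hlt, e⟩⟩))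
  rcases lt_trichotomy (Θ.1 + Θ.2) 0 with hd | hd | hd
  · rcases lt_trichotomy Θ.2 0 with h1 | h1 | h1
    · refine finite_of_reflect_left n d h1 hd fun j e => w2 j ?_ (by linarith)
      have := mul_nonpos_of_nonneg_of_nonpos (Nat.cast_nonneg (α := ℝ) j) hd.le
      linarith
    · exact absurd (by simp [h1]) (w3 0 (by linarith))
    · exact finite_of_reflect_right n d h1 hd fun j e => w3 (j + 1) (by linarith)
        (by push_cast; linarith)
  · by_cases h : Θ.1 = Θ.2
    · exact finite_of_nonneg n d (by linarith) (by linarith)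
    · exact absurd (Or.inr (Or.inr ⟨h, hd⟩)) hΘ
  · rcases lt_or_ge Θ.1 0 with h0 | h0
    · exact finite_of_tilt_left n d h0 hd fun j e => w1 j (by linarith) (by linarith)
    rcases lt_or_ge Θ.2 0 with h1 | h1
    · exact finite_of_tilt_right n d h1 hd fun j e => w4 j (by linarith) (by linarith)
    · exact finite_of_nonneg n d h0 h1

end Finiteness

end

/-! ### Subquotients -/

section

namespace ConifoldRep

variable {P Q P' Q' : Type} [AddCommGroup P] [Module ℂ P] [AddCommGroup Q] [Module ℂ Q]
  [AddCommGroup P'] [Module ℂ P'] [AddCommGroup Q'] [Module ℂ Q']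

section Order

variable {c : ConifoldRep P Q}

theorem Sub.le_refl (A : Sub c) : A ≤ A := ⟨_root_.le_refl _, _root_.le_refl _⟩

theorem Sub.le_trans {A B C : Sub c} (h : A ≤ B) (h' : B ≤ C) : A ≤ C :=
  ⟨h.1.trans h'.1, h.2.trans h'.2⟩

theorem Sub.bot_le (A : Sub c) : ⊥ ≤ A := ⟨_root_.bot_le, _root_.bot_le⟩

theorem Sub.le_top (A : Sub c) : A ≤ ⊤ := ⟨_root_.le_top, _root_.le_top⟩

/-- The total dimension. -/
def Sub.rank (W : Sub c) : ℕ := finrank ℂ W.fst + finrank ℂ W.snd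

variable [FiniteDimensional ℂ P] [FiniteDimensional ℂ Q]

theorem Sub.rank_le (W : Sub c) : W.rank ≤ finrank ℂ P + finrank ℂ Q :=
  add_le_add (Submodule.finrank_le _) (Submodule.finrank_le _)

theorem Sub.eq_of_le_of_rank_le {A B : Sub c} (h : A ≤ B) (hr : B.rank ≤ A.rank) : A = B := by
  have h1 := Submodule.finrank_mono h.1
  have h2 := Submodule.finrank_mono h.2
  simp only [Sub.rank] at hr
  exact Sub.ext (Submodule.eq_of_le_of_finrank_le h.1 (by omega))
    (Submodule.eq_of_le_of_finrank_le h.2 (by omega))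

theorem Sub.rank_lt {A B : Sub c} (h : A ≤ B) (hne : A ≠ B) : A.rank < B.rank := by
  by_contra hr
  exact hne (Sub.eq_of_le_of_rank_le h (not_lt.1 hr))

theorem Sub.exists_minimal (p : Sub c → Prop) (h : ∃ W, p W) :
    ∃ W, p W ∧ ∀ W', p W' → W' ≤ W → W' = W := by
  classical
  obtain ⟨W, hW⟩ := h
  have hex : ∃ n, ∃ W, p W ∧ W.rank = n := ⟨_, W, hW, rfl⟩
  obtain ⟨W, hW, hr⟩ := Nat.find_spec hex
  refine ⟨W, hW, fun W' hW' hle => Sub.eq_of_le_of_rank_le hle ?_⟩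
  rw [hr]
  exact Nat.find_min' hex ⟨W', hW', rfl⟩

theorem Sub.exists_maximal (p : Sub c → Prop) (h : ∃ W, p W) :
    ∃ W, p W ∧ ∀ W', p W' → W ≤ W' → W = W' := by
  classical
  obtain ⟨W, hW⟩ := h
  have hex : ∃ n, ∃ W, p W ∧ finrank ℂ P + finrank ℂ Q - W.rank = n := ⟨_, W, hW, rfl⟩
  obtain ⟨W, hW, hr⟩ := Nat.find_spec hex
  refine ⟨W, hW, fun W' hW' hle => Sub.eq_of_le_of_rank_le hle ?_⟩
  have := Nat.find_min' hex ⟨W', hW', rfl⟩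
  have h1 := W.rank_le
  have h2 := W'.rank_le
  omega

end Order

/-- `p₀`, `p₁` identify the subquotient `B / A` with `c'`. -/
structure IsSubquo {c : ConifoldRep P Q} (A B : Sub c) (c' : ConifoldRep P' Q') (p₀ : P →ₗ[ℂ] P')
    (p₁ : Q →ₗ[ℂ] Q') : Prop where
  le : A ≤ B
  surj₀ : ∀ p', ∃ p ∈ B.fst, p₀ p = p'
  surj₁ : ∀ q', ∃ q ∈ B.snd, p₁ q = q'
  ker₀ : ∀ p ∈ B.fst, p₀ p = 0 ↔ p ∈ A.fst
  ker₁ : ∀ q ∈ B.snd, p₁ q = 0 ↔ q ∈ A.snd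
  x : ∀ i, ∀ p ∈ B.fst, p₁ (c.x i p) = c'.x i (p₀ p)
  y : ∀ i, ∀ q ∈ B.snd, p₀ (c.y i q) = c'.y i (p₁ q)
  z : ∀ p ∈ B.fst, p₀ (c.z p) = c'.z (p₀ p)
  w : ∀ q ∈ B.snd, p₁ (c.w q) = c'.w (p₁ q)

namespace IsSubquo

variable {c : ConifoldRep P Q} {A B : Sub c} {c' : ConifoldRep P' Q'} {p₀ : P →ₗ[ℂ] P'}
    {p₁ : Q →ₗ[ℂ] Q'} (h : IsSubquo A B c' p₀ p₁)

/-- The preimage of a subrepresentation of the subquotient. -/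
@[simps] def pull (h : IsSubquo A B c' p₀ p₁) (W : Sub c') : Sub c where
  fst := B.fst ⊓ W.fst.comap p₀
  snd := B.snd ⊓ W.snd.comap p₁
  x_mem i p hp := ⟨B.x_mem i p hp.1, by
    change p₁ (c.x i p) ∈ W.snd
    rw [h.x i p hp.1]
    exact W.x_mem i _ hp.2⟩
  y_mem i p hp := ⟨B.y_mem i p hp.1, by
    change p₀ (c.y i p) ∈ W.fst
    rw [h.y i p hp.1]
    exact W.y_mem i _ hp.2⟩
  z_mem p hp := ⟨B.z_mem p hp.1, by
    change p₀ (c.z p) ∈ W.fst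
    rw [h.z p hp.1]
    exact W.z_mem _ hp.2⟩
  w_mem p hp := ⟨B.w_mem p hp.1, by
    change p₁ (c.w p) ∈ W.snd
    rw [h.w p hp.1]
    exact W.w_mem _ hp.2⟩

/-- The image of a subrepresentation in the subquotient. -/
@[simps] def push (h : IsSubquo A B c' p₀ p₁) (C : Sub c) (hC : C ≤ B) : Sub c' where
  fst := C.fst.map p₀
  snd := C.snd.map p₁
  x_mem := by
    rintro i _ ⟨p, hp, rfl⟩
    exact ⟨_, C.x_mem i p hp, h.x i p (hC.1 hp)⟩
  y_mem := by
    rintro i _ ⟨p, hp, rfl⟩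
    exact ⟨_, C.y_mem i p hp, h.y i p (hC.2 hp)⟩
  z_mem := by
    rintro _ ⟨p, hp, rfl⟩
    exact ⟨_, C.z_mem p hp, h.z p (hC.1 hp)⟩
  w_mem := by
    rintro _ ⟨p, hp, rfl⟩
    exact ⟨_, C.w_mem p hp, h.w p (hC.2 hp)⟩

include h

theorem le_pull (W : Sub c') : A ≤ h.pull W :=
  ⟨fun p hp => ⟨h.le.1 hp, by
    change p₀ p ∈ W.fst
    rw [(h.ker₀ p (h.le.1 hp)).2 hp]
    exact W.fst.zero_mem⟩,
  fun p hp => ⟨h.le.2 hp, by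
    change p₁ p ∈ W.snd
    rw [(h.ker₁ p (h.le.2 hp)).2 hp]
    exact W.snd.zero_mem⟩⟩

theorem pull_le (W : Sub c') : h.pull W ≤ B := ⟨fun _ hp => hp.1, fun _ hp => hp.1⟩

theorem eq_bot_of_pull_eq {W : Sub c'} (e : h.pull W = A) : W = ⊥ := by
  ext1
  · refine (Submodule.eq_bot_iff _).2 fun p' hp' => ?_
    obtain ⟨p, hp, rfl⟩ := h.surj₀ p'
    rw [h.ker₀ p hp, ← e]
    exact ⟨hp, hp'⟩
  · refine (Submodule.eq_bot_iff _).2 fun p' hp' => ?_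
    obtain ⟨p, hp, rfl⟩ := h.surj₁ p'
    rw [h.ker₁ p hp, ← e]
    exact ⟨hp, hp'⟩

theorem eq_top_of_pull_eq {W : Sub c'} (e : h.pull W = B) : W = ⊤ := by
  ext1
  · refine eq_top_iff.2 fun p' _ => ?_
    obtain ⟨p, hp, rfl⟩ := h.surj₀ p'
    rw [← e] at hp
    exact hp.2
  · refine eq_top_iff.2 fun p' _ => ?_
    obtain ⟨p, hp, rfl⟩ := h.surj₁ p'
    rw [← e] at hp
    exact hp.2

variable [FiniteDimensional ℂ P] [FiniteDimensional ℂ Q]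

theorem finrank_pull (W : Sub c') :
    finrank ℂ (h.pull W).fst = finrank ℂ W.fst + finrank ℂ A.fst ∧
    finrank ℂ (h.pull W).snd = finrank ℂ W.snd + finrank ℂ A.snd := by
  have e1 : (h.pull W).fst.map p₀ = W.fst := by
    ext p'
    constructor
    · rintro ⟨p, hp, rfl⟩
      exact hp.2
    · intro hp'
      obtain ⟨p, hp, rfl⟩ := h.surj₀ p'
      exact ⟨p, ⟨hp, hp'⟩, rfl⟩
  have e2 : (h.pull W).fst ⊓ LinearMap.ker p₀ = A.fst := by
    ext p
    constructor
    · rintro ⟨hp, hp0⟩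
      exact (h.ker₀ p hp.1).1 hp0
    · intro hp
      exact ⟨(h.le_pull W).1 hp, (h.ker₀ p (h.le.1 hp)).2 hp⟩
  have e3 : (h.pull W).snd.map p₁ = W.snd := by
    ext p'
    constructor
    · rintro ⟨p, hp, rfl⟩
      exact hp.2
    · intro hp'
      obtain ⟨p, hp, rfl⟩ := h.surj₁ p'
      exact ⟨p, ⟨hp, hp'⟩, rfl⟩
  have e4 : (h.pull W).snd ⊓ LinearMap.ker p₁ = A.snd := by
    ext p
    constructor
    · rintro ⟨hp, hp0⟩
      exact (h.ker₁ p hp.1).1 hp0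
    · intro hp
      exact ⟨(h.le_pull W).2 hp, (h.ker₁ p (h.le.2 hp)).2 hp⟩
  constructor
  · rw [← finrank_map_add_inf_ker p₀ (h.pull W).fst, e1, e2]
  · rw [← finrank_map_add_inf_ker p₁ (h.pull W).snd, e3, e4]

theorem slope_pull (W : Sub c') (Θ : ℝ × ℝ) : (h.pull W).slope Θ = W.slope Θ + A.slope Θ := by
  obtain ⟨h1, h2⟩ := h.finrank_pull W
  have h1' : (finrank ℂ (h.pull W).fst : ℝ) = finrank ℂ W.fst + finrank ℂ A.fst := by
    exact_mod_cast h1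
  have h2' : (finrank ℂ (h.pull W).snd : ℝ) = finrank ℂ W.snd + finrank ℂ A.snd := by
    exact_mod_cast h2
  rw [Sub.slope, h1', h2', Sub.slope, Sub.slope]
  ring

theorem pull_top : h.pull ⊤ = B := by
  ext p <;> simp

theorem slope_right (Θ : ℝ × ℝ) : B.slope Θ = c'.totalSlope Θ + A.slope Θ := by
  rw [← Sub.slope_top, ← h.slope_pull, h.pull_top]

theorem finrank_right : finrank ℂ B.fst = finrank ℂ P' + finrank ℂ A.fst ∧
    finrank ℂ B.snd = finrank ℂ Q' + finrank ℂ A.snd := by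
  have := h.finrank_pull ⊤
  rw [h.pull_top] at this
  simpa using this

theorem slope_push (C : Sub c) (hC : C ≤ B) (Θ : ℝ × ℝ) :
    (h.push C hC).slope Θ + (C ⊓ A).slope Θ = C.slope Θ := by
  have e1 : C.fst ⊓ LinearMap.ker p₀ = C.fst ⊓ A.fst := by
    ext p
    exact and_congr_right fun hp => h.ker₀ p (hC.1 hp)
  have e2 : C.snd ⊓ LinearMap.ker p₁ = C.snd ⊓ A.snd := by
    ext p
    exact and_congr_right fun hp => h.ker₁ p (hC.2 hp)
  have h1 := finrank_map_add_inf_ker p₀ C.fst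
  have h2 := finrank_map_add_inf_ker p₁ C.snd
  rw [e1] at h1
  rw [e2] at h2
  have h1' : (finrank ℂ (C.fst.map p₀) : ℝ) + finrank ℂ ↥(C.fst ⊓ A.fst) = finrank ℂ C.fst := by
    exact_mod_cast h1
  have h2' : (finrank ℂ (C.snd.map p₁) : ℝ) + finrank ℂ ↥(C.snd ⊓ A.snd) = finrank ℂ C.snd := by
    exact_mod_cast h2
  change Θ.1 * (finrank ℂ (C.fst.map p₀) : ℝ) + Θ.2 * (finrank ℂ (C.snd.map p₁) : ℝ) +
    (Θ.1 * (finrank ℂ ↥(C.fst ⊓ A.fst) : ℝ) + Θ.2 * (finrank ℂ ↥(C.snd ⊓ A.snd) : ℝ)) =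
    Θ.1 * (finrank ℂ C.fst : ℝ) + Θ.2 * (finrank ℂ C.snd : ℝ)
  linear_combination Θ.1 * h1' + Θ.2 * h2'

omit [FiniteDimensional ℂ P] [FiniteDimensional ℂ Q] in
theorem comp {P'' Q'' : Type} [AddCommGroup P''] [Module ℂ P''] [AddCommGroup Q''] [Module ℂ Q'']
    {c'' : ConifoldRep P'' Q''} (e : P' ≃ₗ[ℂ] P'') (e' : Q' ≃ₗ[ℂ] Q'')
    (he : IsHom c' c'' e.toLinearMap e'.toLinearMap) :
    IsSubquo A B c'' (e.toLinearMap ∘ₗ p₀) (e'.toLinearMap ∘ₗ p₁) where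
  le := h.le
  surj₀ p'' := by
    obtain ⟨p, hp, hp'⟩ := h.surj₀ (e.symm p'')
    exact ⟨p, hp, by simp [hp']⟩
  surj₁ p'' := by
    obtain ⟨p, hp, hp'⟩ := h.surj₁ (e'.symm p'')
    exact ⟨p, hp, by simp [hp']⟩
  ker₀ p hp := by
    rw [← h.ker₀ p hp]
    exact e.map_eq_zero_iff
  ker₁ p hp := by
    rw [← h.ker₁ p hp]
    exact e'.map_eq_zero_iff
  x i p hp := by
    rw [LinearMap.comp_apply, h.x i p hp]
    exact he.x i _
  y i p hp := by
    rw [LinearMap.comp_apply, h.y i p hp]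
    exact he.y i _
  z p hp := by
    rw [LinearMap.comp_apply, h.z p hp]
    exact he.z _
  w p hp := by
    rw [LinearMap.comp_apply, h.w p hp]
    exact he.w _

omit [FiniteDimensional ℂ P] [FiniteDimensional ℂ Q] in
theorem isNilpotent (hz : IsNilpotent c.z) (hw : IsNilpotent c.w) :
    IsNilpotent c'.z ∧ IsNilpotent c'.w := by
  obtain ⟨L, hL⟩ := hz
  obtain ⟨M, hM⟩ := hw
  have kz : ∀ L : ℕ, ∀ p ∈ B.fst, (c.z ^ L) p ∈ B.fst ∧ p₀ ((c.z ^ L) p) = (c'.z ^ L) (p₀ p) := by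
    intro L p hp
    induction L with
    | zero => exact ⟨hp, rfl⟩
    | succ L ih =>
      rw [pow_succ', pow_succ', Module.End.mul_apply, Module.End.mul_apply]
      exact ⟨B.z_mem _ ih.1, by rw [h.z _ ih.1, ih.2]⟩
  have kw : ∀ L : ℕ, ∀ p ∈ B.snd, (c.w ^ L) p ∈ B.snd ∧ p₁ ((c.w ^ L) p) = (c'.w ^ L) (p₁ p) := by
    intro L p hp
    induction L with
    | zero => exact ⟨hp, rfl⟩
    | succ L ih =>
      rw [pow_succ', pow_succ', Module.End.mul_apply, Module.End.mul_apply]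
      exact ⟨B.w_mem _ ih.1, by rw [h.w _ ih.1, ih.2]⟩
  refine ⟨⟨L, LinearMap.ext fun p' => ?_⟩, ⟨M, LinearMap.ext fun p' => ?_⟩⟩
  · obtain ⟨p, hp, rfl⟩ := h.surj₀ p'
    rw [← (kz L p hp).2, hL]
    simp
  · obtain ⟨p, hp, rfl⟩ := h.surj₁ p'
    rw [← (kw M p hp).2, hM]
    simp

theorem isStable {Θ : ℝ × ℝ} (hne : A ≠ B) (hAB : A.slope Θ = B.slope Θ)
    (hlt : ∀ C, A ≤ C → C ≤ B → C ≠ A → C ≠ B → C.slope Θ < B.slope Θ) : c'.IsStable Θ where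
  nonzero := by
    have hr := Sub.rank_lt h.le hne
    have := h.finrank_right
    simp only [Sub.rank] at hr
    omega
  total := by
    have := h.slope_right Θ
    linarith
  neg W h1 h2 := by
    have := hlt (h.pull W) (h.le_pull W) (h.pull_le W) (fun e => h1 (h.eq_bot_of_pull_eq e))
      fun e => h2 (h.eq_top_of_pull_eq e)
    rw [h.slope_pull] at this
    linarith

theorem isFramedStable {Θ : ℝ × ℝ} {v : P} (hv : v ∈ B.fst) (hA : A.slope Θ = 0)
    (h0 : ∀ C, A ≤ C → C ≤ B → C ≠ A → C.slope Θ < 0)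
    (hlt : ∀ C, A ≤ C → C ≤ B → C ≠ B → v ∈ C.fst → C.slope Θ < B.slope Θ) :
    c'.IsFramedStable {p₀ v} ∅ Θ := by
  refine ⟨fun W hW => ?_, fun W hvW _ hW => ?_⟩
  · have := h0 (h.pull W) (h.le_pull W) (h.pull_le W) fun e => hW (h.eq_bot_of_pull_eq e)
    rwa [h.slope_pull, hA, add_zero] at this
  · have := hlt (h.pull W) (h.le_pull W) (h.pull_le W) (fun e => hW (h.eq_top_of_pull_eq e))
      ⟨hv, by simpa using hvW⟩
    rwa [h.slope_pull, hA, add_zero, h.slope_right Θ, hA, add_zero] at this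

end IsSubquo

/-- A representation on coordinate spaces, by matrices. -/
@[simps] def toQRep {d₀ d₁ : ℕ} (c : ConifoldRep (Fin d₀ → ℂ) (Fin d₁ → ℂ)) : QRep d₀ d₁ where
  a i := LinearMap.toMatrix' (c.x i)
  b i := LinearMap.toMatrix' (c.y i)
  c := LinearMap.toMatrix' c.z
  d := LinearMap.toMatrix' c.w
  rel_aba i := by
    simp only [← LinearMap.toMatrix'_comp]
    exact congrArg _ (LinearMap.ext fun p => c.xyx i p)
  rel_bab i := by
    simp only [← LinearMap.toMatrix'_comp]
    exact congrArg _ (LinearMap.ext fun p => c.yxy i p)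
  rel_da i := by
    simp only [← LinearMap.toMatrix'_comp]
    exact congrArg _ (LinearMap.ext fun p => c.wx i p)
  rel_cb i := by
    simp only [← LinearMap.toMatrix'_comp]
    exact congrArg _ (LinearMap.ext fun p => c.zy i p)

theorem toConifold_toQRep {d₀ d₁ : ℕ} (c : ConifoldRep (Fin d₀ → ℂ) (Fin d₁ → ℂ)) :
    c.toQRep.toConifold = c := by
  cases c
  simp [QRep.toConifold, toQRep, ← Matrix.toLin'_apply']

theorem exists_projection [FiniteDimensional ℂ P] (A B : Submodule ℂ P) :
    ∃ (n : ℕ) (p : P →ₗ[ℂ] (Fin n → ℂ)) (s : (Fin n → ℂ) →ₗ[ℂ] P),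
      -- The map `p` is defined on all of the space, although only its restriction to `B` is
      -- meaningful.
      (∀ u, s u ∈ B ∧ p (s u) = u) ∧ ∀ b ∈ B, p b = 0 ↔ b ∈ A := by
  let K := B ⧸ A.comap B.subtype
  let e : K ≃ₗ[ℂ] (Fin (finrank ℂ K) → ℂ) := LinearEquiv.ofFinrankEq _ _ (by simp)
  let q : B →ₗ[ℂ] (Fin (finrank ℂ K) → ℂ) := e.toLinearMap ∘ₗ (A.comap B.subtype).mkQ
  obtain ⟨p, hp⟩ := LinearMap.exists_extend q
  have hp' : ∀ b : B, p b = q b := fun b => LinearMap.congr_fun hp b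
  obtain ⟨s, hs⟩ := LinearMap.exists_rightInverse_of_surjective q (by
    rw [LinearMap.range_eq_top]
    exact e.surjective.comp (Submodule.mkQ_surjective _))
  refine ⟨_, p, B.subtype ∘ₗ s, fun u => ⟨(s u).2, ?_⟩, fun b hb => ?_⟩
  · exact (hp' _).trans (LinearMap.congr_fun hs u)
  · rw [hp' ⟨b, hb⟩]
    change e _ = 0 ↔ _
    rw [LinearEquiv.map_eq_zero_iff, Submodule.mkQ_apply, Submodule.Quotient.mk_eq_zero]
    rfl

/-- The arrows of the subquotient are lifted by a linear section, applied, and projected; another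
lift differs by an element of `A`, which the projection kills. -/
theorem exists_isSubquo [FiniteDimensional ℂ P] [FiniteDimensional ℂ Q] {c : ConifoldRep P Q}
    (A B : Sub c) (h : A ≤ B) :
    ∃ (d₀ d₁ : ℕ) (R : QRep d₀ d₁) (p₀ : P →ₗ[ℂ] (Fin d₀ → ℂ)) (p₁ : Q →ₗ[ℂ] (Fin d₁ → ℂ)),
      IsSubquo A B R.toConifold p₀ p₁ := by
  obtain ⟨d₀, p₀, s₀, hs₀, hk₀⟩ := exists_projection A.fst B.fst
  obtain ⟨d₁, p₁, s₁, hs₁, hk₁⟩ := exists_projection A.snd B.snd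
  have e₀ : ∀ p ∈ B.fst, s₀ (p₀ p) - p ∈ A.fst := fun p hp => by
    rw [← hk₀ _ (B.fst.sub_mem (hs₀ _).1 hp), map_sub, (hs₀ _).2, sub_self]
  have e₁ : ∀ p ∈ B.snd, s₁ (p₁ p) - p ∈ A.snd := fun p hp => by
    rw [← hk₁ _ (B.snd.sub_mem (hs₁ _).1 hp), map_sub, (hs₁ _).2, sub_self]
  have hx : ∀ i, ∀ p ∈ B.fst, p₁ (c.x i (s₀ (p₀ p))) = p₁ (c.x i p) := fun i p hp => by
    have := A.x_mem i _ (e₀ p hp)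
    rwa [← hk₁ _ (h.2 this), map_sub, map_sub, sub_eq_zero] at this
  have hy : ∀ i, ∀ p ∈ B.snd, p₀ (c.y i (s₁ (p₁ p))) = p₀ (c.y i p) := fun i p hp => by
    have := A.y_mem i _ (e₁ p hp)
    rwa [← hk₀ _ (h.1 this), map_sub, map_sub, sub_eq_zero] at this
  have hz : ∀ p ∈ B.fst, p₀ (c.z (s₀ (p₀ p))) = p₀ (c.z p) := fun p hp => by
    have := A.z_mem _ (e₀ p hp)
    rwa [← hk₀ _ (h.1 this), map_sub, map_sub, sub_eq_zero] at this
  have hw : ∀ p ∈ B.snd, p₁ (c.w (s₁ (p₁ p))) = p₁ (c.w p) := fun p hp => by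
    have := A.w_mem _ (e₁ p hp)
    rwa [← hk₁ _ (h.2 this), map_sub, map_sub, sub_eq_zero] at this
  have mx : ∀ i u, c.x i (s₀ u) ∈ B.snd := fun i u => B.x_mem i _ (hs₀ u).1
  have my : ∀ i u, c.y i (s₁ u) ∈ B.fst := fun i u => B.y_mem i _ (hs₁ u).1
  have mz : ∀ u, c.z (s₀ u) ∈ B.fst := fun u => B.z_mem _ (hs₀ u).1
  have mw : ∀ u, c.w (s₁ u) ∈ B.snd := fun u => B.w_mem _ (hs₁ u).1
  let c' : ConifoldRep (Fin d₀ → ℂ) (Fin d₁ → ℂ) :=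
    { x := fun i => p₁ ∘ₗ c.x i ∘ₗ s₀
      y := fun i => p₀ ∘ₗ c.y i ∘ₗ s₁
      z := p₀ ∘ₗ c.z ∘ₗ s₀
      w := p₁ ∘ₗ c.w ∘ₗ s₁
      xyx := fun i u => by
        simp only [LinearMap.comp_apply]
        rw [hy i _ (mx 0 u), hy i _ (mx 1 u), hx 1 _ (B.y_mem i _ (mx 0 u)),
          hx 0 _ (B.y_mem i _ (mx 1 u)), c.xyx]
      yxy := fun i u => by
        simp only [LinearMap.comp_apply]
        rw [hx i _ (my 0 u), hx i _ (my 1 u), hy 1 _ (B.x_mem i _ (my 0 u)),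
          hy 0 _ (B.x_mem i _ (my 1 u)), c.yxy]
      wx := fun i u => by
        simp only [LinearMap.comp_apply]
        rw [hw _ (mx i u), hx i _ (mz u), c.wx]
      zy := fun i u => by
        simp only [LinearMap.comp_apply]
        rw [hz _ (my i u), hy i _ (mw u), c.zy] }
  refine ⟨d₀, d₁, c'.toQRep, p₀, p₁, ?_⟩
  rw [toConifold_toQRep]
  exact ⟨h, fun u => ⟨s₀ u, hs₀ u⟩, fun u => ⟨s₁ u, hs₁ u⟩, hk₀, hk₁,
    fun i p hp => (hx i p hp).symm, fun i p hp => (hy i p hp).symm, fun p hp => (hz p hp).symm,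
    fun p hp => (hw p hp).symm⟩

theorem exists_equiv_of_surjective {M M' M'' : Type} [AddCommGroup M] [Module ℂ M]
    [AddCommGroup M'] [Module ℂ M'] [AddCommGroup M''] [Module ℂ M''] (N : Submodule ℂ M)
    (p : M →ₗ[ℂ] M') (p' : M →ₗ[ℂ] M'') (hp : N.map p = ⊤) (hp' : N.map p' = ⊤)
    (h : ∀ n ∈ N, p n = 0 ↔ p' n = 0) : ∃ e : M' ≃ₗ[ℂ] M'', ∀ n ∈ N, e (p n) = p' n := by
  have s1 : Function.Surjective (p.domRestrict N) := by
    rw [← LinearMap.range_eq_top, LinearMap.range_domRestrict, hp]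
  have s2 : Function.Surjective (p'.domRestrict N) := by
    rw [← LinearMap.range_eq_top, LinearMap.range_domRestrict, hp']
  have hk : LinearMap.ker (p.domRestrict N) = LinearMap.ker (p'.domRestrict N) := by
    ext n
    exact h n n.2
  refine ⟨((p.domRestrict N).quotKerEquivOfSurjective s1).symm.trans
    ((Submodule.quotEquivOfEq _ _ hk).trans ((p'.domRestrict N).quotKerEquivOfSurjective s2)),
    fun n hn => ?_⟩
  have : ((p.domRestrict N).quotKerEquivOfSurjective s1).symm (p n) =
      Submodule.Quotient.mk ⟨n, hn⟩ := by
    rw [LinearEquiv.symm_apply_eq]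
    rfl
  simp only [LinearEquiv.trans_apply]
  rw [this]
  rfl

/-! ### Uniqueness of the framed Jordan–Hölder factor. -/

section Semistable

variable [FiniteDimensional ℂ P] [FiniteDimensional ℂ Q] {c : ConifoldRep P Q} {Θ : ℝ × ℝ} {v : P}

/-- Semistability of a representation with a framing vector. -/
def IsFramedSemistable (c : ConifoldRep P Q) (v : P) (Θ : ℝ × ℝ) : Prop :=
  (∀ W : Sub c, W.slope Θ ≤ 0) ∧ ∀ W : Sub c, v ∈ W.fst → W.slope Θ ≤ c.totalSlope Θ

/-- Both factors are quotients of `B ⊓ B'`: this intersection still has total slope and contains the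
framing, so by stability it maps onto each factor. The kernel of either map has slope zero, so its
image in the other stable factor vanishes; hence the two kernels agree. -/
theorem IsSubquo.unique {P'' Q'' : Type} [AddCommGroup P''] [Module ℂ P''] [AddCommGroup Q'']
    [Module ℂ Q''] {c' : ConifoldRep P' Q'} {c'' : ConifoldRep P'' Q''} {A B A' B' : Sub c}
    {p₀ : P →ₗ[ℂ] P'} {p₁ : Q →ₗ[ℂ] Q'} {p₀' : P →ₗ[ℂ] P''} {p₁' : Q →ₗ[ℂ] Q''}
    (hc : c.IsFramedSemistable v Θ) (h : IsSubquo A B c' p₀ p₁) (h' : IsSubquo A' B' c'' p₀' p₁')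
    (hA : A.slope Θ = 0) (hA' : A'.slope Θ = 0) (hB : B.slope Θ = c.totalSlope Θ)
    (hB' : B'.slope Θ = c.totalSlope Θ) (hv : v ∈ B.fst) (hv' : v ∈ B'.fst)
    (hst : c'.IsFramedStable {p₀ v} ∅ Θ) (hst' : c''.IsFramedStable {p₀' v} ∅ Θ) :
    ∃ (e : P' ≃ₗ[ℂ] P'') (e' : Q' ≃ₗ[ℂ] Q''), IsHom c' c'' e.toLinearMap e'.toLinearMap ∧
      e (p₀ v) = p₀' v := by
  have hle : B ⊓ B' ≤ B := ⟨inf_le_left, inf_le_left⟩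
  have hle' : B ⊓ B' ≤ B' := ⟨inf_le_right, inf_le_right⟩
  have hvi : v ∈ (B ⊓ B').fst := ⟨hv, hv'⟩
  -- The slopes of sum and intersection add up to twice the total, while each is at most the total
  -- by semistability.
  have hinf : (B ⊓ B').slope Θ = c.totalSlope Θ := by
    have h1 := Sub.slope_sup_add_inf B B' Θ
    have h2 := hc.2 (B ⊔ B') (Submodule.mem_sup_left hv)
    have h3 := hc.2 (B ⊓ B') hvi
    linarith
  have key : ∀ {R T : Type} [AddCommGroup R] [Module ℂ R] [AddCommGroup T] [Module ℂ T]
      {k : ConifoldRep R T} {C D : Sub c} {q₀ : P →ₗ[ℂ] R} {q₁ : Q →ₗ[ℂ] T}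
      (hk : IsSubquo C D k q₀ q₁) (hle : B ⊓ B' ≤ D), C.slope Θ = 0 →
      D.slope Θ = c.totalSlope Θ → k.IsFramedStable {q₀ v} ∅ Θ →
      hk.push _ hle = ⊤ ∧ (B ⊓ B' ⊓ C).slope Θ = 0 := by
    intro R T _ _ _ _ k C D q₀ q₁ hk hle hC hD hkst
    have h1 := hk.slope_push _ hle Θ
    have h2 := hk.slope_right Θ
    have h3 := hc.1 (B ⊓ B' ⊓ C)
    have hmem : q₀ v ∈ (hk.push _ hle).fst := ⟨v, hvi, rfl⟩
    have htop : hk.push _ hle = ⊤ := by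
      by_contra hne
      have := hkst.2 _ (Set.singleton_subset_iff.2 hmem) (Set.empty_subset _) hne
      linarith
    refine ⟨htop, ?_⟩
    rw [htop, Sub.slope_top] at h1
    linarith
  obtain ⟨k1, k2⟩ := key h hle hA hB hst
  obtain ⟨k1', k2'⟩ := key h' hle' hA' hB' hst'
  have key2 : ∀ {R T : Type} [AddCommGroup R] [Module ℂ R] [AddCommGroup T] [Module ℂ T]
      {k : ConifoldRep R T} {C D E : Sub c} {q₀ : P →ₗ[ℂ] R} {q₁ : Q →ₗ[ℂ] T}
      (hk : IsSubquo C D k q₀ q₁), E ≤ D → E.slope Θ = 0 → k.IsFramedStable {q₀ v} ∅ Θ →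
      E ≤ C := by
    intro R T _ _ _ _ k C D E q₀ q₁ hk hED hE hkst
    have h1 := hk.slope_push _ hED Θ
    have h2 := hc.1 (E ⊓ C)
    have hbot : hk.push _ hED = ⊥ := by
      by_contra hne
      have := hkst.1 _ hne
      linarith
    refine ⟨fun p hp => (hk.ker₀ p (hED.1 hp)).1 ?_, fun p hp => (hk.ker₁ p (hED.2 hp)).1 ?_⟩
    · have : q₀ p ∈ (hk.push _ hED).fst := ⟨p, hp, rfl⟩
      rw [hbot] at this
      exact this
    · have : q₁ p ∈ (hk.push _ hED).snd := ⟨p, hp, rfl⟩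
      rw [hbot] at this
      exact this
  have l1 : B ⊓ B' ⊓ A ≤ A' :=
    key2 h' (Sub.le_trans ⟨inf_le_left, inf_le_left⟩ hle') k2 hst'
  have l2 : B ⊓ B' ⊓ A' ≤ A :=
    key2 h (Sub.le_trans ⟨inf_le_left, inf_le_left⟩ hle) k2' hst
  obtain ⟨e, he⟩ := exists_equiv_of_surjective (B ⊓ B').fst p₀ p₀' (congrArg Sub.fst k1)
    (congrArg Sub.fst k1') fun n hn => by
      rw [h.ker₀ n hn.1, h'.ker₀ n hn.2]
      exact ⟨fun ha => l1.1 ⟨hn, ha⟩, fun ha => l2.1 ⟨hn, ha⟩⟩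
  obtain ⟨e', he'⟩ := exists_equiv_of_surjective (B ⊓ B').snd p₁ p₁' (congrArg Sub.snd k1)
    (congrArg Sub.snd k1') fun n hn => by
      rw [h.ker₁ n hn.1, h'.ker₁ n hn.2]
      exact ⟨fun ha => l1.2 ⟨hn, ha⟩, fun ha => l2.2 ⟨hn, ha⟩⟩
  have sur₀ : ∀ p', ∃ p ∈ (B ⊓ B').fst, p₀ p = p' := fun p' => by
    have : p' ∈ (h.push _ hle).fst := by rw [k1]; trivial
    exact this
  have sur₁ : ∀ p', ∃ p ∈ (B ⊓ B').snd, p₁ p = p' := fun p' => by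
    have : p' ∈ (h.push _ hle).snd := by rw [k1]; trivial
    exact this
  refine ⟨e, e', ⟨fun i p' => ?_, fun i p' => ?_, fun p' => ?_, fun p' => ?_⟩, he v hvi⟩
  · obtain ⟨p, hp, rfl⟩ := sur₀ p'
    change e' _ = c''.x i (e _)
    rw [← h.x i p hp.1, he' _ ((B ⊓ B').x_mem i p hp), he p hp, h'.x i p hp.2]
  · obtain ⟨p, hp, rfl⟩ := sur₁ p'
    change e _ = c''.y i (e' _)
    rw [← h.y i p hp.1, he _ ((B ⊓ B').y_mem i p hp), he' p hp, h'.y i p hp.2]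
  · obtain ⟨p, hp, rfl⟩ := sur₀ p'
    change e _ = c''.z (e _)
    rw [← h.z p hp.1, he _ ((B ⊓ B').z_mem p hp), he p hp, h'.z p hp.2]
  · obtain ⟨p, hp, rfl⟩ := sur₁ p'
    change e' _ = c''.w (e' _)
    rw [← h.w p hp.1, he' _ ((B ⊓ B').w_mem p hp), he' p hp, h'.w p hp.2]

end Semistable

end ConifoldRep

end

/-! ### Semistability and Jordan-Hölder filtrations -/

section

namespace ConifoldRep

variable {P Q P' Q' : Type} [AddCommGroup P] [Module ℂ P] [AddCommGroup Q] [Module ℂ Q]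
  [AddCommGroup P'] [Module ℂ P'] [AddCommGroup Q'] [Module ℂ Q']

/-! ### Strict semistability occurs only on walls. -/

section Walls

variable [FiniteDimensional ℂ P] [FiniteDimensional ℂ Q] {c : ConifoldRep P Q} {Θ : ℝ × ℝ} {v : P}

theorem IsStable.mem_walls (h : c.IsStable Θ) (hΘ : Θ ≠ 0) : Θ ∈ walls := by
  have ht := h.total
  have hn := h.nonzero
  rw [totalSlope] at ht
  by_cases hsum : Θ.1 + Θ.2 = 0
  · refine Or.inr (Or.inr ⟨fun e => hΘ ?_, hsum⟩)
    exact Prod.ext (by simp only [Prod.fst_zero]; linarith) (by simp only [Prod.snd_zero]; linarith)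
  have hn' : (0 : ℝ) < finrank ℂ P + finrank ℂ Q := by exact_mod_cast hn
  have hP : (0 : ℝ) ≤ finrank ℂ P := Nat.cast_nonneg _
  have hQ : (0 : ℝ) ≤ finrank ℂ Q := Nat.cast_nonneg _
  have hne : Θ.1 ≠ Θ.2 := by
    intro e
    rw [e, ← mul_add] at ht
    rcases mul_eq_zero.1 ht with h0 | h0
    · rw [e, h0] at hsum
      exact hsum (add_zero 0)
    · linarith
  have hd : finrank ℂ P = finrank ℂ Q + 1 ∨ finrank ℂ Q = finrank ℂ P + 1 := by
    -- At least one parameter is nonpositive because the slope is zero; if it is the second, the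
    -- vertices are exchanged.
    rcases le_or_gt Θ.1 0 with h0 | h0
    · exact h.finrank_eq_add_one hsum h0
    · refine (h.swap.finrank_eq_add_one (by rwa [add_comm] at hsum) ?_).symm
      by_contra h1
      have h1 : 0 < Θ.2 := not_le.1 h1
      rcases hP.lt_or_eq with h2 | h2
      · have := mul_pos h0 h2
        have := mul_nonneg h1.le hQ
        linarith
      · rw [← h2, zero_add] at hn'
        have := mul_pos h1 hn'
        rw [← h2] at ht
        linarith
  rcases hd with hd | hd
  · refine Or.inl ⟨finrank ℂ P, by omega, ?_⟩
    have e : (finrank ℂ P : ℝ) - 1 = finrank ℂ Q := by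
      rw [hd]
      push_cast
      ring
    rcases lt_or_gt_of_ne hne with hlt | hlt
    · exact Or.inl ⟨hlt, by rw [e]; linarith⟩
    · exact Or.inr ⟨hlt, by rw [e]; linarith⟩
  · refine Or.inr (Or.inl ⟨finrank ℂ P, ?_⟩)
    have e : (finrank ℂ P : ℝ) + 1 = finrank ℂ Q := by
      rw [hd]
      push_cast
      ring
    rcases lt_or_gt_of_ne hne with hlt | hlt
    · exact Or.inl ⟨hlt, by rw [e]; linarith⟩
    · exact Or.inr ⟨hlt, by rw [e]; linarith⟩

/-- A minimal nonzero subrepresentation of slope zero, or the quotient by a maximal proper framed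
one of total slope, is stable of slope zero. -/
theorem IsFramedSemistable.mem_walls (h : c.IsFramedSemistable v Θ) (hΘ : Θ ≠ 0)
    (hex : (∃ W : Sub c, W ≠ ⊥ ∧ W.slope Θ = 0) ∨
      ∃ W : Sub c, W ≠ ⊤ ∧ v ∈ W.fst ∧ W.slope Θ = c.totalSlope Θ) : Θ ∈ walls := by
  rcases hex with hex | hex
  · obtain ⟨W, ⟨hW, hs⟩, hmin⟩ := Sub.exists_minimal _ hex
    obtain ⟨_, _, R, p₀, p₁, hR⟩ := exists_isSubquo ⊥ W W.bot_le
    refine (hR.isStable (Θ := Θ) hW.symm (by rw [hs, Sub.slope_bot]) fun C _ h2 h3 h4 => ?_).mem_walls hΘ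
    rw [hs]
    exact lt_of_le_of_ne (h.1 C) fun e => h4 (hmin C ⟨h3, e⟩ h2)
  · obtain ⟨W, ⟨hW, hv, hs⟩, hmax⟩ := Sub.exists_maximal _ hex
    obtain ⟨_, _, R, p₀, p₁, hR⟩ := exists_isSubquo W ⊤ W.le_top
    refine (hR.isStable (Θ := Θ) hW (by rw [hs, Sub.slope_top]) fun C h1 _ h3 h4 => ?_).mem_walls hΘ
    rw [Sub.slope_top]
    exact lt_of_le_of_ne (h.2 C (h1.1 hv)) fun e => h3 (hmax C ⟨h4, h1.1 hv, e⟩ h1).symm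

theorem exists_convex_max_eq_zero {ι : Type} {D : Set ι} (hD : D.Finite) (F G : ι → ℝ)
    (hG : ∀ i ∈ D, G i < 0) (hF : ∃ i ∈ D, 0 < F i) :
    ∃ τ : ℝ, 0 < τ ∧ τ < 1 ∧ (∀ i ∈ D, (1 - τ) * F i + τ * G i ≤ 0) ∧
      ∃ i ∈ D, (1 - τ) * F i + τ * G i = 0 := by
  classical
  -- The affine function of index `i` with positive initial value vanishes at `F i / (F i - G i)`;
  -- the latest such zero is the required parameter.
  obtain ⟨i₀, hi₀, hmax⟩ := (hD.subset (Set.sep_subset D fun i => 0 < F i)).exists_maximalFor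
    (fun i => F i / (F i - G i)) _ (by obtain ⟨i, hi, hi'⟩ := hF; exact ⟨i, hi, hi'⟩)
  obtain ⟨hi₀, hF₀⟩ := hi₀
  have hG₀ := hG i₀ hi₀
  have hpos : 0 < F i₀ - G i₀ := by linarith
  refine ⟨F i₀ / (F i₀ - G i₀), div_pos hF₀ hpos, (div_lt_one hpos).2 (by linarith),
    fun i hi => ?_, i₀, hi₀, by field_simp; ring⟩
  have h1 : F i₀ / (F i₀ - G i₀) < 1 := (div_lt_one hpos).2 (by linarith)
  have h0 : 0 < F i₀ / (F i₀ - G i₀) := div_pos hF₀ hpos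
  have hGi := hG i hi
  rcases le_or_gt (F i) 0 with h | h
  · nlinarith
  · have hle : F i / (F i - G i) ≤ F i₀ / (F i₀ - G i₀) := by
      rcases le_total (F i₀ / (F i₀ - G i₀)) (F i / (F i - G i)) with h2 | h2
      · exact hmax ⟨hi, h⟩ h2
      · exact h2
    rw [div_le_iff₀ (by linarith)] at hle
    linarith

theorem Sub.slope_convex (W : Sub c) (Θ Θ' : ℝ × ℝ) (τ : ℝ) :
    W.slope ((1 - τ) • Θ + τ • Θ') = (1 - τ) * W.slope Θ + τ * W.slope Θ' := by
  simp only [Sub.slope, Prod.fst_add, Prod.snd_add, Prod.smul_fst, Prod.smul_snd, smul_eq_mul]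
  ring

theorem totalSlope_convex (Θ Θ' : ℝ × ℝ) (τ : ℝ) :
    c.totalSlope ((1 - τ) • Θ + τ • Θ') = (1 - τ) * c.totalSlope Θ + τ * c.totalSlope Θ' := by
  rw [← Sub.slope_top, ← Sub.slope_top, ← Sub.slope_top, Sub.slope_convex]

/-- If semistability failed at `Θ`, then moving from `Θ'` towards `Θ` one would meet, strictly in
between, a parameter where the representation is strictly semistable, hence a wall. The origin must
be avoided by `hne`, as it lies on no wall although all is semistable there. -/
theorem IsFramedStable.isFramedSemistable {u Θ' : ℝ × ℝ} (h : c.IsFramedStable {v} ∅ Θ')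
    (hadj : IsAdjacent Θ u Θ') (hne : ∀ s : ℝ, 0 < s → Θ + s • u ≠ 0) :
    c.IsFramedSemistable v Θ := by
  obtain ⟨ε, hε, rfl, hw⟩ := hadj
  have hseg : ∀ τ : ℝ, (1 - τ) • Θ + τ • (Θ + ε • u) = Θ + (τ * ε) • u := by
    intro τ
    rw [smul_add, smul_smul, ← add_assoc, ← add_smul, sub_add_cancel, one_smul]
  let dim : Sub c → ℕ × ℕ := fun W => (finrank ℂ W.fst, finrank ℂ W.snd)
  let val : ℝ × ℝ → Bool × (ℕ × ℕ) → ℝ := fun Θ i =>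
    Θ.1 * i.2.1 + Θ.2 * i.2.2 - if i.1 then c.totalSlope Θ else 0
  -- All inequalities are linear in `Θ` and depend only on a dimension vector, so the family is
  -- finite. The boolean distinguishes subrepresentations from those containing the framing.
  let D : Set (Bool × (ℕ × ℕ)) := {i | (i.1 = false ∧ ∃ W : Sub c, W ≠ ⊥ ∧ i.2 = dim W) ∨
    (i.1 = true ∧ ∃ W : Sub c, W ≠ ⊤ ∧ v ∈ W.fst ∧ i.2 = dim W)}
  have hDfin : D.Finite := by
    refine ((Set.finite_univ (α := Bool)).prod ((Set.finite_Iic (finrank ℂ P)).prod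
      (Set.finite_Iic (finrank ℂ Q)))).subset ?_
    rintro ⟨b, i⟩ (⟨-, W, -, hi⟩ | ⟨-, W, -, -, hi⟩)
    · simp only at hi
      subst hi
      exact ⟨trivial, Submodule.finrank_le _, Submodule.finrank_le _⟩
    · simp only at hi
      subst hi
      exact ⟨trivial, Submodule.finrank_le _, Submodule.finrank_le _⟩
  have hval0 : ∀ Θ W, val Θ (false, dim W) = W.slope Θ := fun Θ W => by simp [val, dim, Sub.slope]
  have hval1 : ∀ Θ W, val Θ (true, dim W) = W.slope Θ - c.totalSlope Θ := fun Θ W => by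
    simp [val, dim, Sub.slope]
  have mem0 : ∀ W : Sub c, W ≠ ⊥ → (false, dim W) ∈ D := fun W hW => Or.inl ⟨rfl, W, hW, rfl⟩
  have mem1 : ∀ W : Sub c, W ≠ ⊤ → v ∈ W.fst → (true, dim W) ∈ D := fun W hW hv =>
    Or.inr ⟨rfl, W, hW, hv, rfl⟩
  by_contra hc
  have hF : ∃ i ∈ D, 0 < val Θ i := by
    simp only [IsFramedSemistable, not_and_or, not_forall, not_le] at hc
    rcases hc with ⟨W, hW⟩ | ⟨W, hv, hW⟩
    · refine ⟨_, mem0 W ?_, by rwa [hval0]⟩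
      rintro rfl
      rw [Sub.slope_bot] at hW
      exact lt_irrefl _ hW
    · refine ⟨_, mem1 W ?_ hv, by rw [hval1]; linarith⟩
      rintro rfl
      rw [Sub.slope_top] at hW
      exact lt_irrefl _ hW
  have hG : ∀ i ∈ D, val (Θ + ε • u) i < 0 := by
    rintro ⟨b, i⟩ (⟨hb, W, hW, hi⟩ | ⟨hb, W, hW, hv, hi⟩)
    · simp only at hb hi
      rw [hb, hi, hval0]
      exact h.1 W hW
    · simp only at hb hi
      rw [hb, hi, hval1]
      have := h.2 W (by simpa using hv) (Set.empty_subset _) hW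
      linarith
  obtain ⟨τ, h0, h1, hle, i, hi, heq⟩ := exists_convex_max_eq_zero hDfin _ _ hG hF
  have hτ : ∀ i, (1 - τ) * val Θ i + τ * val (Θ + ε • u) i = val (Θ + (τ * ε) • u) i := by
    intro i
    rw [← hseg]
    simp only [val]
    split_ifs
    · rw [totalSlope_convex]
      simp only [Prod.fst_add, Prod.snd_add, Prod.smul_fst, Prod.smul_snd, smul_eq_mul]
      ring
    · simp only [Prod.fst_add, Prod.snd_add, Prod.smul_fst, Prod.smul_snd, smul_eq_mul]
      ring
  have hss : c.IsFramedSemistable v (Θ + (τ * ε) • u) := by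
    refine ⟨fun W => ?_, fun W hv => ?_⟩
    · by_cases hW : W = ⊥
      · rw [hW, Sub.slope_bot]
      · have := hle _ (mem0 W hW)
        rwa [hτ, hval0] at this
    · by_cases hW : W = ⊤
      · rw [hW, Sub.slope_top]
      · have := hle _ (mem1 W hW hv)
        rw [hτ, hval1] at this
        linarith
  refine hw (τ * ε) (mul_pos h0 hε) (by nlinarith) (hss.mem_walls (hne _ (mul_pos h0 hε)) ?_)
  rw [hτ] at heq
  obtain ⟨b, i⟩ := i
  rcases hi with ⟨hb, W, hW, hi⟩ | ⟨hb, W, hW, hv, hi⟩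
  · simp only at hb hi
    rw [hb, hi, hval0] at heq
    exact Or.inl ⟨W, hW, heq⟩
  · simp only at hb hi
    rw [hb, hi, hval1] at heq
    exact Or.inr ⟨W, hW, hv, by linarith⟩

end Walls

/-- Every stable representation of slope zero with nilpotent loops is isomorphic to `S`. -/
def _root_.WallCrossing.QRep.IsUniqueStable {s₀ s₁ : ℕ} (S : QRep s₀ s₁) (Θ : ℝ × ℝ) : Prop :=
  ∀ (d₀ d₁ : ℕ) (R : QRep d₀ d₁), R.toConifold.IsStable Θ → IsNilpotent R.toConifold.z →
    IsNilpotent R.toConifold.w → ∃ (e : (Fin d₀ → ℂ) ≃ₗ[ℂ] (Fin s₀ → ℂ))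
      (e' : (Fin d₁ → ℂ) ≃ₗ[ℂ] (Fin s₁ → ℂ)),
      IsHom R.toConifold S.toConifold e.toLinearMap e'.toLinearMap

/-! ### Existence of Jordan–Hölder filtrations. -/

section Filtration

variable {s₀ s₁ : ℕ} {S : QRep s₀ s₁} [FiniteDimensional ℂ P] [FiniteDimensional ℂ Q]
  {c : ConifoldRep P Q} {Θ : ℝ × ℝ} {v : P}

/-- The subquotient `B / A` is isomorphic to `S`. -/
def Sub.IsLink (S : QRep s₀ s₁) (A B : Sub c) : Prop :=
  ∃ (p₀ : P →ₗ[ℂ] (Fin s₀ → ℂ)) (p₁ : Q →ₗ[ℂ] (Fin s₁ → ℂ)), IsSubquo A B S.toConifold p₀ p₁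

/-- Induction on the rank: a minimal step above `A` of the same slope has a stable quotient with
nilpotent loops, which must be `S`. -/
theorem exists_chain (hS : S.IsUniqueStable Θ) (hz : IsNilpotent c.z) (hw : IsNilpotent c.w) (l : ℕ)
    (A B : Sub c) (hAB : A ≤ B) (hr : B.rank - A.rank ≤ l) (hs : A.slope Θ = B.slope Θ)
    (hle : ∀ C, A ≤ C → C ≤ B → C.slope Θ ≤ B.slope Θ) :
    ∃ (l : ℕ) (W : ℕ → Sub c), W 0 = A ∧ W l = B ∧ ∀ j < l, Sub.IsLink S (W j) (W (j + 1)) := by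
  induction l generalizing A with
  | zero =>
    have e : A = B := Sub.eq_of_le_of_rank_le hAB (by omega)
    exact ⟨0, fun _ => A, rfl, e, by simp⟩
  | succ l ih =>
    by_cases hne : A = B
    · exact ⟨0, fun _ => A, rfl, hne, by simp⟩
    obtain ⟨C, ⟨hAC, hCB, hCA, hCs⟩, hmin⟩ := Sub.exists_minimal
      (fun C : Sub c => A ≤ C ∧ C ≤ B ∧ C ≠ A ∧ C.slope Θ = B.slope Θ)
      ⟨B, hAB, B.le_refl, fun e => hne e.symm, rfl⟩
    have hrank := Sub.rank_lt hAC hCA.symm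
    obtain ⟨n, W, hW0, hWn, hW⟩ := ih C hCB (by omega) hCs fun D h1 h2 =>
      hle D (Sub.le_trans hAC h1) h2
    obtain ⟨_, _, R, p₀, p₁, hR⟩ := exists_isSubquo A C hAC
    have hst : R.toConifold.IsStable Θ := hR.isStable hCA.symm (hs.trans hCs.symm)
      fun D h1 h2 h3 h4 => by
        rw [hCs]
        exact lt_of_le_of_ne (hle D h1 (Sub.le_trans h2 hCB)) fun e =>
          h4 (hmin D ⟨h1, Sub.le_trans h2 hCB, h3, e⟩ h2)
    obtain ⟨hz', hw'⟩ := hR.isNilpotent hz hw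
    obtain ⟨e, e', he⟩ := hS _ _ R hst hz' hw'
    have hlink : Sub.IsLink S A C := ⟨_, _, hR.comp e e' he⟩
    refine ⟨n + 1, fun j => Nat.casesOn j A W, rfl, hWn, fun j hj => ?_⟩
    rcases j with _ | j
    · change Sub.IsLink S A (W 0)
      rwa [hW0]
    · exact hW j (by omega)

/-- With `A` maximal of slope zero and `B` minimal above `A` containing the framing with total
slope, `B / A` is the framed stable factor. The parts below `A` and above `B` are filtered by copies
of `S`. -/
theorem exists_filtration (hS : S.IsUniqueStable Θ) (hz : IsNilpotent c.z) (hw : IsNilpotent c.w)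
    (hc : c.IsFramedSemistable v Θ) :
    ∃ (W : ℕ → Sub c) (r j₀ : ℕ), j₀ ≤ r ∧ W 0 = ⊥ ∧ W (r + 1) = ⊤ ∧ v ∈ (W (j₀ + 1)).fst ∧
      W j₀ ≤ W (j₀ + 1) ∧ (W j₀).slope Θ = 0 ∧ (W (j₀ + 1)).slope Θ = c.totalSlope Θ ∧
      (∀ C, W j₀ ≤ C → C ≤ W (j₀ + 1) → C ≠ W j₀ → C.slope Θ < 0) ∧
      (∀ C, W j₀ ≤ C → C ≤ W (j₀ + 1) → C ≠ W (j₀ + 1) → v ∈ C.fst →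
        C.slope Θ < (W (j₀ + 1)).slope Θ) ∧
      ∀ j ≤ r, j ≠ j₀ → Sub.IsLink S (W j) (W (j + 1)) := by
  obtain ⟨A, hA, hAmax⟩ := Sub.exists_maximal (fun A : Sub c => A.slope Θ = 0)
    ⟨⊥, Sub.slope_bot Θ⟩
  obtain ⟨B, ⟨hAB, hv, hB⟩, hBmin⟩ := Sub.exists_minimal
    (fun B : Sub c => A ≤ B ∧ v ∈ B.fst ∧ B.slope Θ = c.totalSlope Θ)
    ⟨⊤, A.le_top, trivial, Sub.slope_top c Θ⟩
  obtain ⟨l₁, W₁, h₁0, h₁l, h₁⟩ := exists_chain hS hz hw _ ⊥ A A.bot_le le_rfl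
    (by rw [hA, Sub.slope_bot]) fun C _ _ => by rw [hA]; exact hc.1 C
  obtain ⟨l₂, W₂, h₂0, h₂l, h₂⟩ := exists_chain hS hz hw _ B ⊤ B.le_top le_rfl
    (by rw [hB, Sub.slope_top]) fun C hC _ => by rw [Sub.slope_top]; exact hc.2 C (hC.1 hv)
  have e0 : ∀ j ≤ l₁, (if j ≤ l₁ then W₁ j else W₂ (j - l₁ - 1)) = W₁ j := fun j hj => if_pos hj
  have e1 : ∀ j, (if l₁ + j + 1 ≤ l₁ then W₁ (l₁ + j + 1) else W₂ (l₁ + j + 1 - l₁ - 1)) = W₂ j :=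
    fun j => by rw [if_neg (by omega), show l₁ + j + 1 - l₁ - 1 = j by omega]
  have e10 : (if l₁ + 1 ≤ l₁ then W₁ (l₁ + 1) else W₂ (l₁ + 1 - l₁ - 1)) = B := (e1 0).trans h₂0
  have e00 : (if l₁ ≤ l₁ then W₁ l₁ else W₂ (l₁ - l₁ - 1)) = A := (e0 l₁ le_rfl).trans h₁l
  refine ⟨fun j => if j ≤ l₁ then W₁ j else W₂ (j - l₁ - 1), l₁ + l₂, l₁, by omega, ?_, ?_, ?_⟩
  · exact (e0 0 (Nat.zero_le _)).trans h₁0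
  · exact (e1 l₂).trans h₂l
  simp only [e10, e00]
  refine ⟨hv, hAB, hA, hB, fun C h1 _ h3 => ?_, fun C h1 h2 h3 h4 => ?_, fun j hj hne => ?_⟩
  · exact lt_of_le_of_ne (hc.1 C) fun e => h3 (hAmax C e h1).symm
  · rw [hB]
    exact lt_of_le_of_ne (hc.2 C h4) fun e => h3 (hBmin C ⟨h1, h4, e⟩ h2)
  · rcases Nat.lt_or_ge j l₁ with h | h
    · rw [e0 j h.le, e0 (j + 1) h]
      exact h₁ j h
    · obtain ⟨i, rfl⟩ : ∃ i, j = l₁ + i + 1 := ⟨j - l₁ - 1, by omega⟩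
      rw [e1, show l₁ + i + 1 + 1 = l₁ + (i + 1) + 1 by ring, e1]
      exact h₂ i (by omega)

end Filtration

/-- `c₂` is obtained from `c` by scaling the arrows. -/
structure IsScaled (c c₂ : ConifoldRep P Q) (α β : Fin 2 → ℂ) (γ : ℂ) : Prop where
  x : ∀ i p, c₂.x i p = α i • c.x i p
  y : ∀ i q, c₂.y i q = β i • c.y i q
  z : ∀ p, c₂.z p = γ • c.z p
  w : ∀ q, c₂.w q = γ • c.w q

/-! ### Scaling the arrows. -/

section Scaled

variable {c c₂ : ConifoldRep P Q} {c' c₂' : ConifoldRep P' Q'} {α β : Fin 2 → ℂ} {γ : ℂ}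

theorem IsScaled.symm (h : IsScaled c c₂ α β γ) (hα : ∀ i, α i ≠ 0) (hβ : ∀ i, β i ≠ 0)
    (hγ : γ ≠ 0) : IsScaled c₂ c (fun i => (α i)⁻¹) (fun i => (β i)⁻¹) γ⁻¹ where
  x i p := by rw [h.x, inv_smul_smul₀ (hα i)]
  y i p := by rw [h.y, inv_smul_smul₀ (hβ i)]
  z p := by rw [h.z, inv_smul_smul₀ hγ]
  w p := by rw [h.w, inv_smul_smul₀ hγ]

/-- A subrepresentation, for the scaled arrows. -/
@[simps] def Sub.scale (h : IsScaled c c₂ α β γ) (W : Sub c) : Sub c₂ where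
  fst := W.fst
  snd := W.snd
  x_mem i p hp := by rw [h.x]; exact W.snd.smul_mem _ (W.x_mem i p hp)
  y_mem i p hp := by rw [h.y]; exact W.fst.smul_mem _ (W.y_mem i p hp)
  z_mem p hp := by rw [h.z]; exact W.fst.smul_mem _ (W.z_mem p hp)
  w_mem p hp := by rw [h.w]; exact W.snd.smul_mem _ (W.w_mem p hp)

theorem IsFramedStable.scale {FP : Set P} {FQ : Set Q} {Θ : ℝ × ℝ} (hc : c.IsFramedStable FP FQ Θ)
    (h : IsScaled c₂ c α β γ) : c₂.IsFramedStable FP FQ Θ := by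
  have eb : ∀ W : Sub c₂, W.scale h = ⊥ → W = ⊥ := fun W e => by
    have h1 : (W.scale h).fst = ⊥ := congrArg Sub.fst e
    have h2 : (W.scale h).snd = ⊥ := congrArg Sub.snd e
    exact Sub.ext h1 h2
  have et : ∀ W : Sub c₂, W.scale h = ⊤ → W = ⊤ := fun W e => by
    have h1 : (W.scale h).fst = ⊤ := congrArg Sub.fst e
    have h2 : (W.scale h).snd = ⊤ := congrArg Sub.snd e
    exact Sub.ext h1 h2
  exact ⟨fun W hW => hc.1 (W.scale h) fun e => hW (eb W e),
    fun W h1 h2 hW => hc.2 (W.scale h) h1 h2 fun e => hW (et W e)⟩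

theorem IsSubquo.scale {A B : Sub c} {p₀ : P →ₗ[ℂ] P'} {p₁ : Q →ₗ[ℂ] Q'}
    (hs : IsSubquo A B c' p₀ p₁) (h : IsScaled c c₂ α β γ) (h' : IsScaled c' c₂' α β γ) :
    IsSubquo (A.scale h) (B.scale h) c₂' p₀ p₁ where
  le := hs.le
  surj₀ := hs.surj₀
  surj₁ := hs.surj₁
  ker₀ := hs.ker₀
  ker₁ := hs.ker₁
  x i p hp := by rw [h.x, h'.x, map_smul, hs.x i p hp]
  y i p hp := by rw [h.y, h'.y, map_smul, hs.y i p hp]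
  z p hp := by rw [h.z, h'.z, map_smul, hs.z p hp]
  w p hp := by rw [h.w, h'.w, map_smul, hs.w p hp]

end Scaled

theorem IsSubquo.map {P'' Q'' : Type} [AddCommGroup P''] [Module ℂ P''] [AddCommGroup Q'']
    [Module ℂ Q''] {c : ConifoldRep P Q} {c' : ConifoldRep P' Q'} {c'' : ConifoldRep P'' Q''}
    {A B : Sub c} {p₀ : P →ₗ[ℂ] P'} {p₁ : Q →ₗ[ℂ] Q'} (hs : IsSubquo A B c' p₀ p₁)
    (f : P ≃ₗ[ℂ] P'') (g : Q ≃ₗ[ℂ] Q'') (h : IsHom c c'' f.toLinearMap g.toLinearMap) :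
    IsSubquo (h.map A) (h.map B) c' (p₀ ∘ₗ f.symm.toLinearMap) (p₁ ∘ₗ g.symm.toLinearMap) := by
  have hx : ∀ i p, g (c.x i p) = c''.x i (f p) := h.x
  have hy : ∀ i p, f (c.y i p) = c''.y i (g p) := h.y
  have hz : ∀ p, f (c.z p) = c''.z (f p) := h.z
  have hw : ∀ p, g (c.w p) = c''.w (g p) := h.w
  constructor
  · exact ⟨Submodule.map_mono hs.le.1, Submodule.map_mono hs.le.2⟩
  · intro p'
    obtain ⟨p, hp, rfl⟩ := hs.surj₀ p'
    exact ⟨f p, ⟨p, hp, rfl⟩, by simp⟩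
  · intro p'
    obtain ⟨p, hp, rfl⟩ := hs.surj₁ p'
    exact ⟨g p, ⟨p, hp, rfl⟩, by simp⟩
  · rintro _ ⟨p, hp, rfl⟩
    simpa using hs.ker₀ p hp
  · rintro _ ⟨p, hp, rfl⟩
    simpa using hs.ker₁ p hp
  · rintro i _ ⟨p, hp, rfl⟩
    change p₁ (g.symm (c''.x i (f p))) = c'.x i (p₀ (f.symm (f p)))
    rw [← hx, g.symm_apply_apply, f.symm_apply_apply, hs.x i p hp]
  · rintro i _ ⟨p, hp, rfl⟩
    change p₀ (f.symm (c''.y i (g p))) = c'.y i (p₁ (g.symm (g p)))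
    rw [← hy, g.symm_apply_apply, f.symm_apply_apply, hs.y i p hp]
  · rintro _ ⟨p, hp, rfl⟩
    change p₀ (f.symm (c''.z (f p))) = c'.z (p₀ (f.symm (f p)))
    rw [← hz, f.symm_apply_apply, f.symm_apply_apply, hs.z p hp]
  · rintro _ ⟨p, hp, rfl⟩
    change p₁ (g.symm (c''.w (g p))) = c'.w (p₁ (g.symm (g p)))
    rw [← hw, g.symm_apply_apply, g.symm_apply_apply, hs.w p hp]

theorem IsHom.slope_map_equiv {c : ConifoldRep P Q} {c' : ConifoldRep P' Q'} (f : P ≃ₗ[ℂ] P')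
    (g : Q ≃ₗ[ℂ] Q') (h : IsHom c c' f.toLinearMap g.toLinearMap) (W : Sub c) (Θ : ℝ × ℝ) :
    (h.map W).slope Θ = W.slope Θ := by
  have h1 : finrank ℂ (h.map W).fst = finrank ℂ W.fst := LinearEquiv.finrank_map_eq f W.fst
  have h2 : finrank ℂ (h.map W).snd = finrank ℂ W.snd := LinearEquiv.finrank_map_eq g W.snd
  rw [Sub.slope, Sub.slope, h1, h2]

end ConifoldRep

end

/-! ### Fibres over the wall -/

section

open ConifoldRep


variable {d₀ d₁ e₀ e₁ s₀ s₁ : ℕ}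

theorem IsSubquotientMap.isSubquo {V : QRep d₀ d₁} {W W' : SubRep V} {R : QRep e₀ e₁}
    {p₀ : W'.W₀ →ₗ[ℂ] (Fin e₀ → ℂ)} {p₁ : W'.W₁ →ₗ[ℂ] (Fin e₁ → ℂ)}
    (h : IsSubquotientMap W W' R p₀ p₁) :
    ∃ (q₀ : (Fin d₀ → ℂ) →ₗ[ℂ] (Fin e₀ → ℂ)) (q₁ : (Fin d₁ → ℂ) →ₗ[ℂ] (Fin e₁ → ℂ)),
      (∀ x, q₀ x.1 = p₀ x) ∧ IsSubquo W.toSub W'.toSub R.toConifold q₀ q₁ := by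
  obtain ⟨q₀, hq₀⟩ := LinearMap.exists_extend p₀
  obtain ⟨q₁, hq₁⟩ := LinearMap.exists_extend p₁
  have h₀ : ∀ x, q₀ x.1 = p₀ x := fun x => LinearMap.congr_fun hq₀ x
  have h₁ : ∀ x, q₁ x.1 = p₁ x := fun x => LinearMap.congr_fun hq₁ x
  refine ⟨q₀, q₁, h₀, ⟨h.le₀, h.le₁⟩, fun u => ?_, fun u => ?_, fun x hx => ?_, fun x hx => ?_,
    fun i x hx => ?_, fun i x hx => ?_, fun x hx => ?_, fun x hx => ?_⟩
  · obtain ⟨x, rfl⟩ := h.surj₀ u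
    exact ⟨x.1, x.2, h₀ x⟩
  · obtain ⟨x, rfl⟩ := h.surj₁ u
    exact ⟨x.1, x.2, h₁ x⟩
  · exact (h₀ ⟨x, hx⟩) ▸ h.ker₀ ⟨x, hx⟩
  · exact (h₁ ⟨x, hx⟩) ▸ h.ker₁ ⟨x, hx⟩
  · have := h.comm_a i ⟨x, hx⟩
    rw [← h₀, ← h₁] at this
    exact this
  · have := h.comm_b i ⟨x, hx⟩
    rw [← h₀, ← h₁] at this
    exact this
  · have := h.comm_c ⟨x, hx⟩
    rw [← h₀, ← h₀] at this
    exact this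
  · have := h.comm_d ⟨x, hx⟩
    rw [← h₁, ← h₁] at this
    exact this

theorem ConifoldRep.IsSubquo.isSubquotientMap {V : QRep d₀ d₁} {A B : Sub V.toConifold}
    {R : QRep e₀ e₁} {p₀ : (Fin d₀ → ℂ) →ₗ[ℂ] (Fin e₀ → ℂ)}
    {p₁ : (Fin d₁ → ℂ) →ₗ[ℂ] (Fin e₁ → ℂ)} (h : IsSubquo A B R.toConifold p₀ p₁) :
    IsSubquotientMap (SubRep.ofSub A) (SubRep.ofSub B) R (p₀.domRestrict B.fst)
      (p₁.domRestrict B.snd) where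
  le₀ := h.le.1
  le₁ := h.le.2
  surj₀ u := by
    obtain ⟨x, hx, hu⟩ := h.surj₀ u
    exact ⟨⟨x, hx⟩, hu⟩
  surj₁ u := by
    obtain ⟨x, hx, hu⟩ := h.surj₁ u
    exact ⟨⟨x, hx⟩, hu⟩
  ker₀ x := h.ker₀ x.1 x.2
  ker₁ x := h.ker₁ x.1 x.2
  comm_a i x := h.x i x.1 x.2
  comm_b i x := h.y i x.1 x.2
  comm_c x := h.z x.1 x.2
  comm_d x := h.w x.1 x.2

/-- The framed representation `U` is a subquotient of `V` by subrepresentations with the slopes of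
a Jordan-Hölder filtration. -/
def FramedRep.IsFactor (V : FramedRep d₀ d₁) (U : FramedRep e₀ e₁) (Θ : ℝ × ℝ) : Prop :=
  ∃ (A B : Sub V.toQRep.toConifold) (p₀ : (Fin d₀ → ℂ) →ₗ[ℂ] (Fin e₀ → ℂ))
    (p₁ : (Fin d₁ → ℂ) →ₗ[ℂ] (Fin e₁ → ℂ)), IsSubquo A B U.toQRep.toConifold p₀ p₁ ∧
    A.slope Θ = 0 ∧ B.slope Θ = V.toQRep.toConifold.totalSlope Θ ∧ V.v ∈ B.fst ∧ p₀ V.v = U.v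

theorem FramedRep.IsFactor.equivalent {V : FramedRep d₀ d₁} {U : FramedRep e₀ e₁}
    {U' : FramedRep s₀ s₁} {Θ : ℝ × ℝ} (hV : V.toQRep.toConifold.IsFramedSemistable V.v Θ)
    (h : V.IsFactor U Θ) (h' : V.IsFactor U' Θ) (hU : U.IsStable Θ) (hU' : U'.IsStable Θ) :
    U.Equivalent U' := by
  obtain ⟨A, B, p₀, p₁, hs, hA, hB, hv, hp⟩ := h
  obtain ⟨A', B', p₀', p₁', hs', hA', hB', hv', hp'⟩ := h'
  rw [FramedRep.isStable_iff] at hU hU'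
  rw [← hp] at hU
  rw [← hp'] at hU'
  obtain ⟨e, e', he, hev⟩ := hs.unique hV hs' hA hA' hB hB' hv hv' hU hU'
  exact ⟨e, e', he, by rw [← hp, ← hp', hev]⟩

theorem FramedRep.isScaled_act (V : FramedRep d₀ d₁) (t : Fin 4 → ℂˣ) :
    IsScaled V.toQRep.toConifold (V.act t).toQRep.toConifold ![(t 1 : ℂ), t 2] ![1, (t 0 : ℂ)]
      (t 3) where
  x i p := by
    simp only [FramedRep.act, QRep.toConifold, mulVecLin_apply, Matrix.smul_mulVec]
    fin_cases i <;> rfl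
  y i p := by
    simp only [FramedRep.act, QRep.toConifold, mulVecLin_apply, Matrix.smul_mulVec]
    fin_cases i <;> rfl
  z p := by
    simp only [FramedRep.act, QRep.toConifold, mulVecLin_apply, Matrix.smul_mulVec]
  w p := by
    simp only [FramedRep.act, QRep.toConifold, mulVecLin_apply, Matrix.smul_mulVec]

theorem FramedRep.IsStable.act {V : FramedRep d₀ d₁} {Θ : ℝ × ℝ} (h : V.IsStable Θ)
    (t : Fin 4 → ℂˣ) : (V.act t).IsStable Θ := by
  rw [FramedRep.isStable_iff] at h ⊢
  refine h.scale ((V.isScaled_act t).symm (fun i => ?_) (fun i => ?_) (t 3).ne_zero)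
  · fin_cases i <;> simp
  · fin_cases i <;> simp

/-- A torus element turns the factor `U` of `V` into the factor `U.act t` of `V.act t`, which is
isomorphic to `V`; uniqueness of the framed factor gives `U.act t ≅ U`. -/
theorem FramedRep.IsFactor.isTorusFixed {V : FramedRep d₀ d₁} {U : FramedRep e₀ e₁} {Θ : ℝ × ℝ}
    (hV : V.toQRep.toConifold.IsFramedSemistable V.v Θ) (ht : V.IsTorusFixed)
    (h : V.IsFactor U Θ) (hU : U.IsStable Θ) : U.IsTorusFixed := by
  intro t hT
  obtain ⟨f, g, hfg, hfv⟩ := (FramedRep.iso_iff _ _).1 (ht t hT)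
  rw [FramedRep.iso_iff]
  refine FramedRep.IsFactor.equivalent hV ?_ h (hU.act t) hU
  obtain ⟨A, B, p₀, p₁, hs, hA, hB, hv, hp⟩ := h
  refine ⟨_, _, _, _, (hs.scale (V.isScaled_act t) (U.isScaled_act t)).map f g hfg, ?_, ?_, ?_, ?_⟩
  · rw [hfg.slope_map_equiv]
    exact hA
  · rw [hfg.slope_map_equiv]
    exact hB
  · exact ⟨V.v, hv, hfv⟩
  · have : f.symm V.v = V.v := by
      rw [LinearEquiv.symm_apply_eq]
      exact hfv.symm
    change p₀ (f.symm V.v) = U.v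
    rw [this, hp]

/-- Each copy of `S` adds its dimension vector. As `S` has slope zero, the two members of the
filtration around the framed factor have slopes zero and the total slope. -/
theorem FramedRep.IsSEquivalent.dimensions {V : FramedRep d₀ d₁} {U : FramedRep e₀ e₁}
    {S : QRep s₀ s₁} {r : ℕ} (h : V.IsSEquivalent U S r) {Θ : ℝ × ℝ}
    (hS : S.toConifold.totalSlope Θ = 0) :
    V.IsFactor U Θ ∧ d₀ = e₀ + r * s₀ ∧ d₁ = e₁ + r * s₁ := by
  obtain ⟨W, j₀, hj, h0, hr, ⟨hv, p₀, p₁, hp, hpv⟩, hl⟩ := h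
  obtain ⟨q₀, q₁, hq, hsq⟩ := hp.isSubquo
  have hU := hsq.finrank_right
  simp only [finrank_fin_fun] at hU
  have hlink : ∀ j ≤ r, j ≠ j₀ →
      finrank ℂ (W (j + 1)).W₀ = s₀ + finrank ℂ (W j).W₀ ∧
      finrank ℂ (W (j + 1)).W₁ = s₁ + finrank ℂ (W j).W₁ := fun j hjr hne => by
    obtain ⟨p₀, p₁, hp⟩ := hl j hjr hne
    obtain ⟨q₀, q₁, -, hsq⟩ := hp.isSubquo
    have := hsq.finrank_right
    simp only [finrank_fin_fun] at this
    exact this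
  have h00 : finrank ℂ (W 0).W₀ = 0 ∧ finrank ℂ (W 0).W₁ = 0 := by
    rw [h0.1, h0.2]
    simp
  have hlow : ∀ j ≤ j₀, finrank ℂ (W j).W₀ = j * s₀ ∧ finrank ℂ (W j).W₁ = j * s₁ := by
    intro j
    induction j with
    | zero => simpa using h00
    | succ j ih =>
      intro hj'
      obtain ⟨i0, i1⟩ := ih (by omega)
      obtain ⟨l0, l1⟩ := hlink j (by omega) (by omega)
      rw [l0, l1, i0, i1]
      constructor <;> ring
  have hmid : finrank ℂ (W (j₀ + 1)).W₀ = e₀ + j₀ * s₀ ∧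
      finrank ℂ (W (j₀ + 1)).W₁ = e₁ + j₀ * s₁ := by
    rw [← (hlow j₀ le_rfl).1, ← (hlow j₀ le_rfl).2]
    exact hU
  have hhigh : ∀ j, j₀ ≤ j → j ≤ r → finrank ℂ (W (j + 1)).W₀ = e₀ + j * s₀ ∧
      finrank ℂ (W (j + 1)).W₁ = e₁ + j * s₁ := by
    intro j hj'
    induction j, hj' using Nat.le_induction with
    | base => exact fun _ => hmid
    | succ j hj' ih =>
      intro hjr
      obtain ⟨i0, i1⟩ := ih (by omega)
      obtain ⟨l0, l1⟩ := hlink (j + 1) (by omega) (by omega)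
      rw [l0, l1, i0, i1]
      constructor <;> ring
  obtain ⟨t0, t1⟩ := hhigh r hj le_rfl
  rw [hr.1, finrank_top, finrank_fin_fun] at t0
  rw [hr.2, finrank_top, finrank_fin_fun] at t1
  simp only [totalSlope, finrank_fin_fun] at hS
  refine ⟨⟨_, _, q₀, q₁, hsq, ?_, ?_, hv, (hq ⟨V.v, hv⟩).trans hpv⟩, t0, t1⟩
  · change Θ.1 * (finrank ℂ (W j₀).W₀ : ℝ) + Θ.2 * (finrank ℂ (W j₀).W₁ : ℝ) = 0
    rw [(hlow j₀ le_rfl).1, (hlow j₀ le_rfl).2]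
    push_cast
    linear_combination (j₀ : ℝ) * hS
  · simp only [totalSlope, finrank_fin_fun]
    change Θ.1 * (finrank ℂ (W (j₀ + 1)).W₀ : ℝ) + Θ.2 * (finrank ℂ (W (j₀ + 1)).W₁ : ℝ) = _
    rw [hmid.1, hmid.2, t0, t1]
    push_cast
    linear_combination (j₀ - r : ℝ) * hS

theorem exists_isoClass (U : FramedRep d₀ d₁) : ∃ I : IsoClass, U.Equivalent I.rep := by
  let I : IsoClass := ⟨(d₀, d₁), Quotient.mk (FramedRep.setoid d₀ d₁) U⟩
  have h : FramedRep.Iso I.rep U := Quotient.exact (Quotient.out_eq I.2)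
  exact ⟨I, (FramedRep.iso_iff _ _).1 (FramedRep.Iso.equivalence.symm h)⟩

variable {Θ u Θ' : ℝ × ℝ} {S : QRep s₀ s₁}

theorem isFramedSemistable_of_mem (hadj : IsAdjacent Θ u Θ') (hne : ∀ s : ℝ, 0 < s → Θ + s • u ≠ 0)
    {I : IsoClass} (hI : I ∈ fixedPoints Θ') :
    I.rep.toQRep.toConifold.IsFramedSemistable I.rep.v Θ :=
  ((FramedRep.isStable_iff _ _).1 hI.1).isFramedSemistable hadj hne

theorem exists_mem_fibre (hS : S.IsUniqueStable Θ) (hadj : IsAdjacent Θ u Θ')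
    (hne : ∀ s : ℝ, 0 < s → Θ + s • u ≠ 0) {I : IsoClass} (hI : I ∈ fixedPoints Θ') :
    ∃ I₀ ∈ fixedPoints Θ, ∃ r, I ∈ fibre Θ' I₀.rep S r := by
  have hss := isFramedSemistable_of_mem hadj hne hI
  obtain ⟨g, h, htor, -, hg, hh⟩ := hI.2.exists_isTorus
  have hnil := isNil_of_isTorus htor hg hh
  obtain ⟨W, r, j₀, hj, h0, hr, hv, hle, hA, hB, hst0, hst1, hlink⟩ :=
    exists_filtration hS hnil.z hnil.w hss
  obtain ⟨d₀, d₁, R, p₀, p₁, hR⟩ := exists_isSubquo _ _ hle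
  obtain ⟨I₀, e, e', he, hev⟩ := exists_isoClass (⟨R, p₀ I.rep.v⟩ : FramedRep d₀ d₁)
  have hq := hR.comp e e' he
  have hqv : (e.toLinearMap ∘ₗ p₀) I.rep.v = I₀.rep.v := hev
  have hfac : I.rep.IsFactor I₀.rep Θ := ⟨_, _, _, _, hq, hA, hB, hv, hqv⟩
  have hstab : I₀.rep.IsStable Θ := by
    rw [FramedRep.isStable_iff, ← hqv]
    exact hq.isFramedStable hv hA hst0 hst1
  refine ⟨I₀, ⟨hstab, hfac.isTorusFixed hss hI.2 hstab⟩, r, hI, fun j => SubRep.ofSub (W j), j₀, hj,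
    (SubRep.isZero_iff _).2 h0, (SubRep.isAll_iff _).2 hr,
    ⟨hv, _, _, hq.isSubquotientMap, hqv⟩, fun j hjr hne => ?_⟩
  obtain ⟨q₀, q₁, hq⟩ := hlink j hjr hne
  exact ⟨_, _, hq.isSubquotientMap⟩

/-- Together with `exists_mem_fibre` this makes the fibres over the various framed factors a
partition of the fixed points. -/
theorem fibre_unique (hS : S.toConifold.totalSlope Θ = 0) (hadj : IsAdjacent Θ u Θ')
    (hne : ∀ s : ℝ, 0 < s → Θ + s • u ≠ 0) {I I₀ I₀' : IsoClass} (h₀ : I₀ ∈ fixedPoints Θ)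
    (h₀' : I₀' ∈ fixedPoints Θ) {r r' : ℕ} (h : I ∈ fibre Θ' I₀.rep S r)
    (h' : I ∈ fibre Θ' I₀'.rep S r') : I₀ = I₀' := by
  obtain ⟨e, e', he, hv⟩ := FramedRep.IsFactor.equivalent (isFramedSemistable_of_mem hadj hne h.1)
    (h.2.dimensions hS).1 (h'.2.dimensions hS).1 h₀.1 h₀'.1
  exact IsoClass.eq_of_equiv _ _ e e' he hv

end

section

open ConifoldRep


/-! ### The stable objects on the walls -/

variable {d₀ d₁ e₀ e₁ s₀ s₁ : ℕ}

theorem isHom_ofB {P Q : Type} [AddCommGroup P] [Module ℂ P] [AddCommGroup Q] [Module ℂ Q]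
    {c : ConifoldRep P Q} {b : Fin 2 → Matrix (Fin d₀) (Fin d₁) ℂ} {f : P →ₗ[ℂ] (Fin d₀ → ℂ)}
    {g : Q →ₗ[ℂ] (Fin d₁ → ℂ)} (h : IsHom c (ofY fun i => (b i).mulVecLin) f g) :
    IsHom c (QRep.ofB b).toConifold f g where
  x i p := (h.x i p).trans (by simp [QRep.ofB])
  y := h.y
  z p := (h.z p).trans (by simp [QRep.ofB])
  w p := (h.w p).trans (by simp [QRep.ofB])

theorem isHom_ofA {P Q : Type} [AddCommGroup P] [Module ℂ P] [AddCommGroup Q] [Module ℂ Q]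
    {c : ConifoldRep P Q} {a : Fin 2 → Matrix (Fin d₁) (Fin d₀) ℂ} {f : P →ₗ[ℂ] (Fin d₀ → ℂ)}
    {g : Q →ₗ[ℂ] (Fin d₁ → ℂ)} (h : IsHom c.swap (ofY fun i => (a i).mulVecLin) g f) :
    IsHom c (QRep.ofA a).toConifold f g where
  x := h.y
  y i p := (h.x i p).trans (by simp [QRep.ofA])
  z p := (h.w p).trans (by simp [QRep.ofA])
  w p := (h.z p).trans (by simp [QRep.ofA])

variable {k : ℕ} {Θ Θp Θm : ℝ × ℝ}

theorem isUniqueStable_SmMinus (hk : 1 ≤ k) (h : Θ ∈ LmMinus k) : (SmMinus k).IsUniqueStable Θ := by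
  obtain ⟨m, rfl⟩ := Nat.exists_eq_add_of_le' hk
  obtain ⟨hlt, hm⟩ := h
  intro d₀ d₁ R hR hz hw
  obtain ⟨f, g, hfg⟩ := hR.exists_equiv_upMat m hlt (by push_cast at hm; linarith) hz hw
  exact ⟨f, g, isHom_ofB hfg⟩

theorem isUniqueStable_SmPlus (h : Θ ∈ LmPlus k) : (SmPlus k).IsUniqueStable Θ := by
  obtain ⟨hlt, hm⟩ := h
  intro d₀ d₁ R hR hz hw
  obtain ⟨f, g, hfg⟩ := hR.exists_equiv_downMat k hlt hm hz hw
  exact ⟨f, g, isHom_ofB hfg⟩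

theorem isUniqueStable_SpMinus (hk : 1 ≤ k) (h : Θ ∈ LpMinus k) : (SpMinus k).IsUniqueStable Θ := by
  obtain ⟨m, rfl⟩ := Nat.exists_eq_add_of_le' hk
  obtain ⟨hlt, hm⟩ := h
  intro d₀ d₁ R hR hz hw
  obtain ⟨f, g, hfg⟩ := hR.swap.exists_equiv_downMat m hlt
    (by push_cast at hm; simp only [Prod.fst_swap, Prod.snd_swap]; linarith) hw hz
  exact ⟨g, f, isHom_ofA hfg⟩

theorem isUniqueStable_SpPlus (h : Θ ∈ LpPlus k) : (SpPlus k).IsUniqueStable Θ := by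
  obtain ⟨hlt, hm⟩ := h
  intro d₀ d₁ R hR hz hw
  obtain ⟨f, g, hfg⟩ := hR.swap.exists_equiv_upMat k hlt
    (by simp only [Prod.fst_swap, Prod.snd_swap]; linarith) hw hz
  exact ⟨g, f, isHom_ofA hfg⟩

/-- The displacement is parallel to an axis. Reaching the origin would make one coordinate of `Θ`
zero, and the wall equation would then annihilate the other, contrary to `θ₀ ≠ θ₁`. -/
theorem exists_isAdjacent {b : ℝ} (h : AreAdjacentAcross k Θ Θp Θm) (hΘ : Θ.1 ≠ Θ.2)
    (hb : (k : ℝ) * Θ.1 + b * Θ.2 = 0) (hb0 : k = 0 → b ≠ 0) :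
    ∃ up um : ℝ × ℝ, IsAdjacent Θ up Θp ∧ IsAdjacent Θ um Θm ∧
      (∀ s : ℝ, 0 < s → Θ + s • up ≠ 0) ∧ ∀ s : ℝ, 0 < s → Θ + s • um ≠ 0 := by
  rw [AreAdjacentAcross] at h
  have key : ∀ (s : ℝ) (u : ℝ × ℝ), (k = 0 → u.1 = 0) → (k ≠ 0 → u.2 = 0) → Θ + s • u ≠ 0 := by
    intro s u h0 h1 e
    have e1 : Θ.1 + s * u.1 = 0 := congrArg Prod.fst e
    have e2 : Θ.2 + s * u.2 = 0 := congrArg Prod.snd e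
    by_cases hk : k = 0
    · have hb0 := hb0 hk
      rw [h0 hk, mul_zero, add_zero] at e1
      rw [hk, Nat.cast_zero, zero_mul, zero_add] at hb
      exact hΘ (e1.trans ((mul_eq_zero.1 hb).resolve_left hb0).symm)
    · rw [h1 hk, mul_zero, add_zero] at e2
      rw [e2, mul_zero, add_zero] at hb
      exact hΘ (((mul_eq_zero.1 hb).resolve_left (Nat.cast_ne_zero.2 hk)).trans e2.symm)
  split_ifs at h with hk
  · exact ⟨_, _, h.1, h.2, fun s _ => key s _ (fun _ => rfl) (fun hk' => absurd hk hk'),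
      fun s _ => key s _ (fun _ => rfl) (fun hk' => absurd hk hk')⟩
  · exact ⟨_, _, h.1, h.2, fun s _ => key s _ (fun hk' => absurd hk' hk) (fun _ => rfl),
      fun s _ => key s _ (fun hk' => absurd hk' hk) (fun _ => rfl)⟩

theorem IsAdjacent.notMem_walls {u Θ' : ℝ × ℝ} (h : IsAdjacent Θ u Θ') : Θ' ∉ walls := by
  obtain ⟨ε, hε, rfl, hw⟩ := h
  exact hw ε hε le_rfl

/-! ### Generating series -/

/-- The exponent with entries `m`, `n`. -/
def biexp (m n : ℕ) : Fin 2 →₀ ℕ := Finsupp.single 0 m + Finsupp.single 1 n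

@[simp] theorem biexp_zero (m n : ℕ) : biexp m n 0 = m := by simp [biexp]

@[simp] theorem biexp_one (m n : ℕ) : biexp m n 1 = n := by simp [biexp]

theorem eq_biexp_iff {e : Fin 2 →₀ ℕ} {m n : ℕ} : e = biexp m n ↔ e 0 = m ∧ e 1 = n := by
  rw [DFunLike.ext_iff, Fin.forall_fin_two, biexp_zero, biexp_one]

theorem biexp_ne_zero {m n : ℕ} (h : m + n ≠ 0) : biexp m n ≠ 0 := by
  intro e
  obtain ⟨h1, h2⟩ := eq_biexp_iff.1 e.symm
  simp only [Finsupp.coe_zero, Pi.zero_apply] at h1 h2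
  omega

theorem coeff_monomial_mul_subst_of_eq {R : Type} [CommRing R] {x a e : Fin 2 →₀ ℕ} (hx : x ≠ 0)
    {r : ℕ} (he : e = a + r • x) (f : PowerSeries R) :
    MvPowerSeries.coeff e (MvPowerSeries.monomial a (1 : R) *
      PowerSeries.subst (MvPowerSeries.monomial x (1 : R)) f) = PowerSeries.coeff r f := by
  classical
  rw [he, MvPowerSeries.coeff_add_monomial_mul, one_mul,
    PowerSeries.coeff_subst (PowerSeries.HasSubst.monomial hx 1), finsum_eq_single _ r]
  · rw [MvPowerSeries.monomial_pow, one_pow, MvPowerSeries.coeff_monomial_same, smul_eq_mul, mul_one]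
  · intro n hn
    rw [MvPowerSeries.monomial_pow, one_pow, MvPowerSeries.coeff_monomial_ne, smul_zero]
    intro h
    obtain ⟨i, hi⟩ := DFunLike.ne_iff.1 hx
    have h' : r * x i = n * x i := DFunLike.congr_fun h i
    exact hn (Nat.eq_of_mul_eq_mul_right (Nat.pos_of_ne_zero hi) h').symm

theorem coeff_monomial_mul_subst_of_ne {R : Type} [CommRing R] {x a e : Fin 2 →₀ ℕ} (hx : x ≠ 0)
    (he : ∀ r : ℕ, e ≠ a + r • x) (f : PowerSeries R) :
    MvPowerSeries.coeff e (MvPowerSeries.monomial a (1 : R) *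
      PowerSeries.subst (MvPowerSeries.monomial x (1 : R)) f) = 0 := by
  classical
  rw [MvPowerSeries.coeff_monomial_mul]
  split_ifs with hle
  · rw [one_mul, PowerSeries.coeff_subst (PowerSeries.HasSubst.monomial hx 1)]
    refine finsum_eq_zero_of_forall_eq_zero fun r => ?_
    rw [MvPowerSeries.monomial_pow, one_pow, MvPowerSeries.coeff_monomial_ne, smul_zero]
    intro h
    exact he r (by rw [← h, add_tsub_cancel_of_le hle])
  · rfl

theorem mem_fixedPointsOf_iff {I : IsoClass} {e : Fin 2 →₀ ℕ} :
    I ∈ fixedPointsOf Θ (e 0) ((e 0 : ℤ) - (e 1 : ℤ)) ↔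
      I ∈ fixedPoints Θ ∧ e = biexp I.dim₀ I.dim₁ := by
  change _ ∧ (I.dim₀ : ℤ) = _ ∧ (I.dim₀ : ℤ) - (I.dim₁ : ℤ) = _ ↔ _
  rw [eq_biexp_iff]
  refine and_congr_right fun _ => ?_
  omega

/-- Grouping the fixed points by framed factor: over `J`, the exponent is that of `J` plus a
multiple of that of `S`, so at most one coefficient of the fibre series contributes to `e`. A finite
set `E` of factors suffices for one coefficient. -/
theorem coeff_genSeries {u Θ' : ℝ × ℝ} {S : QRep s₀ s₁} (hs : s₀ + s₁ ≠ 0)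
    (hS : S.toConifold.totalSlope Θ = 0) (hadj : IsAdjacent Θ u Θ')
    (hne : ∀ s : ℝ, 0 < s → Θ + s • u ≠ 0) (base : IsoClass → IsoClass) (r : IsoClass → ℕ)
    (hbase : ∀ I ∈ fixedPoints Θ', base I ∈ fixedPoints Θ ∧ I ∈ fibre Θ' (base I).rep S (r I))
    (τ : IsoClass → Signs) (e : Fin 2 →₀ ℕ) (E : Finset IsoClass) (hE : ∀ I ∈ E, I ∈ fixedPoints Θ)
    (hbE : ∀ I ∈ fixedPointsOf Θ' (e 0) ((e 0 : ℤ) - (e 1 : ℤ)), base I ∈ E) :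
    MvPowerSeries.coeff e (genSeries Θ' fun I => τ (base I) I) =
      MvPowerSeries.coeff e (∑ J ∈ E, MvPowerSeries.monomial (biexp J.dim₀ J.dim₁) (1 : Lam) *
        PowerSeries.subst (MvPowerSeries.monomial (biexp s₀ s₁) (1 : Lam))
          (fibreSeries Θ' (τ J) J.rep S)) := by
  classical
  have hx : biexp s₀ s₁ ≠ 0 := biexp_ne_zero hs
  have hfin := finite_fixedPointsOf (e 0) ((e 0 : ℤ) - (e 1 : ℤ)) hadj.notMem_walls
  have hdim : ∀ (I J : IsoClass) (n : ℕ), I ∈ fibre Θ' J.rep S n →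
      biexp I.dim₀ I.dim₁ = biexp J.dim₀ J.dim₁ + n • biexp s₀ s₁ := by
    intro I J n h
    obtain ⟨-, h0, h1⟩ := h.2.dimensions hS
    rw [eq_comm, eq_biexp_iff]
    simp [h0, h1]
  have hmem : ∀ I J n, J ∈ fixedPoints Θ → I ∈ fibre Θ' J.rep S n → base I = J :=
    fun I J n hJ h => fibre_unique hS hadj hne (hbase I h.1).1 hJ (hbase I h.1).2 h
  have hlhs : MvPowerSeries.coeff e (genSeries Θ' fun I => τ (base I) I) =
      ∑ I ∈ hfin.toFinset, weight (fun I => τ (base I) I) I :=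
    finsum_mem_eq_finite_toFinset_sum _ hfin
  rw [hlhs, map_sum, ← Finset.sum_fiberwise_of_maps_to (t := E) (g := base)
    fun I hI => hbE I (hfin.mem_toFinset.1 hI)]
  refine Finset.sum_congr rfl fun J hJ => ?_
  by_cases hr : ∃ n : ℕ, e = biexp J.dim₀ J.dim₁ + n • biexp s₀ s₁
  · obtain ⟨n, hn⟩ := hr
    have hset : fibre Θ' J.rep S n =
        ((hfin.toFinset.filter fun I => base I = J : Finset IsoClass) : Set IsoClass) := by
      ext I
      rw [Finset.mem_coe, Finset.mem_filter, hfin.mem_toFinset, mem_fixedPointsOf_iff]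
      constructor
      · intro h
        exact ⟨⟨h.1, by rw [hn, hdim I J n h]⟩, hmem I J n (hE J hJ) h⟩
      · rintro ⟨⟨h1, h2⟩, rfl⟩
        have h3 := (hbase I h1).2
        have h4 := hdim _ _ _ h3
        rw [← h2, hn] at h4
        obtain ⟨i, hi⟩ := DFunLike.ne_iff.1 hx
        have h5 : n * biexp s₀ s₁ i = r I * biexp s₀ s₁ i :=
          DFunLike.congr_fun (add_left_cancel h4) i
        -- The number of copies of `S` is determined by the exponent because the dimension vector of
        -- `S` is nonzero.
        rw [Nat.eq_of_mul_eq_mul_right (Nat.pos_of_ne_zero hi) h5]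
        exact h3
    rw [coeff_monomial_mul_subst_of_eq hx hn, fibreSeries, PowerSeries.coeff_mk, hset,
      finsum_mem_coe_finset]
    refine Finset.sum_congr rfl fun I hI => ?_
    rw [weight, weight, (Finset.mem_filter.1 hI).2]
  · rw [coeff_monomial_mul_subst_of_ne hx fun n hn => hr ⟨n, hn⟩]
    refine Finset.sum_eq_zero fun I hI => ?_
    obtain ⟨h1, rfl⟩ := Finset.mem_filter.1 hI
    rw [hfin.mem_toFinset, mem_fixedPointsOf_iff] at h1
    exact absurd ⟨_, h1.2.trans (hdim _ _ _ (hbase I h1.1).2)⟩ hr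

/-! ### The zero representation -/

theorem contribution_of_dim_zero (V : FramedRep d₀ d₁) (h₀ : d₀ = 0) (h₁ : d₁ = 0) :
    V.contribution = 1 := by
  subst h₀ h₁
  have h : Nonempty (EquivariantStructure V) :=
    ⟨⟨V, FramedRep.Iso.equivalence.refl V, Fin.elim0, Fin.elim0, fun _ p => p.elim0,
      fun _ p => p.elim0, fun p => p.elim0, fun p => p.elim0, fun p => p.elim0⟩⟩
  have hE : ∀ E : EquivariantStructure V, E.contribution = 1 := fun E => by
    simp [EquivariantStructure.contribution, EquivariantStructure.sqrtChi,
      EquivariantStructure.chiZ, EquivariantStructure.K₀, EquivariantStructure.K₁, eulerT, eulerTm]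
  rw [FramedRep.contribution, dif_pos h, hE]

theorem isoClass_eq_of_dim_zero {I J : IsoClass} (h : I.dim₀ = 0 ∧ I.dim₁ = 0)
    (h' : J.dim₀ = 0 ∧ J.dim₁ = 0) : I = J := by
  have e0 : IsEmpty (Fin J.dim₀) := by rw [h'.1]; infer_instance
  have e1 : IsEmpty (Fin J.dim₁) := by rw [h'.2]; infer_instance
  exact IsoClass.eq_of_equiv I J (LinearEquiv.ofFinrankEq _ _ (by simp [h.1, h'.1]))
    (LinearEquiv.ofFinrankEq _ _ (by simp [h.2, h'.2]))
    ⟨fun _ _ => Subsingleton.elim _ _, fun _ _ => Subsingleton.elim _ _,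
      fun _ => Subsingleton.elim _ _, fun _ => Subsingleton.elim _ _⟩ (Subsingleton.elim _ _)

theorem mem_fixedPoints_of_dim_zero {I : IsoClass} (h : I.dim₀ = 0 ∧ I.dim₁ = 0) :
    I ∈ fixedPoints Θ := by
  have e0 : IsEmpty (Fin I.dim₀) := by rw [h.1]; infer_instance
  have e1 : IsEmpty (Fin I.dim₁) := by rw [h.2]; infer_instance
  refine ⟨⟨fun W hW => absurd ⟨Subsingleton.elim _ _, Subsingleton.elim _ _⟩ hW, fun W _ hW =>
    absurd ⟨Subsingleton.elim _ _, Subsingleton.elim _ _⟩ hW⟩, fun t _ => ?_⟩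
  exact (FramedRep.iso_iff _ _).2 ⟨LinearEquiv.refl _ _, LinearEquiv.refl _ _,
    ⟨fun _ _ => Subsingleton.elim _ _, fun _ _ => Subsingleton.elim _ _,
      fun _ => Subsingleton.elim _ _, fun _ => Subsingleton.elim _ _⟩, Subsingleton.elim _ _⟩

instance : Nonempty IsoClass :=
  ⟨⟨(0, 0), Quotient.mk (FramedRep.setoid 0 0) ⟨QRep.ofA fun _ => 0, 0⟩⟩⟩

/-- The only system with both dimensions zero contributes `1` up to sign, and this is the constant
term. -/
theorem isUnit_genSeries (Θ : ℝ × ℝ) (σ : Signs) : IsUnit (genSeries Θ σ) := by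
  let I : IsoClass := ⟨(0, 0), Quotient.mk (FramedRep.setoid 0 0) ⟨QRep.ofA fun _ => 0, 0⟩⟩
  have hI : I.dim₀ = 0 ∧ I.dim₁ = 0 := ⟨rfl, rfl⟩
  have hset : fixedPointsOf Θ 0 0 = {I} := by
    ext J
    constructor
    · rintro ⟨-, h0, h1⟩
      simp only [IsoClass.n, IsoClass.deg] at h0 h1
      exact isoClass_eq_of_dim_zero ⟨by omega, by omega⟩ hI
    · rintro rfl
      exact ⟨mem_fixedPoints_of_dim_zero hI, rfl, rfl⟩
  have hc : MvPowerSeries.constantCoeff (genSeries Θ σ) = ((σ I : ℤ) : Lam) := by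
    change tautInv Θ σ 0 0 = _
    rw [tautInv, hset, finsum_mem_singleton, weight, contribution_of_dim_zero _ hI.1 hI.2, mul_one]
  rw [MvPowerSeries.isUnit_iff_constantCoeff, hc]
  exact (σ I).isUnit.map (Int.castRingHom Lam)

theorem quotientFormula_of_conjectureAt {S : QRep k s₁} {d : ℤ} (hd : d = k - s₁) (hs : k + s₁ ≠ 0)
    (hS : S.IsUniqueStable Θ) (hS0 : S.toConifold.totalSlope Θ = 0) (hΘ : Θ.1 ≠ Θ.2)
    (hadj : AreAdjacentAcross k Θ Θp Θm) (hconj : ConjectureAt Θ Θp Θm k S) :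
    QuotientFormula Θp Θm k d := by
  classical
  obtain ⟨up, um, hp, hm, hnp, hnm⟩ := exists_isAdjacent (b := s₁) hadj hΘ
    (by simp only [totalSlope, finrank_fin_fun] at hS0; linarith)
    fun h0 => Nat.cast_ne_zero.2 (by omega)
  refine ⟨fun n d => ⟨finite_fixedPointsOf n d hp.notMem_walls,
    finite_fixedPointsOf n d hm.notMem_walls⟩, ?_⟩
  choose! bp hbp rp hrp using fun I => exists_mem_fibre (I := I) hS hp hnp
  choose! bm hbm rm hrm using fun I => exists_mem_fibre (I := I) hS hm hnm
  choose! τp τm hτ using fun (J : IsoClass) (hJ : J ∈ fixedPoints Θ) => hconj _ _ J.rep hJ.1 hJ.2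
  -- The Conjecture gives signs depending on the framed factor; they are combined by evaluating at
  -- the factor of each system.
  refine ⟨fun I => τp (bp I) I, fun I => τm (bm I) I, isUnit_genSeries _ _, ?_⟩
  have hx : qtExp k d = biexp k s₁ := by
    rw [qtExp, biexp, hd, sub_sub_cancel, Int.toNat_natCast]
  ext e
  -- A coefficient of a product involves all exponents below `e`, so the factors from both sides of
  -- the wall and for all these exponents are collected. Finiteness comes from the adjacent
  -- chambers, not from the wall itself.
  let D : Set IsoClass := ⋃ a ∈ Set.Iic e,
    bp '' fixedPointsOf Θp (a 0) ((a 0 : ℤ) - (a 1 : ℤ)) ∪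
      bm '' fixedPointsOf Θm (a 0) ((a 0 : ℤ) - (a 1 : ℤ))
  have hD : D.Finite := (Set.finite_Iic e).biUnion fun a _ =>
    ((finite_fixedPointsOf _ _ hp.notMem_walls).image _).union
      ((finite_fixedPointsOf _ _ hm.notMem_walls).image _)
  have hE : ∀ J ∈ hD.toFinset, J ∈ fixedPoints Θ := by
    intro J hJ
    obtain ⟨a, -, ⟨I, hI, rfl⟩ | ⟨I, hI, rfl⟩⟩ := Set.mem_iUnion₂.1 (hD.mem_toFinset.1 hJ)
    · exact hbp I hI.1
    · exact hbm I hI.1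
  have hEp : ∀ a ≤ e, ∀ I ∈ fixedPointsOf Θp (a 0) ((a 0 : ℤ) - (a 1 : ℤ)), bp I ∈ hD.toFinset :=
    fun a ha I hI => hD.mem_toFinset.2 (Set.mem_iUnion₂.2 ⟨a, ha, Or.inl ⟨I, hI, rfl⟩⟩)
  have hEm : ∀ a ≤ e, ∀ I ∈ fixedPointsOf Θm (a 0) ((a 0 : ℤ) - (a 1 : ℤ)), bm I ∈ hD.toFinset :=
    fun a ha I hI => hD.mem_toFinset.2 (Set.mem_iUnion₂.2 ⟨a, ha, Or.inr ⟨I, hI, rfl⟩⟩)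
  rw [coeff_genSeries hs hS0 hp hnp bp rp (fun I hI => ⟨hbp I hI, hrp I hI⟩) τp e _ hE
    (hEp e le_rfl)]
  have hsum : ∑ J ∈ hD.toFinset, MvPowerSeries.monomial (biexp J.dim₀ J.dim₁) (1 : Lam) *
        PowerSeries.subst (MvPowerSeries.monomial (biexp k s₁) (1 : Lam))
          (fibreSeries Θp (τp J) J.rep S) =
      (∑ J ∈ hD.toFinset, MvPowerSeries.monomial (biexp J.dim₀ J.dim₁) (1 : Lam) *
        PowerSeries.subst (MvPowerSeries.monomial (biexp k s₁) (1 : Lam))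
          (fibreSeries Θm (τm J) J.rep S)) * oneSubQTPow k d ((k : Lam) * (Lam.m / Lam.l₃)) := by
    rw [Finset.sum_mul]
    refine Finset.sum_congr rfl fun J hJ => ?_
    rw [hτ J (hE J hJ), PowerSeries.subst_mul (PowerSeries.HasSubst.monomial (biexp_ne_zero hs) 1),
      oneSubQTPow, hx, mul_assoc]
  rw [hsum, MvPowerSeries.coeff_mul, MvPowerSeries.coeff_mul]
  refine Finset.sum_congr rfl fun p hpe => ?_
  rw [coeff_genSeries hs hS0 hm hnm bm rm (fun I hI => ⟨hbm I hI, hrm I hI⟩) τm p.1 _ hE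
    (hEm p.1 (Finset.HasAntidiagonal.mem_antidiagonal.1 hpe ▸ le_self_add))]

end

end WallCrossing

end

theorem proposition3p8 (hconj : WallCrossing.WallCrossingConjecture) :
    (∀ (k : ℕ) (Θ Θp Θm : ℝ × ℝ), 1 ≤ k →
      (Θ ∈ WallCrossing.LmMinus k ∨ Θ ∈ WallCrossing.LpMinus k) →
      WallCrossing.AreAdjacentAcross k Θ Θp Θm →
      WallCrossing.QuotientFormula Θp Θm k 1) ∧
    (∀ (k : ℕ) (Θ Θp Θm : ℝ × ℝ),
      (Θ ∈ WallCrossing.LmPlus k ∨ Θ ∈ WallCrossing.LpPlus k) →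
      WallCrossing.AreAdjacentAcross k Θ Θp Θm →
      WallCrossing.QuotientFormula Θp Θm k (-1)) := by
  have hslope : ∀ {s₀ s₁ : ℕ} (S : WallCrossing.QRep s₀ s₁) (Θ : ℝ × ℝ),
      S.toConifold.totalSlope Θ = Θ.1 * s₀ + Θ.2 * s₁ := fun S Θ => by
    simp [WallCrossing.ConifoldRep.totalSlope]
  refine ⟨fun k Θ Θp Θm hk hΘ hadj => ?_, fun k Θ Θp Θm hΘ hadj => ?_⟩
  · have hd : (1 : ℤ) = k - (k - 1 : ℕ) := by omega
    have hs : k + (k - 1) ≠ 0 := by omega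
    have hk' : ((k - 1 : ℕ) : ℝ) = k - 1 := Nat.cast_pred hk
    rcases hΘ with h | h
    · exact WallCrossing.quotientFormula_of_conjectureAt hd hs
        (WallCrossing.isUniqueStable_SmMinus hk h)
        (by rw [hslope, hk']; linarith [h.2]) h.1.ne hadj ((hconj.1 k hk Θ Θp Θm hadj).1 h)
    · exact WallCrossing.quotientFormula_of_conjectureAt hd hs
        (WallCrossing.isUniqueStable_SpMinus hk h)
        (by rw [hslope, hk']; linarith [h.2]) h.1.ne' hadj ((hconj.1 k hk Θ Θp Θm hadj).2 h)
  · have hd : (-1 : ℤ) = k - (k + 1 : ℕ) := by omega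
    have hs : k + (k + 1) ≠ 0 := by omega
    rcases hΘ with h | h
    · exact WallCrossing.quotientFormula_of_conjectureAt hd hs (WallCrossing.isUniqueStable_SmPlus h)
        (by rw [hslope]; push_cast; linarith [h.2]) h.1.ne hadj ((hconj.2 k Θ Θp Θm hadj).1 h)
    · exact WallCrossing.quotientFormula_of_conjectureAt hd hs (WallCrossing.isUniqueStable_SpPlus h)
        (by rw [hslope]; push_cast; linarith [h.2]) h.1.ne' hadj ((hconj.2 k Θ Θp Θm hadj).2 h)
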